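/- **Notation.** Let $n\ge 1$ be an integer and $\mu_1,\mu_2\in\mathbb R$. Put $\delta=(\mu_1-1)^2-4\mu_2$ and $$\gamma_F(p,\nu)=2-\nu(p-1),\qquad \gamma_S(p,\nu)=2+(\nu+1)p-(\nu-1)p^2,$$ $$p_F(\nu)=\begin{cases}1+\frac2\nu,&\nu>0,\\+\infty,&\nu\le 0,\end{cases}\qquad p_S(\nu)=\begin{cases}\frac{\nu+1+\sqrt{\nu^2+10\nu-7}}{2(\nu-1)},&\nu>1,\\+\infty,&\nu\le1,\end{cases}$$ $$d_*(\nu)=\begin{cases}\frac12\left(-1-\nu+\sqrt{\nu^2+10\nu-7}\right),&\nu>1,\\0,&\nu\le1.\end{cases}$$ For $\delta\ge0$ put $$p_{\mu_1,\delta}(n)=\max\left\{p_F\left(n+\tfrac{\mu_1-1-\sqrt\delta}{2}\right),\,p_S(n+\mu_1)\right\},\qquad p_*=\begin{cases}1+\frac{n-\sqrt\delta+2}{n+\mu_1-1},&n+\mu_1\ne1,\\+\infty,&n+\mu_1=1.\end{cases}$$ Put $\operatorname{sgn}\delta=1$ if $\delta>0$ and $\operatorname{sgn}0=0$. **Equation.**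 Consider $$u_{tt}-\Delta u+\frac{\mu_1}{1+t}u_t+\frac{\mu_2}{(1+t)^2}u=|u|^p \text{ in }\mathbb R^n\times(0,T),\qquad u(x,0)=\varepsilon f(x),\quad u_t(x,0)=\varepsilon g(x).\tag{1}$$ An *energy solution* of (1) on $[0,T)$ is a function $u\in C([0,T),H^1(\mathbb R^n))\cap C^1([0,T),L^2(\mathbb R^n))\cap C((0,T),L^p_{loc}(\mathbb R^n))$ with $|u|^p$ integrable on $K\times(0,t)$ for every compact $K\subset\mathbb R^n$ and every $t<T$, with $u(\cdot,0)=\varepsilon f$ and $u_t(\cdot,0)=\varepsilon g$, such that for every $t\in[0,T)$ and every $\phi\in C_0^\infty(\mathbb R^n\times[0,T))$ $$\int u_t(x,t)\phi(x,t)\,dx-\int\varepsilon g(x)\phi(x,0)\,dx+\int_0^t\!\!\int\{-u_t\phi_t+\nabla u\cdot\nabla\phi\}\,dx\,ds+\int_0^t\!\!\int\left\{\frac{\mu_1}{1+s}u_t\phi+\frac{\mu_2}{(1+s)^2}u\phi\right\}dx\,ds=\int_0^t\!\!\int|u|^p\phi\,dx\,ds .$$ For $R\ge1$ let $T_\varepsilon\in[0,\infty]$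 be the lifespan (blow-up time): the supremum of all $T>0$ such that (1) has an energy solution $u$ on $[0,T)$ with $$\operatorname{supp}u\subset\{(x,t):|x|\le t+R\}.$$ **Theorem.** Let $\mu_1\ge0$, $\mu_2\in\mathbb R$, $\delta\ge0$, $1<p<p_{\mu_1,\delta}(n)$ and $R\ge1$. Let $f\in H^1(\mathbb R^n)$ and $g\in L^2(\mathbb R^n)$ satisfy $f\ge0$, $f\not\equiv0$ (almost everywhere) and $$h:=\frac{\mu_1-1+\sqrt\delta}{2}f+g=0.$$ Then there are constants $\varepsilon_4>0$ and $C>0$, depending only on $n,\mu_1,\mu_2,p,R,f,g$ and not on $\varepsilon$, such that for all $0<\varepsilon\le\varepsilon_4$ the following hold. * If $\sqrt\delta\le n-d_*(n+\mu_1)$, then $T_\varepsilon\le C\varepsilon^{-2p(p-1)/\gamma_S(p,n+\mu_1)}$. * If $n-d_*(n+\mu_1)<\sqrt\delta<n+2$, then $$T_\varepsilon\le\begin{cases}C\varepsilon^{-2p(p-1)/\gamma_S(p,n+\mu_1)}&\text{if }1<p<p_*,\\ C\sigma_*(\varepsilon)&\text{if }p=p_*,\\ C\sigma(\varepsilon)&\text{if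 }p_*<p<p_{\mu_1,\delta}(n).\end{cases}$$ * If $\sqrt\delta\ge n+2$, then $T_\varepsilon\le C\sigma(\varepsilon)$. Here $\sigma=\sigma(\varepsilon)$ and $\sigma_*=\sigma_*(\varepsilon)$ are, in the cases in which they occur, the unique positive solutions of $$\varepsilon^p\,\sigma^{\frac{\gamma_F(p,\,n+(\mu_1-1-\sqrt\delta)/2)}{p-1}}\ln(1+\sigma)^{1-\operatorname{sgn}\delta}=1,\qquad \varepsilon^p\,\sigma_*^{\frac{\gamma_F(p,\,n+(\mu_1-1-\sqrt\delta)/2)}{p-1}}\ln(1+\sigma_*)^{2-\operatorname{sgn}\delta}=1 .$$ * Moreover, if $n=1$, $0\le\delta<1$ and $1<p<r_*(\mu_1,\delta)$, then $$T_\varepsilon\le C\varepsilon^{-(p-1)/\gamma_F(p,(\mu_1+1+\sqrt\delta)/2)},$$ where, with $\theta=1+\frac{\mu_1}2-\frac12\sqrt{\mu_1^2+16}$, $$r_*(\mu_1,\delta)=\begin{cases}1+2\,\frac{2-\sqrt\delta}{1+\mu_1+\sqrt\delta},&\sqrt\delta<\theta,\\[2pt] 1+2\,\frac{2-\theta}{1+\mu_1+\theta}=\frac{2}{1+\theta},&\sqrt\delta=\theta,\\[2pt]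 \frac{2}{1+\sqrt\delta},&\sqrt\delta>\theta.\end{cases}$$ -/

import Mathlib

open MeasureTheory Set Filter Topology
open scoped ContDiff ENNReal

noncomputable section

namespace ScaleInvWave

/-! ### Exponents -/

/-- `γ_F(p,ν) = 2 - ν (p - 1)`. -/
def gammaF (p ν : ℝ) : ℝ := 2 - ν * (p - 1)

/-- `γ_S(p,ν) = 2 + (ν + 1) p - (ν - 1) p²`. -/
def gammaS (p ν : ℝ) : ℝ := 2 + (ν + 1) * p - (ν - 1) * p ^ 2

/-- The Fujita exponent, `+∞` for `ν ≤ 0`. -/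
def pF (ν : ℝ) : EReal :=
  if 0 < ν then ((1 + 2 / ν : ℝ) : EReal) else ⊤

/-- The Strauss exponent, `+∞` for `ν ≤ 1`. -/
def pS (ν : ℝ) : EReal :=
  if 1 < ν then
    (((ν + 1 + Real.sqrt (ν ^ 2 + 10 * ν - 7)) / (2 * (ν - 1)) : ℝ) : EReal)
  else ⊤

/-- `δ(μ₁,μ₂) = (μ₁ - 1)² - 4 μ₂`. -/
def delta (μ₁ μ₂ : ℝ) : ℝ := (μ₁ - 1) ^ 2 - 4 * μ₂

/-- The shifted dimension `n + (μ₁ - 1 - √δ) / 2`. -/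
def heatDim (n : ℕ) (μ₁ δ : ℝ) : ℝ := n + (μ₁ - 1 - Real.sqrt δ) / 2

/-- `p_{μ₁,δ}(n) = max {p_F(n + (μ₁ - 1 - √δ)/2), p_S(n + μ₁)}`. -/
def pCrit (n : ℕ) (μ₁ δ : ℝ) : EReal :=
  max (pF (heatDim n μ₁ δ)) (pS (n + μ₁))

/-- `d_*(ν)`. -/
def dStar (ν : ℝ) : ℝ :=
  if 1 < ν then (-1 - ν + Real.sqrt (ν ^ 2 + 10 * ν - 7)) / 2 else 0

/-- `p_*(n + μ₁, n - √δ)`, equal to `+∞` when `n + μ₁ = 1`. -/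
def pStar (n : ℕ) (μ₁ δ : ℝ) : EReal :=
  if (n : ℝ) + μ₁ = 1 then ⊤
  else ((1 + (n - Real.sqrt δ + 2) / (n + μ₁ - 1) : ℝ) : EReal)

/-- `θ(μ₁)`. -/
def theta (μ₁ : ℝ) : ℝ := 1 + μ₁ / 2 - Real.sqrt (μ₁ ^ 2 + 16) / 2

/-- `r_*(μ₁,δ)`. -/
def rStar (μ₁ δ : ℝ) : ℝ :=
  if Real.sqrt δ < theta μ₁ then
    1 + 2 * ((2 - Real.sqrt δ) / (1 + μ₁ + Real.sqrt δ))
  else if Real.sqrt δ = theta μ₁ then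
    1 + 2 * ((2 - theta μ₁) / (1 + μ₁ + theta μ₁))
  else 2 / (1 + Real.sqrt δ)

/-! ### Function spaces -/

/-- Euclidean space `ℝⁿ`. -/
abbrev Rn (n : ℕ) : Type := EuclideanSpace ℝ (Fin n)

/-- `L²(ℝⁿ)`. -/
abbrev L2 (n : ℕ) : Type := Lp ℝ 2 (volume : Measure (Rn n))

/-- `L²(ℝⁿ; ℝⁿ)`. -/
abbrev L2vec (n : ℕ) : Type := Lp (Rn n) 2 (volume : Measure (Rn n))

/-- `G ∈ L²(ℝⁿ; ℝⁿ)` is the weak (distributional) gradient of `w ∈ L²(ℝⁿ)`. -/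
def IsWeakGradient {n : ℕ} (w : L2 n) (G : L2vec n) : Prop :=
  ∀ η : Rn n → ℝ, ContDiff ℝ ∞ η → HasCompactSupport η → ∀ e : Rn n,
    ∫ x, w x * fderiv ℝ η x e = - ∫ x, inner ℝ (G x) e * η x

/-- `w ∈ H¹(ℝⁿ)`. -/
def MemH1 {n : ℕ} (w : L2 n) : Prop := ∃ G : L2vec n, IsWeakGradient w G

/-- A test function in `C_0^∞(ℝⁿ × [0,T))`, given by a smooth extension to negative times. Its
support may meet the initial hyperplane `t = 0`. -/
structure IsTestFunction {n : ℕ} (T : ℝ) (φ : Rn n × ℝ → ℝ) : Prop where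
  smooth : ContDiff ℝ ∞ φ
  compact : HasCompactSupport φ
  support : tsupport φ ⊆ {z | z.2 < T}

/-! ### Energy solutions -/

/-- `u` is an energy solution over `[0,T)` of
`u_tt - Δu + μ₁/(1+t) u_t + μ₂/(1+t)² u = |u|^p`, `u(0) = ε f`, `u_t(0) = ε g`,
with time derivative `ut` and spatial gradient `Du`. Only the values at times in `[0,T)` matter. -/
structure IsEnergySolution {n : ℕ} (μ₁ μ₂ p : ℝ) (f g : L2 n) (ε T : ℝ)
    (u ut : ℝ → L2 n) (Du : ℝ → L2vec n) : Prop where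
  /-- `u ∈ C([0,T), H¹)`: `Du` is the gradient, and `u`, `Du` are continuous into `L²`. -/
  weak_grad : ∀ t ∈ Ico 0 T, IsWeakGradient (u t) (Du t)
  cont_u : ContinuousOn u (Ico 0 T)
  cont_Du : ContinuousOn Du (Ico 0 T)
  /-- `u ∈ C¹([0,T), L²)`. -/
  hasDeriv : ∀ t ∈ Ico 0 T, HasDerivWithinAt u (ut t) (Ico 0 T) t
  cont_ut : ContinuousOn ut (Ico 0 T)
  /-- `u ∈ C((0,T), L^p_loc)`. -/
  memLp_loc : ∀ t ∈ Ioo 0 T, ∀ K : Set (Rn n), IsCompact K →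
    MemLp (u t) (ENNReal.ofReal p) (volume.restrict K)
  cont_Lp_loc : ∀ t ∈ Ioo 0 T, ∀ K : Set (Rn n), IsCompact K →
    Tendsto (fun s => eLpNorm (fun x => u s x - u t x) (ENNReal.ofReal p) (volume.restrict K))
      (𝓝 t) (𝓝 0)
  /-- The nonlinear term of the weak formulation is an honest (convergent) integral up to time
  zero. -/
  integrable_nonlin : ∀ t ∈ Ioo 0 T, ∀ K : Set (Rn n), IsCompact K →
    IntervalIntegrable (fun s => ∫ x in K, |u s x| ^ p) volume 0 t
  /-- Initial data. -/
  init_u : u 0 = ε • f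
  init_ut : ut 0 = ε • g
  /-- The weak formulation. -/
  weak_eq : ∀ φ : Rn n × ℝ → ℝ, IsTestFunction T φ → ∀ t ∈ Ico 0 T,
    (∫ x, ut t x * φ (x, t)) - (∫ x, ε * g x * φ (x, 0))
      + (∫ s in (0 : ℝ)..t, ∫ x,
          (-(ut s x * deriv (fun r => φ (x, r)) s)
            + fderiv ℝ (fun y => φ (y, s)) x (Du s x)))
      + (∫ s in (0 : ℝ)..t, ∫ x, μ₁ / (1 + s) * ut s x * φ (x, s))
      + (∫ s in (0 : ℝ)..t, ∫ x, μ₂ / (1 + s) ^ 2 * u s x * φ (x, s))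
    = ∫ s in (0 : ℝ)..t, ∫ x, |u s x| ^ p * φ (x, s)

/-- `supp u ⊆ {(x,t) : |x| ≤ t + R}`, for `u` defined on `[0,T)`. -/
def SupportedInCone {n : ℕ} (R T : ℝ) (u : ℝ → L2 n) : Prop :=
  ∀ t ∈ Ico 0 T, ∀ᵐ x : Rn n, t + R < ‖x‖ → u t x = 0

/-- The lifespan (blow-up time) `T_ε ∈ [0,∞]`: the supremum of all times `T > 0` for which some
energy solution on `[0,T)` supported in the cone `|x| ≤ t + R` exists. In particular no such
solution whatsoever exists on `[0,T)` if `T > T_ε`. -/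
def lifespan {n : ℕ} (μ₁ μ₂ p : ℝ) (f g : L2 n) (R ε : ℝ) : ℝ≥0∞ :=
  sSup {τ | ∃ T : ℝ, 0 < T ∧ τ = ENNReal.ofReal T ∧
    ∃ (u ut : ℝ → L2 n) (Du : ℝ → L2vec n),
      IsEnergySolution μ₁ μ₂ p f g ε T u ut Du ∧ SupportedInCone R T u}

/-! ### Lifespan bounds -/

/-- `s` is a positive solution of
`ε^p s^{γ_F(p, n + (μ₁-1-√δ)/2)/(p-1)} (log (1+s))^c = 1`. -/
def IsMixedTime (n : ℕ) (μ₁ δ p c ε s : ℝ) : Prop :=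
  0 < s ∧
    ε ^ p * s ^ (gammaF p (heatDim n μ₁ δ) / (p - 1)) * (Real.log (1 + s)) ^ c = 1

/-- The equation defining `s = s(ε)` has exactly one positive solution, and `Tε ≤ C s(ε)`. -/
def MixedBound (n : ℕ) (μ₁ δ p c C ε : ℝ) (Tε : ℝ≥0∞) : Prop :=
  (∃! s, IsMixedTime n μ₁ δ p c ε s) ∧
    ∀ s, IsMixedTime n μ₁ δ p c ε s → Tε ≤ ENNReal.ofReal (C * s)

/-- `Tε ≤ C ε^{-2p(p-1)/γ_S(p, n+μ₁)}`. -/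
def WaveBound (n : ℕ) (μ₁ p C ε : ℝ) (Tε : ℝ≥0∞) : Prop :=
  Tε ≤ ENNReal.ofReal (C * ε ^ (-(2 * p * (p - 1)) / gammaS p (n + μ₁)))

end ScaleInvWave

end

namespace ScaleInvWave

/-! ### Differential inequalities -/

/-! Write σ = √δ. Pairing the equation with a plane wave exp(ξ·x), truncated outside the support
cone, gives Y'' + μ₁/(1+t) Y' + μ₂/(1+t)² Y = |ξ|² Y + N with N ≥ 0. Because δ ≥ 0, the Euler
operator on the left factors over the reals: M = (1+t)^((μ₁-1+σ)/2) Y and a momentum G satisfy M' =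
(1+t)^(σ-1) G and G' = (1+t)^((1+μ₁-σ)/2) (|ξ|² Y + N) (`damped_to_momentum`). The condition h = 0
says exactly G(0) = 0, and f ≥ 0 gives M(0) > 0 of size ε. Hence M and G increase, but for ξ = 0 the
linear evolution keeps M constant: all growth of the mean is fed by N, which is why ε^p appears in
the lifespan.

Two applications of Hölder's inequality bound N = ∫|u|^p from below. For |ξ| = 1, Y is at least of
order ε (1+t)^(-μ₁/2) e^t (`exists_pairing_growth`). Averaging over directions, and using the L^q
size of the averaged plane wave on the cone, gives N ≥ c ε^p (1+t)^(n-1-(n+μ₁-1)p/2)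
(`exists_source_lower`). For ξ = 0, N ≥ c (1+t)^(-n(p-1)) Y^p (`exists_source_lower_mean`). This
closes a superlinear system, so Kato's argument (`kato_doubling`, `momentum_upper_bound`) bounds
M(τ/2) by a power of 1+τ whenever the solution lives beyond τ.

Each lower bound for M then restricts τ (`momentum_dichotomy`, `exists_time_control`). M ≥ M(0)
gives the one-dimensional bound with ε to the first power. Integrating N twice gives the exponent
γ_S. Retaining only a constant lower bound for G gives γ_F, with a logarithm if σ = 0. One further
logarithm appears if (1+t)^((1+μ₁-σ)/2) N is bounded below by a multiple of 1/(1+t), which is the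
case p = p_*. What remains is algebra of exponents: d_* is the value of n - √δ at which the Fujita,
Strauss and p_* exponents coincide, so in each regime the relevant γ is positive and the inequality
can be solved for τ. -/

theorem mul_sub_le_of_hasDerivAt {f f' : ℝ → ℝ} {a b c : ℝ} (hab : a ≤ b)
    (hf : ContinuousOn f (Icc a b)) (hf' : ∀ t ∈ Ioo a b, HasDerivAt f (f' t) t)
    (hc : ∀ t ∈ Ioo a b, c ≤ f' t) : c * (b - a) ≤ f b - f a := by
  refine (convex_Icc a b).mul_sub_le_image_sub_of_le_deriv hf ?_ ?_ a (left_mem_Icc.2 hab) b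
    (right_mem_Icc.2 hab) hab
  · rw [interior_Icc]
    exact fun t ht => (hf' t ht).differentiableAt.differentiableWithinAt
  · rw [interior_Icc]
    intro t ht
    rw [(hf' t ht).deriv]
    exact hc t ht

theorem monotoneOn_of_hasDerivAt_nonneg {f f' : ℝ → ℝ} {a b : ℝ}
    (hf : ContinuousOn f (Icc a b)) (hf' : ∀ t ∈ Ioo a b, HasDerivAt f (f' t) t)
    (hc : ∀ t ∈ Ioo a b, 0 ≤ f' t) : MonotoneOn f (Icc a b) := by
  intro x hx y hy hxy
  have := mul_sub_le_of_hasDerivAt (c := 0) hxy (hf.mono (Icc_subset_Icc hx.1 hy.2))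
    (fun t ht => hf' t ⟨hx.1.trans_lt ht.1, ht.2.trans_le hy.2⟩)
    (fun t ht => hc t ⟨hx.1.trans_lt ht.1, ht.2.trans_le hy.2⟩)
  linarith

/-- A continuation argument: as long as X is positive W increases, hence stays nonnegative, hence X
increases, so X can never come down to zero. It serves both for solutions and for differences of a
solution and a subsolution. -/
theorem monotoneOn_of_coupled {X W X' W' : ℝ → ℝ} {a b : ℝ}
    (hX : ContinuousOn X (Icc a b)) (hW : ContinuousOn W (Icc a b))
    (hX' : ∀ t ∈ Ioo a b, HasDerivAt X (X' t) t) (hW' : ∀ t ∈ Ioo a b, HasDerivAt W (W' t) t)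
    (h1 : ∀ t ∈ Ioo a b, 0 ≤ W t → 0 ≤ X' t) (h2 : ∀ t ∈ Ioo a b, 0 < X t → 0 ≤ W' t)
    (hXa : 0 < X a) (hWa : 0 ≤ W a) :
    MonotoneOn X (Icc a b) ∧ MonotoneOn W (Icc a b) := by
  have key : ∀ c ∈ Icc a b, (∀ t ∈ Ico a c, 0 < X t) →
      MonotoneOn X (Icc a c) ∧ MonotoneOn W (Icc a c) := by
    intro c hc hpos
    have hWm : MonotoneOn W (Icc a c) :=
      monotoneOn_of_hasDerivAt_nonneg (hW.mono (Icc_subset_Icc le_rfl hc.2))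
        (fun t ht => hW' t ⟨ht.1, ht.2.trans_le hc.2⟩)
        (fun t ht => h2 t ⟨ht.1, ht.2.trans_le hc.2⟩ (hpos t ⟨ht.1.le, ht.2⟩))
    refine ⟨monotoneOn_of_hasDerivAt_nonneg (hX.mono (Icc_subset_Icc le_rfl hc.2))
        (fun t ht => hX' t ⟨ht.1, ht.2.trans_le hc.2⟩)
        (fun t ht => h1 t ⟨ht.1, ht.2.trans_le hc.2⟩ ?_), hWm⟩
    exact hWa.trans (hWm ⟨le_rfl, hc.1⟩ ⟨ht.1.le, ht.2.le⟩ ht.1.le)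
  rcases lt_or_ge b a with hba | hab
  · simp [Icc_eq_empty_of_lt hba, MonotoneOn]
  refine key b ⟨hab, le_rfl⟩ ?_
  by_contra! hcon
  obtain ⟨t, ht, hXt⟩ := hcon
  have hS : IsCompact (Icc a b ∩ X ⁻¹' Iic 0) :=
    isCompact_Icc.of_isClosed_subset (hX.preimage_isClosed_of_isClosed isClosed_Icc isClosed_Iic)
      inter_subset_left
  -- The first time c at which X ≤ 0; monotonicity on [a, c] gives X c ≥ X a > 0.
  obtain ⟨c, ⟨hc, hXc⟩, hmin⟩ := hS.exists_isLeast ⟨t, ⟨ht.1, ht.2.le⟩, hXt⟩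
  have := (key c hc fun s hs => by
    by_contra! h
    exact absurd (hmin ⟨⟨hs.1, hs.2.le.trans hc.2⟩, h⟩) (not_le.2 hs.2)).1
      ⟨le_rfl, hc.1⟩ ⟨hc.1, le_rfl⟩ hc.1
  have h0 : X c ≤ 0 := hXc
  linarith

/-! ### Exponential growth by comparison with an explicit subsolution. -/

theorem hasDerivAt_one_add_rpow {t : ℝ} (ht : 0 ≤ t) (e : ℝ) :
    HasDerivAt (fun s : ℝ => (1 + s) ^ e) (e * (1 + t) ^ (e - 1)) t := by
  have := ((hasDerivAt_id t).const_add 1).rpow_const (p := e) (Or.inl (by simp; linarith))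
  simpa using this

theorem continuousOn_one_add_rpow (e τ : ℝ) :
    ContinuousOn (fun s : ℝ => (1 + s) ^ e) (Icc 0 τ) :=
  fun _ ht => (hasDerivAt_one_add_rpow ht.1 e).continuousAt.continuousWithinAt

/-- The subsolution `(1+t)^(-m) exp (t + a/(1+t))` and its momentum. -/
theorem subsolution_deriv (m a : ℝ) {t : ℝ} (ht : 0 ≤ t) :
    HasDerivAt (fun s : ℝ => (1 + s) ^ (-m) * Real.exp (s + a / (1 + s)))
      ((1 + t) ^ (-2 * m) *
        ((1 + t) ^ m * (1 - a / (1 + t) ^ 2 - m / (1 + t)) * Real.exp (t + a / (1 + t)))) t ∧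
    HasDerivAt (fun s : ℝ =>
        (1 + s) ^ m * (1 - a / (1 + s) ^ 2 - m / (1 + s)) * Real.exp (s + a / (1 + s)))
      ((1 + t) ^ m * ((1 - a / (1 + t) ^ 2) ^ 2 + 2 * a / (1 + t) ^ 3 - m * (m - 1) / (1 + t) ^ 2)
        * Real.exp (t + a / (1 + t))) t := by
  have h1 : (0 : ℝ) < 1 + t := by linarith
  have hd : HasDerivAt (fun s : ℝ => 1 + s) 1 t := (hasDerivAt_id t).const_add 1
  have he : HasDerivAt (fun s : ℝ => Real.exp (s + a / (1 + s)))
      (Real.exp (t + a / (1 + t)) * (1 - a / (1 + t) ^ 2)) t := by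
    have := ((hasDerivAt_id t).add ((hasDerivAt_const t a).div hd h1.ne')).exp
    refine this.congr_deriv ?_
    simp only [id, Pi.add_apply, Pi.div_apply]
    field_simp
    ring
  constructor
  · refine ((hasDerivAt_one_add_rpow ht (-m)).mul he).congr_deriv ?_
    have e1 : (1 + t) ^ (-2 * m) * (1 + t) ^ m = (1 + t) ^ (-m) := by
      rw [← Real.rpow_add h1]; congr 1; ring
    have e2 : (1 + t) ^ (-m - 1) = (1 + t) ^ (-m) / (1 + t) := by
      rw [Real.rpow_sub_one h1.ne']
    calc _ = (1 + t) ^ (-m) * (1 - a / (1 + t) ^ 2 - m / (1 + t)) * Real.exp (t + a / (1 + t)) := by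
          rw [e2]; ring
      _ = _ := by rw [← e1]; ring
  · have hq : HasDerivAt (fun s : ℝ => 1 - a / (1 + s) ^ 2 - m / (1 + s))
        (2 * a / (1 + t) ^ 3 + m / (1 + t) ^ 2) t := by
      have := (((hasDerivAt_const t a).div (hd.pow 2) (pow_ne_zero 2 h1.ne')).const_sub 1).sub
        ((hasDerivAt_const t m).div hd h1.ne')
      refine this.congr_deriv ?_
      simp only [Pi.pow_apply]
      field_simp
      ring
    refine (((hasDerivAt_one_add_rpow ht m).mul hq).mul he).congr_deriv ?_
    have e2 : (1 + t) ^ (m - 1) = (1 + t) ^ m / (1 + t) := by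
      rw [Real.rpow_sub_one h1.ne']
    simp only [Pi.mul_apply]
    rw [e2]
    field_simp
    ring

/-- The correction a/(1+t) in the exponent contributes -2a/x² at leading order. With a > |m(m-1)|
this absorbs the term m(m-1)/x², and the remaining terms are small once x ≥ 4a. -/
theorem subsolution_bound {m a x : ℝ} (ha : a = |m * (m - 1)| + 1) (hx : 4 * a ≤ x) :
    (1 - a / x ^ 2) ^ 2 + 2 * a / x ^ 3 - m * (m - 1) / x ^ 2 ≤ 1 := by
  have hk := neg_abs_le (m * (m - 1))
  have hk0 := abs_nonneg (m * (m - 1))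
  have ha1 : 1 ≤ a := by linarith
  have hx0 : 0 < x := by linarith
  have hx1 : 1 ≤ x := by linarith
  have : (1 - a / x ^ 2) ^ 2 + 2 * a / x ^ 3 - m * (m - 1) / x ^ 2 - 1
      = (-2 * a + a * (a / x ^ 2) + 2 * (a / x) - m * (m - 1)) / x ^ 2 := by
    field_simp; ring
  have h2 : a / x ≤ 1 / 4 := by rw [div_le_iff₀ hx0]; linarith
  have h3 : a / x ^ 2 ≤ 1 / 4 := by
    rw [div_le_iff₀ (by positivity)]; nlinarith
  have h4 : (-2 * a + a * (a / x ^ 2) + 2 * (a / x) - m * (m - 1)) / x ^ 2 ≤ 0 := by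
    apply div_nonpos_of_nonpos_of_nonneg _ (by positivity)
    nlinarith
  linarith

theorem one_add_rpow_ge_min {t s e : ℝ} (ht : 0 ≤ t) (hts : t ≤ s) :
    min 1 ((1 + s) ^ e) ≤ (1 + t) ^ e := by
  rcases le_total 0 e with he | he
  · exact (min_le_left _ _).trans (Real.one_le_rpow (by linarith) he)
  · exact (min_le_right _ _).trans (Real.rpow_le_rpow_of_nonpos (by linarith) (by linarith) he)

/-- The subsolution of `subsolution_deriv` works only after the time t₀ = 4a. Up to t₀ one uses that
M and G increase, and a small multiple of the subsolution lies below (M, G) at t₀; afterwards the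
differences satisfy `monotoneOn_of_coupled`. -/
theorem wave_system_growth (m : ℝ) : ∃ c : ℝ, 0 < c ∧ ∀ (τ : ℝ) (M G G' : ℝ → ℝ),
    ContinuousOn M (Icc 0 τ) → ContinuousOn G (Icc 0 τ) →
    (∀ t ∈ Ioo 0 τ, HasDerivAt M ((1 + t) ^ (-2 * m) * G t) t) →
    (∀ t ∈ Ioo 0 τ, HasDerivAt G (G' t) t) →
    (∀ t ∈ Ioo 0 τ, (1 + t) ^ (2 * m) * M t ≤ G' t) →
    0 < M 0 → 0 ≤ G 0 → ∀ t ∈ Icc 0 τ, c * M 0 * ((1 + t) ^ (-m) * Real.exp t) ≤ M t := by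
  set a : ℝ := |m * (m - 1)| + 1 with ha
  have ha1 : 1 ≤ a := by have := abs_nonneg (m * (m - 1)); linarith
  set t₀ : ℝ := 4 * a with ht₀
  have ht₀0 : 0 < t₀ := by linarith
  set M₀ : ℝ → ℝ := fun s => (1 + s) ^ (-m) * Real.exp (s + a / (1 + s)) with hM₀
  set G₀ : ℝ → ℝ := fun s =>
    (1 + s) ^ m * (1 - a / (1 + s) ^ 2 - m / (1 + s)) * Real.exp (s + a / (1 + s)) with hG₀
  set b : ℝ := min 1 ((1 + t₀) ^ (2 * m)) with hb
  have hb0 : 0 < b := lt_min one_pos (by positivity)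
  have hM₀c : ContinuousOn M₀ (Icc 0 t₀) := fun t ht =>
    (subsolution_deriv m a ht.1).1.continuousAt.continuousWithinAt
  obtain ⟨K, hK⟩ := isCompact_Icc.exists_bound_of_continuousOn hM₀c
  -- The first two terms keep M₀/D below 1 on [0, t₀]; the last one makes |G₀ t₀|/D ≤ b t₀, the
  -- amount that G/M(0) has gained by time t₀.
  set D : ℝ := 1 + |K| + |G₀ t₀| / (b * t₀) with hD
  have hD1 : 1 + |K| ≤ D := by
    have : 0 ≤ |G₀ t₀| / (b * t₀) := by positivity
    linarith
  have hD0 : 0 < D := by have := abs_nonneg K; linarith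
  have hlow : ∀ t : ℝ, 0 ≤ t → (1 + t) ^ (-m) * Real.exp t ≤ M₀ t := by
    intro t ht
    apply mul_le_mul_of_nonneg_left _ (by positivity)
    apply Real.exp_le_exp.2
    have : 0 ≤ a / (1 + t) := by positivity
    linarith
  have hM₀K : ∀ t ∈ Icc 0 t₀, 1 / D * M₀ t < 1 := by
    intro t ht
    have h1 := hK t ht
    rw [Real.norm_eq_abs] at h1
    have h2 := le_abs_self (M₀ t)
    have h3 := le_abs_self K
    rw [one_div_mul_eq_div, div_lt_one hD0]
    linarith
  refine ⟨1 / D, by positivity, ?_⟩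
  intro τ M G G' hMc hGc hM' hG' hGG hM0 hG0
  have hmono := monotoneOn_of_coupled hMc hGc hM' hG'
    (fun t ht h => mul_nonneg (Real.rpow_nonneg (by linarith [ht.1]) _) h)
    (fun t ht h => (mul_nonneg (Real.rpow_nonneg (by linarith [ht.1]) _) h.le).trans (hGG t ht))
    hM0 hG0
  have hMlow : ∀ t ∈ Icc 0 τ, M 0 ≤ M t := fun t ht =>
    hmono.1 ⟨le_rfl, ht.1.trans ht.2⟩ ht ht.1
  have hsmall : ∀ t ∈ Icc 0 τ, t ≤ t₀ → 1 / D * M 0 * M₀ t < M t := by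
    intro t ht htt
    have := hM₀K t ⟨ht.1, htt⟩
    have h2 := hMlow t ht
    nlinarith
  suffices hmain : ∀ t ∈ Icc 0 τ, 1 / D * M 0 * M₀ t ≤ M t by
    intro t ht
    refine le_trans ?_ (hmain t ht)
    exact mul_le_mul_of_nonneg_left (hlow t ht.1) (by positivity)
  intro t ht
  rcases le_total t t₀ with htt | htt
  · exact (hsmall t ht htt).le
  have ht₀τ : t₀ ∈ Icc 0 τ := ⟨ht₀0.le, htt.trans ht.2⟩
  have hGt₀ : b * M 0 * t₀ ≤ G t₀ := by
    have := mul_sub_le_of_hasDerivAt (c := b * M 0) ht₀0.le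
      (hGc.mono (Icc_subset_Icc le_rfl ht₀τ.2))
      (fun s hs => hG' s ⟨hs.1, hs.2.trans_le ht₀τ.2⟩) (fun s hs => by
        refine le_trans ?_ (hGG s ⟨hs.1, hs.2.trans_le ht₀τ.2⟩)
        exact mul_le_mul (one_add_rpow_ge_min hs.1.le hs.2.le)
          (hMlow s ⟨hs.1.le, hs.2.le.trans ht₀τ.2⟩) hM0.le (Real.rpow_nonneg (by linarith [hs.1]) _))
    linarith
  have hX := monotoneOn_of_coupled (a := t₀) (b := τ)
    (X := fun s => M s - 1 / D * M 0 * M₀ s) (W := fun s => G s - 1 / D * M 0 * G₀ s)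
    (X' := fun s => (1 + s) ^ (-2 * m) * G s - 1 / D * M 0 * ((1 + s) ^ (-2 * m) * G₀ s))
    (W' := fun s => G' s - 1 / D * M 0 * ((1 + s) ^ m *
      ((1 - a / (1 + s) ^ 2) ^ 2 + 2 * a / (1 + s) ^ 3 - m * (m - 1) / (1 + s) ^ 2)
        * Real.exp (s + a / (1 + s))))
    ((hMc.mono (Icc_subset_Icc ht₀0.le le_rfl)).sub (continuousOn_const.mul fun s hs =>
      (subsolution_deriv m a (ht₀0.le.trans hs.1)).1.continuousAt.continuousWithinAt))
    ((hGc.mono (Icc_subset_Icc ht₀0.le le_rfl)).sub (continuousOn_const.mul fun s hs =>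
      (subsolution_deriv m a (ht₀0.le.trans hs.1)).2.continuousAt.continuousWithinAt))
    (fun s hs => (hM' s ⟨ht₀0.trans hs.1, hs.2⟩).sub
      ((subsolution_deriv m a (ht₀0.le.trans hs.1.le)).1.const_mul _))
    (fun s hs => (hG' s ⟨ht₀0.trans hs.1, hs.2⟩).sub
      ((subsolution_deriv m a (ht₀0.le.trans hs.1.le)).2.const_mul _))
    (fun s hs h => ?_) (fun s hs h => ?_) ?_ ?_
  · have := hX.1 ⟨le_rfl, ht₀τ.2⟩ ⟨htt, ht.2⟩ htt
    have h2 := hsmall t₀ ht₀τ le_rfl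
    simp only at this
    linarith
  · have : 0 ≤ (1 + s) ^ (-2 * m) * (G s - 1 / D * M 0 * G₀ s) :=
      mul_nonneg (Real.rpow_nonneg (by linarith [hs.1]) _) h
    linarith
  · have hs0 : 0 < 1 + s := by linarith [hs.1]
    have hbd := subsolution_bound ha (x := 1 + s) (by linarith [hs.1])
    have h1 := hGG s ⟨ht₀0.trans hs.1, hs.2⟩
    have h2 : (1 + s) ^ (2 * m) * (1 / D * M 0 * M₀ s) ≤ (1 + s) ^ (2 * m) * M s :=
      mul_le_mul_of_nonneg_left (by linarith) (by positivity)
    have h3 : (1 + s) ^ (2 * m) * (1 / D * M 0 * M₀ s)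
        = 1 / D * M 0 * ((1 + s) ^ m * 1 * Real.exp (s + a / (1 + s))) := by
      have : (1 + s) ^ (2 * m) * (1 + s) ^ (-m) = (1 + s) ^ m := by
        rw [← Real.rpow_add hs0]; congr 1; ring
      rw [hM₀, ← this]; ring
    have h4 : 1 / D * M 0 * ((1 + s) ^ m *
      ((1 - a / (1 + s) ^ 2) ^ 2 + 2 * a / (1 + s) ^ 3 - m * (m - 1) / (1 + s) ^ 2)
        * Real.exp (s + a / (1 + s))) ≤
        1 / D * M 0 * ((1 + s) ^ m * 1 * Real.exp (s + a / (1 + s))) := by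
      gcongr
    linarith
  · have := hsmall t₀ ht₀τ le_rfl
    linarith
  · have h1 : 1 / D * |G₀ t₀| ≤ b * t₀ := by
      have : |G₀ t₀| / (b * t₀) ≤ D := by
        have := abs_nonneg K
        linarith
      rw [div_le_iff₀ (by positivity)] at this
      rw [one_div_mul_eq_div, div_le_iff₀ hD0]
      linarith
    have h2 : 1 / D * M 0 * G₀ t₀ ≤ M 0 * (1 / D * |G₀ t₀|) := by
      have := mul_le_mul_of_nonneg_left (le_abs_self (G₀ t₀)) (by positivity : 0 ≤ 1 / D * M 0)
      linarith
    have h3 := mul_le_mul_of_nonneg_left h1 hM0.le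
    linarith

/-- Kato's lemma in discrete form. -/
theorem kato_doubling {p : ℝ} (hp : 1 < p) : ∃ K : ℝ, 0 < K ∧
    ∀ (a b s τ x : ℝ) (X Y : ℝ → ℝ), 0 < a → 0 < b → s ≤ τ → 0 < x → x ≤ X s → 0 ≤ Y s →
    (∀ t₁ t₂, s ≤ t₁ → t₁ ≤ t₂ → t₂ ≤ τ → a * (t₂ - t₁) * Y t₁ ≤ X t₂ - X t₁) →
    (∀ t₁ t₂, s ≤ t₁ → t₁ ≤ t₂ → t₂ ≤ τ → b * (t₂ - t₁) * X t₁ ^ p ≤ Y t₂ - Y t₁) →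
    a * b * x ^ (p - 1) * (τ - s) ^ 2 ≤ K := by
  -- X doubles on successive intervals of lengths Δ r^j. When X doubles, the time needed for the
  -- next doubling shrinks by this r, since r² 2^(p-1) = 1; the total time Δ/(1-r) is finite.
  set r : ℝ := 2 ^ (-(p - 1) / 2) with hr
  have hr0 : 0 < r := by positivity
  have hr1 : r < 1 := Real.rpow_lt_one_of_one_lt_of_neg one_lt_two (by linarith)
  have hr2 : r ^ 2 * (2 : ℝ) ^ (p - 1) = 1 := by
    rw [hr, ← Real.rpow_natCast, ← Real.rpow_mul two_pos.le, ← Real.rpow_add two_pos]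
    have : -(p - 1) / 2 * ((2 : ℕ) : ℝ) + (p - 1) = 0 := by push_cast; ring
    rw [this, Real.rpow_zero]
  have hr1' : 0 < 1 - r := by linarith
  refine ⟨4 / (1 - r) ^ 2, by positivity, ?_⟩
  intro a b s τ x X Y ha hb hsτ hx hxX hY hXi hYi
  by_contra! hcon
  set q : ℝ := a * b * x ^ (p - 1) with hq
  have hq0 : 0 < q := by positivity
  -- Chosen so that q Δ² / 4 = 1, which makes one step of the iteration an exact doubling.
  set Δ : ℝ := 2 / Real.sqrt q with hΔ
  have hsq : 0 < Real.sqrt q := Real.sqrt_pos.2 hq0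
  have hΔ0 : 0 < Δ := by positivity
  have hΔq : q * Δ ^ 2 = 4 := by
    rw [hΔ, div_pow, Real.sq_sqrt hq0.le]; field_simp; norm_num
  have hlen : Δ / (1 - r) ≤ τ - s := by
    have h1 : (Δ / (1 - r)) ^ 2 ≤ (τ - s) ^ 2 := by
      have : q * (Δ / (1 - r)) ^ 2 < q * (τ - s) ^ 2 := by
        rw [div_pow, ← mul_div_assoc, hΔq]; exact hcon
      exact (lt_of_mul_lt_mul_left this hq0.le).le
    exact le_of_sq_le_sq h1 (by linarith)
  set T : ℕ → ℝ := fun j => s + Δ * ((1 - r ^ j) / (1 - r)) with hT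
  have hTs : ∀ j, T (j + 1) = T j + Δ * r ^ j := by
    intro j
    simp only [hT]
    field_simp
    ring
  have hTle : ∀ j, T j ≤ τ := by
    intro j
    have : Δ * ((1 - r ^ j) / (1 - r)) ≤ Δ / (1 - r) := by
      rw [← mul_div_assoc]
      gcongr
      have : 0 < r ^ j := by positivity
      nlinarith
    simp only [hT]
    linarith
  have hsT : ∀ j, s ≤ T j := by
    intro j
    have h1 : r ^ j ≤ 1 := pow_le_one₀ hr0.le hr1.le
    have : 0 ≤ Δ * ((1 - r ^ j) / (1 - r)) :=
      mul_nonneg hΔ0.le (div_nonneg (by linarith) hr1'.le)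
    simp only [hT]
    linarith
  have main : ∀ j : ℕ, 2 ^ j * x ≤ X (T j) ∧ 0 ≤ Y (T j) := by
    intro j
    induction j with
    | zero => simpa [hT] using ⟨hxX, hY⟩
    | succ j ih =>
      obtain ⟨ih1, ih2⟩ := ih
      set d : ℝ := Δ * r ^ j with hd
      have hd0 : 0 < d := by positivity
      have hTj := hTs j
      have hle := hTle (j + 1)
      have hXpos : (0 : ℝ) < 2 ^ j * x := by positivity
      have hmid := hYi (T j) (T j + d / 2) (hsT j) (by linarith) (by linarith)
      have hend := hXi (T j + d / 2) (T (j + 1)) (by linarith [hsT j]) (by linarith) hle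
      have hst := hXi (T j) (T j + d / 2) (hsT j) (by linarith) (by linarith)
      have hYend := hYi (T j) (T (j + 1)) (hsT j) (by linarith) hle
      have hXp : (2 ^ j * x) ^ p ≤ X (T j) ^ p :=
        Real.rpow_le_rpow hXpos.le ih1 (by linarith)
      have hXp0 : 0 ≤ X (T j) ^ p := Real.rpow_nonneg (hXpos.le.trans ih1) _
      -- The first half of the interval raises Y, the second half converts this into a gain of X by
      -- its own lower bound.
      have hid : a * (d / 2) * (b * (d / 2) * (2 ^ j * x) ^ p) = 2 ^ j * x := by
        have e1 : (2 ^ j * x : ℝ) ^ p = ((2 : ℝ) ^ (p - 1)) ^ j * x ^ (p - 1) * (2 ^ j * x) := by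
          have : p = (p - 1) + 1 := by ring
          conv_lhs => rw [this, Real.rpow_add hXpos, Real.rpow_one,
            Real.mul_rpow (by positivity) hx.le]
          congr 2
          rw [← Real.rpow_natCast, ← Real.rpow_natCast, ← Real.rpow_mul two_pos.le,
            ← Real.rpow_mul two_pos.le, mul_comm]
        have e2 : (r ^ j) ^ 2 * ((2 : ℝ) ^ (p - 1)) ^ j = 1 := by
          rw [← pow_mul, mul_comm j 2, pow_mul, ← mul_pow, hr2, one_pow]
        rw [e1, hd]
        calc _ = (q * Δ ^ 2) / 4 * ((r ^ j) ^ 2 * ((2 : ℝ) ^ (p - 1)) ^ j) * (2 ^ j * x) := by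
              rw [hq]; ring
          _ = 2 ^ j * x := by rw [hΔq, e2]; ring
      have hYmid : b * (d / 2) * (2 ^ j * x) ^ p ≤ Y (T j + d / 2) := by
        have : b * (d / 2) * (2 ^ j * x) ^ p ≤ b * (d / 2) * X (T j) ^ p := by gcongr
        have e : T j + d / 2 - T j = d / 2 := by ring
        rw [e] at hmid
        linarith
      have h5 : a * (d / 2) * (b * (d / 2) * (2 ^ j * x) ^ p) ≤ a * (d / 2) * Y (T j + d / 2) := by
        gcongr
      have e3 : T (j + 1) - (T j + d / 2) = d / 2 := by rw [hTj]; ring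
      have e4 : T j + d / 2 - T j = d / 2 := by ring
      rw [e3] at hend
      rw [e4] at hst
      have h6 : 0 ≤ a * (d / 2) * Y (T j) := by positivity
      refine ⟨?_, ?_⟩
      · rw [pow_succ]; linarith
      · have : 0 ≤ b * (T (j + 1) - T j) * X (T j) ^ p := by
          rw [hTj]
          have : 0 ≤ T j + d - T j := by linarith
          positivity
        linarith
  have hbd : ∀ j : ℕ, 2 ^ j * x ≤ X τ := by
    intro j
    have h1 := hXi (T j) τ (hsT j) (hTle j) le_rfl
    have h2 : 0 ≤ a * (τ - T j) * Y (T j) :=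
      mul_nonneg (mul_nonneg ha.le (by linarith [hTle j])) (main j).2
    linarith [(main j).1]
  obtain ⟨j, hj⟩ := pow_unbounded_of_one_lt (X τ / x) one_lt_two
  rw [div_lt_iff₀ hx] at hj
  linarith [hbd j]

/-! ### Upper and lower bounds for the momentum system. -/

/-- Comparability of `(1+t)^e` and `(1+τ)^e` for `τ/4 ≤ t ≤ τ`. -/
theorem one_add_rpow_comparable (e : ℝ) {t τ : ℝ} (ht : 0 ≤ t) (h1 : τ / 4 ≤ t) (h2 : t ≤ τ) :
    (4 : ℝ) ^ (-|e|) * (1 + τ) ^ e ≤ (1 + t) ^ e := by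
  have hτ : 0 ≤ τ := ht.trans h2
  have h4 : (4 : ℝ) ^ (-|e|) ≤ 1 :=
    Real.rpow_le_one_of_one_le_of_nonpos (by norm_num) (by simp)
  rcases le_total 0 e with he | he
  · rw [abs_of_nonneg he, Real.rpow_neg (by norm_num), mul_comm, ← div_eq_mul_inv,
      ← Real.div_rpow (by linarith) (by norm_num)]
    exact Real.rpow_le_rpow (by positivity) (by linarith) he
  · calc (4 : ℝ) ^ (-|e|) * (1 + τ) ^ e ≤ 1 * (1 + τ) ^ e := by gcongr
      _ ≤ (1 + t) ^ e := by
        rw [one_mul]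
        exact Real.rpow_le_rpow_of_nonpos (by linarith) (by linarith) he

/-- The first order system `M' = (1+t)^(σ-1) G`, `G' = (1+t)^k N` with nonnegative source `N`. -/
structure IsMomentumSystem (σ k τ : ℝ) (M G N : ℝ → ℝ) : Prop where
  contM : ContinuousOn M (Icc 0 τ)
  contG : ContinuousOn G (Icc 0 τ)
  derivM : ∀ t ∈ Ioo 0 τ, HasDerivAt M ((1 + t) ^ (σ - 1) * G t) t
  derivG : ∀ t ∈ Ioo 0 τ, HasDerivAt G ((1 + t) ^ k * N t) t
  source_nonneg : ∀ t ∈ Ioo 0 τ, 0 ≤ N t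
  posM : 0 < M 0
  nonnegG : 0 ≤ G 0

namespace IsMomentumSystem

variable {σ k τ : ℝ} {M G N : ℝ → ℝ}

theorem monotone (h : IsMomentumSystem σ k τ M G N) :
    MonotoneOn M (Icc 0 τ) ∧ MonotoneOn G (Icc 0 τ) :=
  monotoneOn_of_coupled h.contM h.contG h.derivM h.derivG
    (fun t ht h' => mul_nonneg (Real.rpow_nonneg (by linarith [ht.1]) _) h')
    (fun t ht _ => mul_nonneg (Real.rpow_nonneg (by linarith [ht.1]) _) (h.source_nonneg t ht))
    h.posM h.nonnegG

theorem G_nonneg (h : IsMomentumSystem σ k τ M G N) {t : ℝ} (ht : t ∈ Icc 0 τ) : 0 ≤ G t :=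
  h.nonnegG.trans (h.monotone.2 ⟨le_rfl, ht.1.trans ht.2⟩ ht ht.1)

theorem M_pos (h : IsMomentumSystem σ k τ M G N) {t : ℝ} (ht : t ∈ Icc 0 τ) : 0 < M t :=
  h.posM.trans_le (h.monotone.1 ⟨le_rfl, ht.1.trans ht.2⟩ ht ht.1)

theorem M_growth (h : IsMomentumSystem σ k τ M G N) {t₁ t₂ : ℝ} (h0 : τ / 4 ≤ t₁) (h1 : t₁ ≤ t₂)
    (h2 : t₂ ≤ τ) (h3 : 0 ≤ t₁) :
    (4 : ℝ) ^ (-|σ - 1|) * (1 + τ) ^ (σ - 1) * (t₂ - t₁) * G t₁ ≤ M t₂ - M t₁ := by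
  have := mul_sub_le_of_hasDerivAt (c := (4 : ℝ) ^ (-|σ - 1|) * (1 + τ) ^ (σ - 1) * G t₁) h1
    (h.contM.mono (Icc_subset_Icc h3 h2))
    (fun t ht => h.derivM t ⟨h3.trans_lt ht.1, ht.2.trans_le h2⟩) (fun t ht => by
      apply mul_le_mul
      · exact one_add_rpow_comparable _ (h3.trans ht.1.le) (h0.trans ht.1.le) (ht.2.le.trans h2)
      · exact h.monotone.2 ⟨h3, h1.trans h2⟩ ⟨h3.trans ht.1.le, ht.2.le.trans h2⟩ ht.1.le
      · exact h.G_nonneg ⟨h3, h1.trans h2⟩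
      · exact Real.rpow_nonneg (by linarith [ht.1]) _)
  linarith

theorem G_growth (h : IsMomentumSystem σ k τ M G N) {e B t₁ t₂ : ℝ} (hB : 0 ≤ B)
    (h0 : τ / 4 ≤ t₁) (h1 : t₁ ≤ t₂) (h2 : t₂ ≤ τ) (h3 : 0 ≤ t₁)
    (hN : ∀ t ∈ Ioo t₁ t₂, B * (1 + t) ^ e ≤ N t) :
    (4 : ℝ) ^ (-|k + e|) * (1 + τ) ^ (k + e) * (t₂ - t₁) * B ≤ G t₂ - G t₁ := by
  have := mul_sub_le_of_hasDerivAt (c := (4 : ℝ) ^ (-|k + e|) * (1 + τ) ^ (k + e) * B) h1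
    (h.contG.mono (Icc_subset_Icc h3 h2))
    (fun t ht => h.derivG t ⟨h3.trans_lt ht.1, ht.2.trans_le h2⟩) (fun t ht => by
      have ht0 : 0 < 1 + t := by linarith [ht.1]
      calc _ ≤ (1 + t) ^ (k + e) * B := by
            gcongr
            exact one_add_rpow_comparable _ (h3.trans ht.1.le) (h0.trans ht.1.le)
              (ht.2.le.trans h2)
        _ = (1 + t) ^ k * (B * (1 + t) ^ e) := by rw [Real.rpow_add ht0]; ring
        _ ≤ _ := by
          apply mul_le_mul_of_nonneg_left (hN t ht) (by positivity))
  linarith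

end IsMomentumSystem

/-- Kato's upper bound. -/
theorem momentum_upper_bound (σ k e : ℝ) {p c₁ : ℝ} (hp : 1 < p) (hc₁ : 0 < c₁) :
    ∃ C : ℝ, 0 < C ∧ ∀ (τ : ℝ) (M G N : ℝ → ℝ), 1 ≤ τ → IsMomentumSystem σ k τ M G N →
      (∀ t ∈ Ioo 0 τ, c₁ * (1 + t) ^ e * M t ^ p ≤ N t) →
      M (τ / 2) ≤ C * (1 + τ) ^ (-(σ + 1 + k + e) / (p - 1)) := by
  obtain ⟨K, hK, hkato⟩ := kato_doubling hp
  set a₀ : ℝ := (4 : ℝ) ^ (-|σ - 1|) with ha₀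
  set b₀ : ℝ := (4 : ℝ) ^ (-|k + e|) with hb₀
  have ha₀0 : 0 < a₀ := by positivity
  have hb₀0 : 0 < b₀ := by positivity
  refine ⟨(K * 16 / (a₀ * b₀ * c₁)) ^ (1 / (p - 1)), by positivity, ?_⟩
  intro τ M G N hτ h hN
  have hx : 0 < M (τ / 2) := h.M_pos ⟨by linarith, by linarith⟩
  have hS : 0 < 1 + τ := by linarith
  have hk := hkato (a₀ * (1 + τ) ^ (σ - 1)) (b₀ * (1 + τ) ^ (k + e) * c₁) (τ / 2) τ (M (τ / 2)) M G
    (by positivity) (by positivity) (by linarith) hx le_rfl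
    (h.G_nonneg ⟨by linarith, by linarith⟩)
    (fun t₁ t₂ h0 h1 h2 => h.M_growth (by linarith) h1 h2 (by linarith))
    (fun t₁ t₂ h0 h1 h2 => by
      have hM1 : 0 < M t₁ := h.M_pos ⟨by linarith, h1.trans h2⟩
      have := h.G_growth (e := e) (B := c₁ * M t₁ ^ p) (by positivity) (by linarith) h1 h2
        (by linarith) (fun t ht => by
          refine le_trans ?_ (hN t ⟨by linarith [ht.1], ht.2.trans_le h2⟩)
          have hm : M t₁ ≤ M t := h.monotone.1 ⟨by linarith, h1.trans h2⟩
            ⟨by linarith [ht.1], ht.2.le.trans h2⟩ ht.1.le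
          have hm2 : M t₁ ^ p ≤ M t ^ p := Real.rpow_le_rpow hM1.le hm (by linarith)
          have : 0 ≤ (1 + t) ^ e := Real.rpow_nonneg (by linarith [ht.1]) _
          calc c₁ * M t₁ ^ p * (1 + t) ^ e ≤ c₁ * M t ^ p * (1 + t) ^ e := by gcongr
            _ = _ := by ring)
      linarith)
  have h1 : M (τ / 2) ^ (p - 1) ≤ K * 16 / (a₀ * b₀ * c₁) * (1 + τ) ^ (-(σ + 1 + k + e)) := by
    have hE : (1 + τ) ^ (σ - 1) * (1 + τ) ^ (k + e) * (1 + τ) ^ 2 = (1 + τ) ^ (σ + 1 + k + e) := by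
      rw [← Real.rpow_natCast, ← Real.rpow_add hS, ← Real.rpow_add hS]
      congr 1; push_cast; ring
    have hsq : (1 + τ) ^ 2 ≤ 16 * (τ - τ / 2) ^ 2 := by nlinarith
    have h2 : a₀ * b₀ * c₁ * (1 + τ) ^ (σ + 1 + k + e) * M (τ / 2) ^ (p - 1) ≤ K * 16 := by
      calc _ = a₀ * (1 + τ) ^ (σ - 1) * (b₀ * (1 + τ) ^ (k + e) * c₁) * M (τ / 2) ^ (p - 1)
            * (1 + τ) ^ 2 := by rw [← hE]; ring
        _ ≤ a₀ * (1 + τ) ^ (σ - 1) * (b₀ * (1 + τ) ^ (k + e) * c₁) * M (τ / 2) ^ (p - 1)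
            * (16 * (τ - τ / 2) ^ 2) := by gcongr
        _ ≤ K * 16 := by linarith
    rw [Real.rpow_neg hS.le, div_mul_eq_mul_div, ← div_eq_mul_inv, div_div, le_div_iff₀ (by positivity)]
    linarith
  have hp1 : 0 < p - 1 := by linarith
  calc M (τ / 2) = (M (τ / 2) ^ (p - 1)) ^ (1 / (p - 1)) := by
        rw [← Real.rpow_mul hx.le, mul_one_div_cancel hp1.ne', Real.rpow_one]
    _ ≤ (K * 16 / (a₀ * b₀ * c₁) * (1 + τ) ^ (-(σ + 1 + k + e))) ^ (1 / (p - 1)) :=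
        Real.rpow_le_rpow (by positivity) h1 (by positivity)
    _ = _ := by
      rw [Real.mul_rpow (by positivity) (by positivity), ← Real.rpow_mul hS.le]
      congr 2; ring

/-- Integrate the source over [τ/4, 3τ/8] to bound G, then G over [3τ/8, τ/2] to bound M; on both
intervals all weights are comparable with their values at τ. -/
theorem momentum_lower_wave (σ k d : ℝ) : ∃ c : ℝ, 0 < c ∧
    ∀ (τ A : ℝ) (M G N : ℝ → ℝ), 1 ≤ τ → 0 ≤ A → IsMomentumSystem σ k τ M G N →
      (∀ t ∈ Ioo 0 τ, A * (1 + t) ^ d ≤ N t) →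
      c * A * (1 + τ) ^ (k + d + σ + 1) ≤ M (τ / 2) := by
  refine ⟨(4 : ℝ) ^ (-|σ - 1|) * (4 : ℝ) ^ (-|k + d|) / 256, by positivity, ?_⟩
  intro τ A M G N hτ hA h hN
  have hS : 0 < 1 + τ := by linarith
  have h1 := h.G_growth (e := d) (t₁ := τ / 4) (t₂ := 3 * τ / 8) hA le_rfl (by linarith)
    (by linarith) (by linarith) (fun t ht => hN t ⟨by linarith [ht.1], by linarith [ht.2]⟩)
  have h2 := h.M_growth (t₁ := 3 * τ / 8) (t₂ := τ / 2) (by linarith) (by linarith) (by linarith)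
    (by linarith)
  have h3 := h.G_nonneg (t := τ / 4) ⟨by linarith, by linarith⟩
  have h4 := h.M_pos (t := 3 * τ / 8) ⟨by linarith, by linarith⟩
  set a := (4 : ℝ) ^ (-|σ - 1|)
  set b := (4 : ℝ) ^ (-|k + d|)
  have ha : 0 < a := by positivity
  have hb : 0 < b := by positivity
  have e1 : 3 * τ / 8 - τ / 4 = τ / 8 := by ring
  have e2 : τ / 2 - 3 * τ / 8 = τ / 8 := by ring
  rw [e1] at h1
  rw [e2] at h2
  have h5 : a * (1 + τ) ^ (σ - 1) * (τ / 8) * (b * (1 + τ) ^ (k + d) * (τ / 8) * A)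
      ≤ a * (1 + τ) ^ (σ - 1) * (τ / 8) * G (3 * τ / 8) := by gcongr; linarith
  have hE : (1 + τ) ^ (σ - 1) * (1 + τ) ^ (k + d) * (1 + τ) ^ 2 = (1 + τ) ^ (k + d + σ + 1) := by
    rw [← Real.rpow_natCast, ← Real.rpow_add hS, ← Real.rpow_add hS]
    congr 1; push_cast; ring
  have hsq : (1 + τ) ^ 2 ≤ 256 * (τ / 8) ^ 2 := by nlinarith
  calc a * b / 256 * A * (1 + τ) ^ (k + d + σ + 1)
      = a * b / 256 * A * ((1 + τ) ^ (σ - 1) * (1 + τ) ^ (k + d)) * (1 + τ) ^ 2 := by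
        rw [← hE]; ring
    _ ≤ a * b / 256 * A * ((1 + τ) ^ (σ - 1) * (1 + τ) ^ (k + d)) * (256 * (τ / 8) ^ 2) := by gcongr
    _ = a * (1 + τ) ^ (σ - 1) * (τ / 8) * (b * (1 + τ) ^ (k + d) * (τ / 8) * A) := by ring
    _ ≤ M (τ / 2) := by linarith

/-- Integrating (1+t)^(σ-1) B over [τ/4, τ/2] gives the power (1+τ)^σ. This loses a logarithm when σ
= 0, which `momentum_lower_log` recovers by integrating from time 1. -/
theorem momentum_lower_heat (σ k : ℝ) : ∃ c : ℝ, 0 < c ∧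
    ∀ (τ B : ℝ) (M G N : ℝ → ℝ), 1 ≤ τ → 0 ≤ B → IsMomentumSystem σ k τ M G N →
      B ≤ G (τ / 4) → c * B * (1 + τ) ^ σ ≤ M (τ / 2) := by
  refine ⟨(4 : ℝ) ^ (-|σ - 1|) / 8, by positivity, ?_⟩
  intro τ B M G N hτ hB h hG
  have hS : 0 < 1 + τ := by linarith
  have h2 := h.M_growth (t₁ := τ / 4) (t₂ := τ / 2) (by linarith) (by linarith) (by linarith)
    (by linarith)
  have h4 := h.M_pos (t := τ / 4) ⟨by linarith, by linarith⟩
  rw [show τ / 2 - τ / 4 = τ / 4 by ring] at h2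
  set a := (4 : ℝ) ^ (-|σ - 1|)
  have ha : 0 < a := by positivity
  have hE : (1 + τ) ^ σ = (1 + τ) ^ (σ - 1) * (1 + τ) := by
    rw [Real.rpow_sub_one hS.ne']; field_simp
  calc a / 8 * B * (1 + τ) ^ σ = a * (1 + τ) ^ (σ - 1) * ((1 + τ) / 8) * B := by rw [hE]; ring
    _ ≤ a * (1 + τ) ^ (σ - 1) * (τ / 4) * G (τ / 4) := by
        have h8 : (1 + τ) / 8 ≤ τ / 4 := by linarith
        gcongr
    _ ≤ M (τ / 2) := by linarith

/-- The source accumulated during [0, 1] is already of size A, and G never decreases afterwards. For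
k + d < -1 this is the right order for the contribution of A (1+t)^d to G. -/
theorem momentum_G_lower (σ k d : ℝ) : ∃ c : ℝ, 0 < c ∧
    ∀ (τ A : ℝ) (M G N : ℝ → ℝ), 1 ≤ τ → 0 ≤ A → IsMomentumSystem σ k τ M G N →
      (∀ t ∈ Ioo 0 τ, A * (1 + t) ^ d ≤ N t) → ∀ t ∈ Icc 1 τ, c * A ≤ G t := by
  refine ⟨min 1 ((1 + 1) ^ (k + d)), by positivity, ?_⟩
  intro τ A M G N hτ hA h hN t ht
  have h1 := mul_sub_le_of_hasDerivAt (c := min 1 ((1 + 1) ^ (k + d)) * A) zero_le_one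
    (h.contG.mono (Icc_subset_Icc le_rfl hτ))
    (fun t ht => h.derivG t ⟨ht.1, ht.2.trans_le hτ⟩) (fun s hs => by
      have hs0 : 0 < 1 + s := by linarith [hs.1]
      calc _ ≤ (1 + s) ^ (k + d) * A := by
            gcongr
            exact one_add_rpow_ge_min hs.1.le hs.2.le
        _ = (1 + s) ^ k * (A * (1 + s) ^ d) := by rw [Real.rpow_add hs0]; ring
        _ ≤ _ := by
          apply mul_le_mul_of_nonneg_left (hN s ⟨hs.1, hs.2.trans_le hτ⟩) (by positivity))
  have h2 := h.monotone.2 ⟨zero_le_one, hτ⟩ ⟨by linarith [ht.1], ht.2⟩ ht.1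
  linarith [h.nonnegG]

theorem hasDerivAt_log_one_add {t : ℝ} (ht : 0 ≤ t) :
    HasDerivAt (fun s : ℝ => Real.log (1 + s)) (1 / (1 + t)) t :=
  ((hasDerivAt_id t).const_add 1).log (by simp; linarith)

/-- In the borderline case the lower bound for G' is A/(1+t). -/
theorem momentum_G_lower_log {σ k d τ A : ℝ} {M G N : ℝ → ℝ} (hkd : k + d = -1)
    (h : IsMomentumSystem σ k τ M G N) (hN : ∀ t ∈ Ioo 0 τ, A * (1 + t) ^ d ≤ N t) :
    ∀ t ∈ Icc 0 τ, A * Real.log (1 + t) ≤ G t := by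
  intro t ht
  have h1 := mul_sub_le_of_hasDerivAt (f := fun s => G s - A * Real.log (1 + s)) (c := 0) ht.1
    ((h.contG.mono (Icc_subset_Icc le_rfl ht.2)).sub (continuousOn_const.mul fun s hs =>
      (hasDerivAt_log_one_add hs.1).continuousAt.continuousWithinAt))
    (fun s hs => (h.derivG s ⟨hs.1, hs.2.trans_le ht.2⟩).sub
      ((hasDerivAt_log_one_add hs.1.le).const_mul A)) (fun s hs => by
      have hs0 : 0 < 1 + s := by linarith [hs.1]
      have h2 : (1 + s) ^ k * (A * (1 + s) ^ d) ≤ (1 + s) ^ k * N s :=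
        mul_le_mul_of_nonneg_left (hN s ⟨hs.1, hs.2.trans_le ht.2⟩) (by positivity)
      have h3 : (1 + s) ^ k * (A * (1 + s) ^ d) = A * (1 / (1 + s)) := by
        calc _ = A * (1 + s) ^ (k + d) := by rw [Real.rpow_add hs0]; ring
          _ = _ := by rw [hkd, Real.rpow_neg_one, one_div]
      linarith)
  simp only [add_zero, Real.log_one, mul_zero, sub_zero] at h1
  linarith [h.nonnegG]

theorem log_quarter_le {τ : ℝ} (hτ : 0 ≤ τ) : Real.log (1 + τ) / 4 ≤ Real.log (1 + τ / 4) := by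
  have h : 1 + τ ≤ (1 + τ / 4) ^ 4 := by
    nlinarith [sq_nonneg (τ ^ 2), pow_nonneg hτ 3, pow_nonneg hτ 2]
  have := Real.log_le_log (by linarith) h
  rw [Real.log_pow] at this
  push_cast at this
  linarith

theorem momentum_lower_log {k τ B : ℝ} {M G N : ℝ → ℝ} (hτ : 15 ≤ τ) (hB : 0 ≤ B)
    (h : IsMomentumSystem 0 k τ M G N) (hG : ∀ t ∈ Icc 1 τ, B ≤ G t) :
    B * Real.log (1 + τ) / 4 ≤ M (τ / 2) := by
  have h1 := mul_sub_le_of_hasDerivAt (f := fun s => M s - B * Real.log (1 + s)) (c := 0)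
    (a := 1) (b := τ / 2) (by linarith)
    ((h.contM.mono (Icc_subset_Icc (by linarith) (by linarith))).sub
      (continuousOn_const.mul fun s hs =>
      (hasDerivAt_log_one_add (by linarith [hs.1])).continuousAt.continuousWithinAt))
    (fun s hs => (h.derivM s ⟨by linarith [hs.1], by linarith [hs.2]⟩).sub
      ((hasDerivAt_log_one_add (by linarith [hs.1])).const_mul B)) (fun s hs => by
      have hs0 : 0 < 1 + s := by linarith [hs.1]
      have h2 := hG s ⟨hs.1.le, by linarith [hs.2]⟩
      rw [zero_sub, Real.rpow_neg_one, ← one_div]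
      have : (1 / (1 + s)) * B ≤ (1 / (1 + s)) * G s := by gcongr
      linarith)
  have h2 := h.M_pos (t := 1) ⟨by linarith, by linarith⟩
  have h3 : Real.log (1 + τ) ≤ 2 * Real.log (1 + τ / 2) := by
    have := Real.log_le_log (by linarith) (show 1 + τ ≤ (1 + τ / 2) ^ 2 by nlinarith)
    rwa [Real.log_pow] at this
  -- The origin of the threshold 15: from 2⁴ ≤ 1 + τ, the loss log 2 at the lower endpoint is at
  -- most a quarter of log (1+τ).
  have h4 : 4 * Real.log (1 + 1) ≤ Real.log (1 + τ) := by
    have := Real.log_le_log (by norm_num) (show ((1 : ℝ) + 1) ^ 4 ≤ 1 + τ by linarith)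
    rwa [Real.log_pow] at this
  generalize Real.log (1 + 1) = l at h1 h4
  generalize Real.log (1 + τ) = L at h3 h4 ⊢
  generalize Real.log (1 + τ / 2) = L₂ at h1 h3
  have h5 : B * (L / 4) ≤ B * (L₂ - l) := by gcongr; linarith
  linarith

/-- Since M' = G/(1+t) dominates A log(1+t)/(1+t), one integrates the derivative of (A/2) log²(1+t).
-/
theorem momentum_lower_log_sq {k τ A : ℝ} {M G N : ℝ → ℝ} (hτ : 0 ≤ τ) (hA : 0 ≤ A)
    (h : IsMomentumSystem 0 k τ M G N) (hG : ∀ t ∈ Icc 0 τ, A * Real.log (1 + t) ≤ G t) :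
    A * Real.log (1 + τ) ^ 2 / 8 ≤ M (τ / 2) := by
  have h1 := mul_sub_le_of_hasDerivAt (f := fun s => M s - A / 2 * Real.log (1 + s) ^ 2) (c := 0)
    (a := 0) (b := τ / 2) (by linarith)
    ((h.contM.mono (Icc_subset_Icc (by linarith) (by linarith))).sub
      (continuousOn_const.mul fun s hs =>
      ((hasDerivAt_log_one_add (by linarith [hs.1])).pow 2).continuousAt.continuousWithinAt))
    (fun s hs => (h.derivM s ⟨by linarith [hs.1], by linarith [hs.2]⟩).sub
      (((hasDerivAt_log_one_add (by linarith [hs.1])).pow 2).const_mul (A / 2))) (fun s hs => by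
      have hs0 : 0 < 1 + s := by linarith [hs.1]
      have h2 := hG s ⟨hs.1.le, by linarith [hs.2]⟩
      rw [zero_sub, Real.rpow_neg_one, ← one_div]
      have : (1 / (1 + s)) * (A * Real.log (1 + s)) ≤ (1 / (1 + s)) * G s := by gcongr
      simp only [Nat.cast_ofNat, Nat.add_one_sub_one, pow_one]
      linarith)
  have h3 : Real.log (1 + τ) ≤ 2 * Real.log (1 + τ / 2) := by
    have := Real.log_le_log (by linarith) (show 1 + τ ≤ (1 + τ / 2) ^ 2 by nlinarith)
    rwa [Real.log_pow] at this
  have h4 : 0 ≤ Real.log (1 + τ) := Real.log_nonneg (by linarith)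
  have h5 : Real.log (1 + τ) ^ 2 ≤ (2 * Real.log (1 + τ / 2)) ^ 2 := by gcongr
  have h6 : A * Real.log (1 + τ) ^ 2 ≤ A * (2 * Real.log (1 + τ / 2)) ^ 2 := by gcongr
  simp only [add_zero, Real.log_one, ne_eq, OfNat.ofNat_ne_zero, not_false_eq_true, zero_pow,
    mul_zero, sub_zero] at h1
  linarith [h.posM]

/-- The four consequences of the interplay between Kato's upper bound and the lower bounds. -/
theorem momentum_dichotomy (k d e : ℝ) {σ p c₁ : ℝ} (hσ : 0 ≤ σ) (hp : 1 < p) (hc₁ : 0 < c₁) :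
    ∃ C : ℝ, 0 < C ∧ ∀ (τ A : ℝ) (M G N : ℝ → ℝ), 15 ≤ τ → 0 ≤ A → IsMomentumSystem σ k τ M G N →
      (∀ t ∈ Ioo 0 τ, c₁ * (1 + t) ^ e * M t ^ p ≤ N t) →
      (∀ t ∈ Ioo 0 τ, A * (1 + t) ^ d ≤ N t) →
      M 0 ≤ C * (1 + τ) ^ (-(σ + 1 + k + e) / (p - 1)) ∧
      A * (1 + τ) ^ (k + d + σ + 1) ≤ C * (1 + τ) ^ (-(σ + 1 + k + e) / (p - 1)) ∧
      A * (1 + τ) ^ σ * Real.log (1 + τ) ^ (1 - Real.sign σ)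
        ≤ C * (1 + τ) ^ (-(σ + 1 + k + e) / (p - 1)) ∧
      (k + d = -1 → A * (1 + τ) ^ σ * Real.log (1 + τ) ^ (2 - Real.sign σ)
        ≤ C * (1 + τ) ^ (-(σ + 1 + k + e) / (p - 1))) := by
  obtain ⟨C, hC, hup⟩ := momentum_upper_bound σ k e hp hc₁
  obtain ⟨c₂, hc₂, hwave⟩ := momentum_lower_wave σ k d
  obtain ⟨c₃, hc₃, hheat⟩ := momentum_lower_heat σ k
  obtain ⟨c₄, hc₄, hGl⟩ := momentum_G_lower σ k d
  set c := min 1 (min c₂ (min (c₃ * c₄) (min (c₃ / 4) (min (c₄ / 4) (1 / 8))))) with hc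
  have hc0 : 0 < c := by positivity
  refine ⟨C / c, by positivity, ?_⟩
  intro τ A M G N hτ hA h hN1 hN2
  have hS : 0 < 1 + τ := by linarith
  have hlog : 0 ≤ Real.log (1 + τ) := Real.log_nonneg (by linarith)
  have hupp := hup τ M G N (by linarith) h hN1
  have key : ∀ x : ℝ, c * x ≤ M (τ / 2) →
      x ≤ C / c * (1 + τ) ^ (-(σ + 1 + k + e) / (p - 1)) := by
    intro x hx
    rw [div_mul_eq_mul_div, le_div_iff₀ hc0]
    linarith
  have weak : ∀ {x c' : ℝ}, c ≤ c' → 0 ≤ x → c' * x ≤ M (τ / 2) → c * x ≤ M (τ / 2) :=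
    fun h1 h2 h3 => (mul_le_mul_of_nonneg_right h1 h2).trans h3
  have l1 : c ≤ 1 := min_le_left _ _
  have l2 : c ≤ c₂ := (min_le_right _ _).trans (min_le_left _ _)
  have l3' : c ≤ min (c₃ * c₄) (min (c₃ / 4) (min (c₄ / 4) (1 / 8))) :=
    (min_le_right _ _).trans (min_le_right _ _)
  have l3 : c ≤ c₃ * c₄ := l3'.trans (min_le_left _ _)
  have l4 : c ≤ c₃ / 4 := l3'.trans ((min_le_right _ _).trans (min_le_left _ _))
  have l5' := l3'.trans ((min_le_right _ _).trans (min_le_right _ _))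
  have l5 : c ≤ c₄ / 4 := l5'.trans (min_le_left _ _)
  have l6 : c ≤ 1 / 8 := l5'.trans (min_le_right _ _)
  have hG1 := hGl τ A M G N (by linarith) hA h hN2
  refine ⟨key _ (weak l1 h.posM.le ?_), key _ (weak l2 (by positivity) ?_), key _ ?_,
    fun hkd => key _ ?_⟩
  · rw [one_mul]
    exact h.monotone.1 ⟨le_rfl, by linarith⟩ ⟨by linarith, by linarith⟩ (by linarith)
  · rw [← mul_assoc]
    exact hwave τ A M G N (by linarith) hA h hN2
  · rcases hσ.eq_or_lt with rfl | hσ0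
    · rw [Real.sign_zero, sub_zero, Real.rpow_one, Real.rpow_zero, mul_one]
      refine weak l5 (by positivity) ?_
      have := momentum_lower_log hτ (B := c₄ * A) (by positivity) h hG1
      linarith
    · rw [Real.sign_of_pos hσ0, sub_self, Real.rpow_zero, mul_one]
      refine weak l3 (by positivity) ?_
      have := hheat τ (c₄ * A) M G N (by linarith) (by positivity) h
        (hG1 _ ⟨by linarith, by linarith⟩)
      linarith
  · have hG2 := momentum_G_lower_log hkd h hN2
    rcases hσ.eq_or_lt with rfl | hσ0
    · rw [Real.sign_zero, sub_zero, Real.rpow_two, Real.rpow_zero, mul_one]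
      refine weak l6 (by positivity) ?_
      have := momentum_lower_log_sq (by linarith) hA h hG2
      linarith
    · rw [Real.sign_of_pos hσ0, show (2 : ℝ) - 1 = 1 by norm_num, Real.rpow_one]
      refine weak l4 (by positivity) ?_
      have h5 := hG2 (τ / 4) ⟨by linarith, by linarith⟩
      have := hheat τ (A * (Real.log (1 + τ) / 4)) M G N (by linarith) (by positivity) h
        (le_trans (by gcongr; exact log_quarter_le (by linarith)) h5)
      linarith

/-! ### Superposition of plane waves -/

/-- The direction of `y`, zero at the origin. -/
noncomputable def dir {n : ℕ} (y : Rn n) : Rn n := ‖y‖⁻¹ • y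

theorem norm_dir_le {n : ℕ} (y : Rn n) : ‖dir y‖ ≤ 1 := by
  rw [dir, norm_smul, norm_inv, norm_norm]
  exact inv_mul_le_one

theorem norm_dir {n : ℕ} {y : Rn n} (hy : y ≠ 0) : ‖dir y‖ = 1 := by
  rw [dir, norm_smul, norm_inv, norm_norm, inv_mul_cancel₀ (norm_ne_zero_iff.2 hy)]

theorem measurable_dir (n : ℕ) : Measurable (dir : Rn n → Rn n) :=
  (measurable_norm.inv).smul measurable_id

/-- `Φ(x) = ∫_{|y|<1} exp (x · y/|y|) dy`, an average of plane waves with `ΔΦ = Φ`. -/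
noncomputable def waveAvg {n : ℕ} (x : Rn n) : ℝ :=
  ∫ y in Metric.ball (0 : Rn n) 1, Real.exp (inner ℝ x (dir y))

theorem waveAvg_nonneg {n : ℕ} (x : Rn n) : 0 ≤ waveAvg x :=
  integral_nonneg fun _ => (Real.exp_pos _).le

theorem inner_dir_le {n : ℕ} (x y : Rn n) : inner ℝ x (dir y) ≤ ‖x‖ :=
  (real_inner_le_norm _ _).trans
    (by have := mul_le_mul_of_nonneg_left (norm_dir_le y) (norm_nonneg x); linarith)

theorem abs_inner_dir_le {n : ℕ} (x y : Rn n) : |inner ℝ x (dir y)| ≤ ‖x‖ :=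
  (abs_real_inner_le_norm _ _).trans
    (by have := mul_le_mul_of_nonneg_left (norm_dir_le y) (norm_nonneg x); linarith)

/-- For the cosine c of the angle between e and y, 1 - c ≥ (1 - c²)/2 ≥ |y|²(1 - c²)/2. The bound is
quadratic in y, so averages over the solid ball reduce to Gaussian integrals and no integration on
the sphere is needed. -/
theorem inner_dir_sub_one_le {n : ℕ} {e y : Rn n} (he : ‖e‖ = 1) (hy : ‖y‖ ≤ 1) :
    inner ℝ e (dir y) - 1 ≤ -(‖y‖ ^ 2 - (inner ℝ e y) ^ 2) / 2 := by
  rcases eq_or_ne y 0 with rfl | hy0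
  · simp [dir]
  have hn : 0 < ‖y‖ := norm_pos_iff.2 hy0
  set c := inner ℝ e (dir y) with hc
  have hs : inner ℝ e y = ‖y‖ * c := by
    rw [hc, dir, inner_smul_right]; field_simp
  have hc1 : |c| ≤ 1 := he ▸ abs_inner_dir_le e y
  obtain ⟨h1, h2⟩ := abs_le.1 hc1
  rw [hs]
  have h3 : ‖y‖ ^ 2 ≤ 1 := by nlinarith
  have h4 : 0 ≤ (1 - c) * (1 + c) := mul_nonneg (by linarith) (by linarith)
  have h5 : ‖y‖ ^ 2 * ((1 - c) * (1 + c)) ≤ (1 - c) * (1 + c) := mul_le_of_le_one_left h4 h3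
  nlinarith

theorem exists_orthonormalBasis_apply_eq {n : ℕ} (i₀ : Fin n) {e : Rn n} (he : ‖e‖ = 1) :
    ∃ b : OrthonormalBasis (Fin n) ℝ (Rn n), b i₀ = e := by
  have ho : Orthonormal ℝ (({i₀} : Set (Fin n)).domRestrict fun _ : Fin n => e) := by
    constructor
    · intro i; simpa using he
    · intro i j hij
      exact absurd (Subsingleton.elim i j) hij
  obtain ⟨b, hb⟩ := ho.exists_orthonormalBasis_extension_of_card_eq (by simp)
  exact ⟨b, hb i₀ rfl⟩

theorem integral_gaussian_basis {n : ℕ} (b : OrthonormalBasis (Fin n) ℝ (Rn n)) {c : Fin n → ℝ}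
    (hc : ∀ i, 0 < c i) :
    Integrable (fun y : Rn n => ∏ i, Real.exp (-c i * (b.repr y i) ^ 2)) ∧
    ∫ y : Rn n, ∏ i, Real.exp (-c i * (b.repr y i) ^ 2) = ∏ i, Real.sqrt (Real.pi / c i) := by
  have hmp : MeasurePreserving (fun y : Rn n => (MeasurableEquiv.toLp 2 (Fin n → ℝ)).symm (b.repr y))
      volume volume :=
    (EuclideanSpace.volume_preserving_symm_measurableEquiv_toLp (Fin n)).comp
      b.measurePreserving_repr
  have hint : Integrable (fun z : Fin n → ℝ => ∏ i, Real.exp (-c i * (z i) ^ 2)) :=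
    Integrable.fintype_prod (f := fun i (x : ℝ) => Real.exp (-c i * x ^ 2))
      (fun i => integrable_exp_neg_mul_sq (hc i))
  have hemb : MeasurableEmbedding
      (fun y : Rn n => (MeasurableEquiv.toLp 2 (Fin n → ℝ)).symm (b.repr y)) :=
    (MeasurableEquiv.toLp 2 (Fin n → ℝ)).symm.measurableEmbedding.comp
      b.repr.toHomeomorph.toMeasurableEquiv.measurableEmbedding
  constructor
  · exact (hmp.integrable_comp_emb hemb).2 hint
  · have := hmp.integral_comp hemb (fun z : Fin n → ℝ => ∏ i, Real.exp (-c i * (z i) ^ 2))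
    refine this.trans ?_
    rw [integral_fintype_prod_volume_eq_prod (fun i (x : ℝ) => Real.exp (-c i * x ^ 2))]
    simp_rw [integral_gaussian]

/-- With x = r e, the factor exp(r (e·y/|y| - 1)) is dominated by a Gaussian of width about
(1+r)^(-1/2) in the n - 1 directions orthogonal to e, whence the decay (1+r)^(-(n-1)/2). -/
theorem waveAvg_le {n : ℕ} (hn : 1 ≤ n) : ∃ C : ℝ, 0 < C ∧ ∀ x : Rn n,
    waveAvg x ≤ C * Real.exp ‖x‖ * (1 + ‖x‖) ^ (-((n : ℝ) - 1) / 2) := by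
  set i₀ : Fin n := ⟨0, hn⟩
  refine ⟨Real.exp (1 / 2) * (Real.sqrt (2 * Real.pi)) ^ n, by positivity, ?_⟩
  intro x
  set r := ‖x‖ with hr
  have hr0 : 0 ≤ r := norm_nonneg x
  obtain ⟨e, he, hxe⟩ : ∃ e : Rn n, ‖e‖ = 1 ∧ x = r • e := by
    rcases eq_or_ne x 0 with rfl | hx
    · exact ⟨EuclideanSpace.single i₀ 1, by simp, by simp [hr]⟩
    · refine ⟨dir x, norm_dir hx, ?_⟩
      rw [dir, smul_smul, mul_inv_cancel₀ (norm_ne_zero_iff.2 hx), one_smul]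
  obtain ⟨b, hb⟩ := exists_orthonormalBasis_apply_eq i₀ he
  -- The extra 1/2 in every coefficient makes the integral over all of space converge and replaces r
  -- by 1 + r. It costs the factor exp(1/2), because |y| ≤ 1.
  set c : Fin n → ℝ := fun i => if i = i₀ then 1 / 2 else (1 + r) / 2 with hc
  have hc0 : ∀ i, 0 < c i := by
    intro i; simp only [hc]; split_ifs <;> positivity
  obtain ⟨hint, hval⟩ := integral_gaussian_basis b hc0
  have hpt : ∀ y ∈ Metric.ball (0 : Rn n) 1, Real.exp (inner ℝ x (dir y)) ≤
      Real.exp r * Real.exp (1 / 2) * ∏ i, Real.exp (-c i * (b.repr y i) ^ 2) := by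
    intro y hy
    have hy1 : ‖y‖ ≤ 1 := by simpa using (mem_ball_zero_iff.1 hy).le
    rw [← Real.exp_sum, ← Real.exp_add, ← Real.exp_add]
    apply Real.exp_le_exp.2
    have h1 := inner_dir_sub_one_le he hy1
    have hsum : ∑ i, -c i * (b.repr y i) ^ 2
        = -((1 + r) / 2) * ‖y‖ ^ 2 + r / 2 * (inner ℝ e y) ^ 2 := by
      have hnorm : ‖y‖ ^ 2 = ∑ i, (b.repr y i) ^ 2 := by
        rw [← b.repr.norm_map y, EuclideanSpace.norm_sq_eq]
        simp
      have he' : inner ℝ e y = b.repr y i₀ := by rw [← hb, b.repr_apply_apply]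
      rw [hnorm, he', Finset.mul_sum, ← Finset.sum_erase_add Finset.univ _ (Finset.mem_univ i₀),
        ← Finset.sum_erase_add (a := i₀) Finset.univ _ (Finset.mem_univ i₀)]
      have : ∑ i ∈ Finset.univ.erase i₀, -c i * (b.repr y i) ^ 2
          = ∑ i ∈ Finset.univ.erase i₀, -((1 + r) / 2) * (b.repr y i) ^ 2 := by
        apply Finset.sum_congr rfl
        intro i hi
        simp only [hc, if_neg (Finset.ne_of_mem_erase hi)]
      rw [this]
      simp only [hc, if_true]
      ring
    rw [hsum, hxe, inner_smul_left]
    have h2 : r * (inner ℝ e (dir y) - 1) ≤ r * (-(‖y‖ ^ 2 - (inner ℝ e y) ^ 2) / 2) :=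
      mul_le_mul_of_nonneg_left h1 hr0
    have h3 : ‖y‖ ^ 2 ≤ 1 := by nlinarith [norm_nonneg y]
    simp only [conj_trivial]
    nlinarith
  have hprod : ∏ i, Real.sqrt (Real.pi / c i)
      = (Real.sqrt (2 * Real.pi)) ^ n * (1 + r) ^ (-((n : ℝ) - 1) / 2) := by
    have h1 : ∀ i, Real.sqrt (Real.pi / c i)
        = Real.sqrt (2 * Real.pi) * (if i = i₀ then 1 else (1 + r) ^ (-(1 / 2) : ℝ)) := by
      intro i
      simp only [hc]
      split_ifs
      · rw [mul_one]; congr 1; ring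
      · rw [Real.rpow_neg (by linarith), ← Real.sqrt_eq_rpow, ← div_eq_mul_inv,
          ← Real.sqrt_div (by positivity)]
        congr 1; field_simp
    simp_rw [h1]
    rw [Finset.prod_mul_distrib, Finset.prod_const, Finset.card_univ, Fintype.card_fin]
    congr 1
    rw [← Finset.prod_erase_mul _ _ (Finset.mem_univ i₀), if_pos rfl, mul_one]
    rw [Finset.prod_congr rfl (g := fun _ => (1 + r) ^ (-(1 / 2) : ℝ))
      (fun i hi => if_neg (Finset.ne_of_mem_erase hi)), Finset.prod_const,
      Finset.card_erase_of_mem (Finset.mem_univ _), Finset.card_univ, Fintype.card_fin,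
      ← Real.rpow_natCast, ← Real.rpow_mul (by linarith)]
    congr 1
    push_cast [hn]
    ring
  calc waveAvg x
      ≤ ∫ y in Metric.ball (0 : Rn n) 1,
          Real.exp r * Real.exp (1 / 2) * ∏ i, Real.exp (-c i * (b.repr y i) ^ 2) :=
        integral_mono_of_nonneg (ae_of_all _ fun _ => (Real.exp_pos _).le)
          (hint.const_mul _).integrableOn (ae_restrict_of_forall_mem measurableSet_ball hpt)
    _ ≤ ∫ y : Rn n, Real.exp r * Real.exp (1 / 2) * ∏ i, Real.exp (-c i * (b.repr y i) ^ 2) :=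
        setIntegral_le_integral (hint.const_mul _) (ae_of_all _ fun y => by positivity)
    _ = _ := by
      rw [integral_const_mul, hval, hprod]; ring

theorem one_add_rpow_le_exp (a : ℝ) {b : ℝ} (hb : 0 < b) :
    ∃ C : ℝ, 0 < C ∧ ∀ s : ℝ, 0 ≤ s → (1 + s) ^ a ≤ C * Real.exp (b * s) := by
  set a' := |a| + 1 with ha'
  have ha0 : 0 < a' := by positivity
  set K := max 1 (a' / b) with hK
  have hK1 : 1 ≤ K := le_max_left _ _
  have hK2 : a' / b ≤ K := le_max_right _ _
  refine ⟨K ^ a', by positivity, fun s hs => ?_⟩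
  have h1 : 1 + s ≤ K * Real.exp (b * s / a') := by
    have h2 := Real.add_one_le_exp (b * s / a')
    have h3 : 1 ≤ K * (b / a') := by
      calc 1 = a' / b * (b / a') := by field_simp
        _ ≤ _ := by gcongr
    calc 1 + s ≤ K * 1 + (K * (b / a')) * s := by nlinarith
      _ = K * (b * s / a' + 1) := by ring
      _ ≤ _ := by gcongr
  calc (1 + s) ^ a ≤ (1 + s) ^ a' :=
        Real.rpow_le_rpow_of_exponent_le (by linarith) (by have := le_abs_self a; linarith)
    _ ≤ (K * Real.exp (b * s / a')) ^ a' := Real.rpow_le_rpow (by linarith) h1 ha0.le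
    _ = _ := by
      rw [Real.mul_rpow (by positivity) (by positivity), ← Real.exp_mul]
      congr 2; field_simp

/-- The weight concentrates in a shell of unit thickness at |x| = A: in polar coordinates r^(n-1) ≤
(1+A)^(n-1) and the exponential has integral one over r ≤ A. -/
theorem integral_exp_norm_sub_le {n : ℕ} (hn : 1 ≤ n) {A : ℝ} (hA : 0 ≤ A) :
    ∫ x in Metric.closedBall (0 : Rn n) A, Real.exp (‖x‖ - A)
      ≤ n * volume.real (Metric.ball (0 : Rn n) 1) * (1 + A) ^ ((n : ℝ) - 1) := by
  have : Nonempty (Fin n) := ⟨⟨0, hn⟩⟩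
  have : Nontrivial (Rn n) := inferInstance
  set φ : ℝ → ℝ := (Iic A).indicator fun r => Real.exp (r - A) with hφ
  have h1 : ∫ x in Metric.closedBall (0 : Rn n) A, Real.exp (‖x‖ - A) = ∫ x : Rn n, φ ‖x‖ := by
    rw [← integral_indicator measurableSet_closedBall]
    congr 1
    ext x
    simp only [hφ, indicator, mem_closedBall_zero_iff, mem_Iic]
  rw [h1, integral_fun_norm_addHaar, finrank_euclideanSpace_fin, nsmul_eq_mul, smul_eq_mul,
    mul_assoc]
  have hint : IntegrableOn (fun r : ℝ => Real.exp (r - A)) (Iic A) := by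
    have := (integrableOn_exp_Iic A).const_mul (Real.exp (-A))
    refine this.congr (ae_of_all _ fun r => ?_)
    simp only [← Real.exp_add]; congr 1; ring
  have hval : ∫ r in Iic A, Real.exp (r - A) = 1 := by
    have := integral_exp_Iic A
    simp_rw [Real.exp_sub]
    rw [integral_div, this, div_self (Real.exp_pos _).ne']
  have h2 : ∫ r in Ioi (0 : ℝ), r ^ (n - 1) • φ r ≤ (1 + A) ^ ((n : ℝ) - 1) := by
    have hb : ∀ r ∈ Ioi (0 : ℝ), r ^ (n - 1) • φ r ≤ (1 + A) ^ ((n : ℝ) - 1) * φ r := by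
      intro r hr
      have hr0 : (0 : ℝ) < r := hr
      simp only [hφ, indicator, mem_Iic, smul_eq_mul]
      split_ifs with h
      · gcongr
        have : ((n : ℝ) - 1) = ((n - 1 : ℕ) : ℝ) := by push_cast [hn]; ring
        rw [this, Real.rpow_natCast]
        gcongr
        linarith
      · simp
    have hφint : Integrable φ := (integrable_indicator_iff measurableSet_Iic).2 hint
    have hφ0 : ∀ r, 0 ≤ φ r := fun r => indicator_nonneg (fun _ _ => (Real.exp_pos _).le) r
    calc _ ≤ ∫ r in Ioi (0 : ℝ), (1 + A) ^ ((n : ℝ) - 1) * φ r :=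
          integral_mono_of_nonneg
            (ae_restrict_of_forall_mem measurableSet_Ioi fun r hr => by
              have hr0 : (0 : ℝ) < r := hr
              have := hφ0 r
              simp only [Pi.zero_apply, smul_eq_mul]; positivity)
            (hφint.const_mul _).integrableOn (ae_restrict_of_forall_mem measurableSet_Ioi hb)
      _ ≤ ∫ r, (1 + A) ^ ((n : ℝ) - 1) * φ r :=
          setIntegral_le_integral (hφint.const_mul _)
            (ae_of_all _ fun r => mul_nonneg (by positivity) (hφ0 r))
      _ = _ := by rw [integral_const_mul, hφ, integral_indicator measurableSet_Iic, hval, mul_one]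
  gcongr

theorem continuous_waveAvg (n : ℕ) : Continuous (waveAvg : Rn n → ℝ) := by
  rw [continuous_iff_continuousAt]
  intro x₀
  refine continuousAt_of_dominated (bound := fun _ => Real.exp (‖x₀‖ + 1)) ?_ ?_ ?_ ?_
  · refine Eventually.of_forall fun x => ?_
    exact (Real.measurable_exp.comp
      (measurable_const.inner (measurable_dir n))).aestronglyMeasurable
  · filter_upwards [Metric.ball_mem_nhds x₀ one_pos] with x hx
    refine ae_of_all _ fun y => ?_
    rw [Real.norm_eq_abs, Real.abs_exp]
    apply Real.exp_le_exp.2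
    have h1 := inner_dir_le x y
    have h2 := norm_sub_norm_le x x₀
    rw [← dist_eq_norm] at h2
    have h3 := Metric.mem_ball.1 hx
    linarith
  · exact integrableOn_const (hs := measure_ball_lt_top.ne)
  · exact ae_of_all _ fun y => by fun_prop

/-- The growth of `Φ` in `L^q` on balls. -/
theorem integral_waveAvg_rpow_le {n : ℕ} (hn : 1 ≤ n) {q : ℝ} (hq : 1 < q) :
    ∃ C : ℝ, 0 < C ∧ ∀ A : ℝ, 0 ≤ A →
      ∫ x in Metric.closedBall (0 : Rn n) A, waveAvg x ^ q
        ≤ C * Real.exp (q * A) * (1 + A) ^ (((n : ℝ) - 1) * (1 - q / 2)) := by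
  obtain ⟨C₁, hC₁, hΦ⟩ := waveAvg_le hn
  set β := ((n : ℝ) - 1) / 2 with hβ
  have hn1 : (1 : ℝ) ≤ n := by exact_mod_cast hn
  have hβ0 : 0 ≤ β := by rw [hβ]; linarith
  -- The rate q - 1 leaves exactly exp(|x| - A) out of exp(q(|x| - A)).
  obtain ⟨C₂, hC₂, hexp⟩ := one_add_rpow_le_exp (q * β) (b := q - 1) (by linarith)
  refine ⟨C₁ ^ q * C₂ * (n * volume.real (Metric.ball (0 : Rn n) 1)), ?_, ?_⟩
  · have : 0 < volume.real (Metric.ball (0 : Rn n) 1) :=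
      ENNReal.toReal_pos (Metric.measure_ball_pos _ _ one_pos).ne' measure_ball_lt_top.ne
    positivity
  intro A hA
  have hA1 : 0 < 1 + A := by linarith
  have hpt : ∀ x ∈ Metric.closedBall (0 : Rn n) A, waveAvg x ^ q ≤
      C₁ ^ q * C₂ * Real.exp (q * A) * (1 + A) ^ (-(q * β)) * Real.exp (‖x‖ - A) := by
    intro x hx
    have hxA : ‖x‖ ≤ A := mem_closedBall_zero_iff.1 hx
    have hr0 := norm_nonneg x
    set r := ‖x‖ with hr
    have hr1 : 0 < 1 + r := by linarith
    have h1 : waveAvg x ^ q ≤ C₁ ^ q * Real.exp (q * r) * (1 + r) ^ (-(q * β)) := by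
      calc waveAvg x ^ q ≤ (C₁ * Real.exp r * (1 + r) ^ (-((n : ℝ) - 1) / 2)) ^ q :=
            Real.rpow_le_rpow (waveAvg_nonneg x) (hΦ x) (by linarith)
        _ = _ := by
          rw [Real.mul_rpow (by positivity) (by positivity), Real.mul_rpow hC₁.le (by positivity),
            ← Real.exp_mul, ← Real.rpow_mul hr1.le]
          congr 2
          · rw [mul_comm]
          · rw [hβ]; ring
    -- The decay at radius r is moved to radius A via 1 + A ≤ (1 + r)(1 + A - r).
    have h2 : (1 + r) ^ (-(q * β)) ≤ (1 + A) ^ (-(q * β)) * (1 + (A - r)) ^ (q * β) := by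
      rw [Real.rpow_neg hr1.le, Real.rpow_neg hA1.le, inv_mul_eq_div, inv_eq_one_div,
        div_le_div_iff₀ (by positivity) (by positivity), one_mul,
        ← Real.mul_rpow (by linarith) (by linarith)]
      apply Real.rpow_le_rpow hA1.le _ (by positivity)
      nlinarith [mul_nonneg hr0 (sub_nonneg.2 hxA)]
    have h3 := hexp (A - r) (by linarith)
    calc waveAvg x ^ q ≤ C₁ ^ q * Real.exp (q * r) * (1 + r) ^ (-(q * β)) := h1
      _ ≤ C₁ ^ q * Real.exp (q * r) *
          ((1 + A) ^ (-(q * β)) * (C₂ * Real.exp ((q - 1) * (A - r)))) := by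
        gcongr
        exact h2.trans (by gcongr)
      _ = C₁ ^ q * C₂ * (1 + A) ^ (-(q * β)) * (Real.exp (q * r) * Real.exp ((q - 1) * (A - r))) := by
        ring
      _ = _ := by
        rw [← Real.exp_add, show q * r + (q - 1) * (A - r) = q * A + (r - A) by ring, Real.exp_add]
        ring
  calc _ ≤ ∫ x in Metric.closedBall (0 : Rn n) A,
        C₁ ^ q * C₂ * Real.exp (q * A) * (1 + A) ^ (-(q * β)) * Real.exp (‖x‖ - A) := by
        apply setIntegral_mono_on _ _ measurableSet_closedBall hpt
        · exact ((continuous_waveAvg n).rpow_const fun _ => Or.inr (by linarith)).continuousOn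
            |>.integrableOn_compact (isCompact_closedBall _ _)
        · exact Continuous.continuousOn (by fun_prop)
            |>.integrableOn_compact (isCompact_closedBall _ _)
    _ ≤ C₁ ^ q * C₂ * Real.exp (q * A) * (1 + A) ^ (-(q * β)) *
        (n * volume.real (Metric.ball (0 : Rn n) 1) * (1 + A) ^ ((n : ℝ) - 1)) := by
        rw [integral_const_mul]
        gcongr
        exact integral_exp_norm_sub_le hn hA
    _ = _ := by
      have : (1 + A) ^ (((n : ℝ) - 1) * (1 - q / 2))
          = (1 + A) ^ (-(q * β)) * (1 + A) ^ ((n : ℝ) - 1) := by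
        rw [← Real.rpow_add hA1]; congr 1; rw [hβ]; ring
      rw [this]; ring

/-! ### Testing the equation with truncated plane waves -/

/-- The truncated exponential `exp (ξ · x) χ(x)`, with `χ = 1` for `|x| ≤ ρ + 1`. -/
noncomputable def planeWave {n : ℕ} (ρ : ℝ) (hρ : 0 < ρ) (ξ x : Rn n) : ℝ :=
  Real.exp (inner ℝ ξ x) *
    (⟨ρ + 1, ρ + 2, by linarith, by linarith⟩ : ContDiffBump (0 : Rn n)) x

section planeWave

variable {n : ℕ} {ρ : ℝ} (hρ : 0 < ρ) (ξ : Rn n)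

theorem planeWave_contDiff : ContDiff ℝ ∞ (planeWave ρ hρ ξ) :=
  (Real.contDiff_exp.comp (contDiff_const.inner ℝ contDiff_id)).mul (ContDiffBump.contDiff _)

theorem planeWave_compact : HasCompactSupport (planeWave ρ hρ ξ) :=
  (ContDiffBump.hasCompactSupport _).mul_left

theorem planeWave_nonneg (x : Rn n) : 0 ≤ planeWave ρ hρ ξ x :=
  mul_nonneg (Real.exp_pos _).le (ContDiffBump.nonneg _)

theorem planeWave_eq {x : Rn n} (hx : ‖x‖ ≤ ρ + 1) :
    planeWave ρ hρ ξ x = Real.exp (inner ℝ ξ x) := by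
  rw [planeWave, ContDiffBump.one_of_mem_closedBall, mul_one]
  simpa using hx

theorem planeWave_eq_zero {x : Rn n} (hx : ρ + 2 ≤ ‖x‖) : planeWave ρ hρ ξ x = 0 := by
  rw [planeWave, ContDiffBump.zero_of_le_dist, mul_zero]
  simpa using hx

theorem planeWave_memLp (q : ℝ≥0∞) : MemLp (planeWave ρ hρ ξ) q :=
  (planeWave_contDiff hρ ξ).continuous.memLp_of_hasCompactSupport (planeWave_compact hρ ξ)

theorem planeWave_fderiv_fderiv {x : Rn n} (hx : ‖x‖ < ρ + 1) (e : Rn n) :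
    fderiv ℝ (fun y => fderiv ℝ (planeWave ρ hρ ξ) y e) x e
      = (inner ℝ ξ e) ^ 2 * planeWave ρ hρ ξ x := by
  have hd : ∀ y : Rn n, HasFDerivAt (fun y : Rn n => Real.exp (inner ℝ ξ y))
      (Real.exp (inner ℝ ξ y) • innerSL ℝ ξ) y := fun y =>
    ((innerSL ℝ ξ).hasFDerivAt (x := y)).exp
  have h1 : ∀ y : Rn n, ‖y‖ < ρ + 1 →
      fderiv ℝ (planeWave ρ hρ ξ) y e = inner ℝ ξ e * Real.exp (inner ℝ ξ y) := by
    intro y hy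
    have : planeWave ρ hρ ξ =ᶠ[𝓝 y] fun y => Real.exp (inner ℝ ξ y) := by
      filter_upwards [Metric.isOpen_ball.mem_nhds (mem_ball_zero_iff.2 hy)] with z hz
      exact planeWave_eq hρ ξ (mem_ball_zero_iff.1 hz).le
    rw [this.fderiv_eq, (hd y).fderiv]
    simp [mul_comm]
  have h2 : (fun y => fderiv ℝ (planeWave ρ hρ ξ) y e) =ᶠ[𝓝 x]
      fun y => inner ℝ ξ e * Real.exp (inner ℝ ξ y) := by
    filter_upwards [Metric.isOpen_ball.mem_nhds (mem_ball_zero_iff.2 hx)] with z hz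
    exact h1 z (mem_ball_zero_iff.1 hz)
  rw [h2.fderiv_eq, ((hd x).const_mul _).fderiv, planeWave_eq hρ ξ hx.le]
  simp
  ring

end planeWave

theorem isTestFunction_mul_bump {n : ℕ} {ψ : Rn n → ℝ} (hψ : ContDiff ℝ ∞ ψ)
    (hψc : HasCompactSupport ψ) {T : ℝ} (θ : ContDiffBump (0 : ℝ)) (hθ : θ.rOut < T) :
    IsTestFunction T (fun z : Rn n × ℝ => ψ z.1 * θ z.2) where
  smooth := (hψ.comp contDiff_fst).mul (θ.contDiff.comp contDiff_snd)
  compact := by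
    refine HasCompactSupport.intro
      (K := tsupport ψ ×ˢ Metric.closedBall (0 : ℝ) θ.rOut) (hψc.prod (isCompact_closedBall _ _)) ?_
    intro z hz
    by_contra h
    apply hz
    refine ⟨subset_tsupport _ (left_ne_zero_of_mul h), ?_⟩
    by_contra h2
    exact right_ne_zero_of_mul h (θ.zero_of_le_dist (not_le.1 h2).le)
  support := by
    have hcl : IsClosed {z : Rn n × ℝ | z.2 ≤ θ.rOut} := isClosed_le continuous_snd continuous_const
    refine (closure_minimal ?_ hcl).trans fun z hz => lt_of_le_of_lt hz hθ
    intro z hz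
    by_contra h2
    refine right_ne_zero_of_mul hz (θ.zero_of_le_dist ?_)
    rw [Real.dist_eq, sub_zero]
    exact (not_le.1 h2).le.trans (le_abs_self _)

/-- The pairing of a weak gradient with the gradient of a truncated plane wave. -/
theorem IsWeakGradient.integral_fderiv_planeWave {n : ℕ} {w : L2 n} {G : L2vec n}
    (h : IsWeakGradient w G) {ρ : ℝ} (hρ : 0 < ρ) (ξ : Rn n) (hw : ∀ᵐ x : Rn n, ρ < ‖x‖ → w x = 0) :
    ∫ x, fderiv ℝ (planeWave ρ hρ ξ) x (G x) = -(‖ξ‖ ^ 2 * ∫ x, w x * planeWave ρ hρ ξ x) := by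
  set ψ := planeWave ρ hρ ξ with hψ
  set e : Fin n → Rn n := fun i => EuclideanSpace.basisFun (Fin n) ℝ i with he
  set η : Fin n → Rn n → ℝ := fun i x => fderiv ℝ ψ x (e i) with hη
  have hηs : ∀ i, ContDiff ℝ ∞ (η i) := fun i =>
    ((planeWave_contDiff hρ ξ).fderiv_right (m := ∞) (by simp)).clm_apply contDiff_const
  have hηc : ∀ i, HasCompactSupport (η i) := fun i =>
    (planeWave_compact hρ ξ).fderiv_apply (𝕜 := ℝ) (e i)
  have hexp : ∀ x, fderiv ℝ ψ x (G x) = ∑ i, inner ℝ (G x) (e i) * η i x := by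
    intro x
    conv_lhs => rw [← (EuclideanSpace.basisFun (Fin n) ℝ).sum_repr (G x)]
    rw [map_sum]
    refine Finset.sum_congr rfl fun i _ => ?_
    rw [map_smul, smul_eq_mul, OrthonormalBasis.repr_apply_apply, real_inner_comm]
  have hint : ∀ i, Integrable (fun x => inner ℝ (G x) (e i) * η i x) := fun i =>
    MemLp.integrable_mul (p := 2) (q := 2) ((Lp.memLp G).inner_const (e i))
      ((hηs i).continuous.memLp_of_hasCompactSupport (hηc i))
  have hint2 : ∀ i, Integrable (fun x => w x * fderiv ℝ (η i) x (e i)) := fun i =>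
    MemLp.integrable_mul (p := 2) (q := 2) (Lp.memLp w)
      ((((hηs i).continuous_fderiv (by simp)).clm_apply
        continuous_const).memLp_of_hasCompactSupport ((hηc i).fderiv_apply (𝕜 := ℝ) (e i)))
  simp_rw [hexp]
  rw [integral_finsetSum _ fun i _ => hint i, ← integral_const_mul, ← neg_eq_iff_eq_neg,
    ← Finset.sum_neg_distrib]
  -- The weak gradient is tested with each ∂ᵢψ, which produces w Δψ. On the support of w the cutoff
  -- is locally constant, so there Δψ = |ξ|² ψ.
  simp_rw [← fun i => h (η i) (hηs i) (hηc i) (e i)]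
  rw [← integral_finsetSum _ fun i _ => hint2 i]
  refine integral_congr_ae ?_
  filter_upwards [hw] with x hx
  by_cases hxn : ‖x‖ < ρ + 1
  · simp_rw [hη, hψ, planeWave_fderiv_fderiv hρ ξ hxn]
    rw [← Finset.mul_sum, ← Finset.sum_mul]
    have : ∑ i, (inner ℝ ξ (e i)) ^ 2 = ‖ξ‖ ^ 2 := by
      rw [EuclideanSpace.norm_sq_eq]
      refine Finset.sum_congr rfl fun i _ => ?_
      simp only [he, EuclideanSpace.basisFun_apply, EuclideanSpace.inner_single_right]
      simp
    rw [this]; ring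
  · rw [hx (by linarith)]; simp

/-- The pairing `∫ w ψ_ξ`, as an inner product in `L²`. -/
theorem inner_planeWave {n : ℕ} {ρ : ℝ} (hρ : 0 < ρ) (ξ : Rn n) (w : L2 n) :
    inner ℝ ((planeWave_memLp hρ ξ 2).toLp (planeWave ρ hρ ξ)) w
      = ∫ x, w x * planeWave ρ hρ ξ x := by
  rw [L2.inner_def]
  refine integral_congr_ae ?_
  filter_upwards [(planeWave_memLp hρ ξ 2).coeFn_toLp] with x hx
  rw [hx]
  simp

/-- `∫ w ψ_ξ`. -/
noncomputable def pairing {n : ℕ} (ρ : ℝ) (hρ : 0 < ρ) (ξ : Rn n) (w : L2 n) : ℝ :=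
  ∫ x, w x * planeWave ρ hρ ξ x

/-- `∫ |w|^p ψ_ξ`. -/
noncomputable def source {n : ℕ} (p ρ : ℝ) (hρ : 0 < ρ) (ξ : Rn n) (w : L2 n) : ℝ :=
  ∫ x, |w x| ^ p * planeWave ρ hρ ξ x

theorem source_nonneg {n : ℕ} (p : ℝ) {ρ : ℝ} (hρ : 0 < ρ) (ξ : Rn n) (w : L2 n) :
    0 ≤ source p ρ hρ ξ w :=
  integral_nonneg fun _ => mul_nonneg (Real.rpow_nonneg (abs_nonneg _) _) (planeWave_nonneg _ _ _)

theorem pairing_eq_inner {n : ℕ} {ρ : ℝ} (hρ : 0 < ρ) (ξ : Rn n) (w : L2 n) :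
    pairing ρ hρ ξ w = innerSL ℝ ((planeWave_memLp hρ ξ 2).toLp (planeWave ρ hρ ξ)) w :=
  (inner_planeWave hρ ξ w).symm

theorem pairing_smul {n : ℕ} {ρ : ℝ} (hρ : 0 < ρ) (ξ : Rn n) (c : ℝ) (w : L2 n) :
    pairing ρ hρ ξ (c • w) = c * pairing ρ hρ ξ w := by
  rw [pairing_eq_inner, map_smul, ← pairing_eq_inner, smul_eq_mul]

theorem abs_norm_toReal_sub_le {n : ℕ} {p : ℝ≥0∞} (hp : 1 ≤ p) {μ : Measure (Rn n)}
    {v w : Rn n → ℝ} (hv : MemLp v p μ) (hw : MemLp w p μ) :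
    |(eLpNorm v p μ).toReal - (eLpNorm w p μ).toReal| ≤
      (eLpNorm (fun x => v x - w x) p μ).toReal := by
  have : Fact (1 ≤ p) := ⟨hp⟩
  have h := abs_norm_sub_norm_le (hv.toLp v) (hw.toLp w)
  rwa [← MemLp.toLp_sub, Lp.norm_toLp, Lp.norm_toLp, Lp.norm_toLp] at h

/-! ### From the weak formulation to an ordinary differential equation. -/

namespace IsEnergySolution

variable {n : ℕ} {μ₁ μ₂ p : ℝ} {f g : L2 n} {ε T R τ ρ : ℝ} {u ut : ℝ → L2 n} {Du : ℝ → L2vec n}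

theorem pairing_continuousOn (h : IsEnergySolution μ₁ μ₂ p f g ε T u ut Du) (hρ : 0 < ρ)
    (ξ : Rn n) :
    ContinuousOn (fun t => pairing ρ hρ ξ (u t)) (Ico 0 T) ∧
    ContinuousOn (fun t => pairing ρ hρ ξ (ut t)) (Ico 0 T) := by
  simp_rw [pairing_eq_inner]
  exact ⟨(ContinuousLinearMap.continuous _).comp_continuousOn h.cont_u,
    (ContinuousLinearMap.continuous _).comp_continuousOn h.cont_ut⟩

theorem pairing_hasDerivAt (h : IsEnergySolution μ₁ μ₂ p f g ε T u ut Du) (hρ : 0 < ρ)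
    (ξ : Rn n) {t : ℝ} (ht : t ∈ Ioo 0 T) :
    HasDerivAt (fun t => pairing ρ hρ ξ (u t)) (pairing ρ hρ ξ (ut t)) t := by
  simp_rw [pairing_eq_inner]
  exact (ContinuousLinearMap.hasFDerivAt _).comp_hasDerivAt t
    ((h.hasDeriv t ⟨ht.1.le, ht.2⟩).hasDerivAt (Ico_mem_nhds ht.1 ht.2))

theorem weighted_memLp (h : IsEnergySolution μ₁ μ₂ p f g ε T u ut Du) (hp : 1 < p) (hρ : 0 < ρ)
    (ξ : Rn n) : ∃ c : ℝ, 0 < c ∧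
    (∀ x, ‖planeWave ρ hρ ξ x ^ (1 / p)‖ ≤ c) ∧ ∀ t ∈ Ioo 0 T,
    MemLp (fun x => u t x * planeWave ρ hρ ξ x ^ (1 / p)) (ENNReal.ofReal p)
      (volume.restrict (Metric.closedBall 0 (ρ + 2))) := by
  have hcont : Continuous fun x => planeWave ρ hρ ξ x ^ (1 / p) :=
    (planeWave_contDiff hρ ξ).continuous.rpow_const fun x => Or.inr (by positivity)
  obtain ⟨c, hc⟩ := (planeWave_compact hρ ξ).exists_bound_of_continuous
    (planeWave_contDiff hρ ξ).continuous
  have hb : ∀ x, ‖planeWave ρ hρ ξ x ^ (1 / p)‖ ≤ (|c| + 1) ^ (1 / p) := by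
    intro x
    rw [Real.norm_of_nonneg (Real.rpow_nonneg (planeWave_nonneg hρ ξ x) _)]
    apply Real.rpow_le_rpow (planeWave_nonneg hρ ξ x) _ (by positivity)
    have := hc x
    rw [Real.norm_of_nonneg (planeWave_nonneg hρ ξ x)] at this
    linarith [le_abs_self c]
  refine ⟨(|c| + 1) ^ (1 / p), by positivity, hb, fun t ht => ?_⟩
  refine (h.memLp_loc t ht _ (isCompact_closedBall 0 (ρ + 2))).of_le_mul
    (c := (|c| + 1) ^ (1 / p)) ?_ (ae_of_all _ fun x => ?_)
  · exact (Lp.aestronglyMeasurable (u t)).restrict.mul hcont.aestronglyMeasurable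
  · rw [norm_mul, mul_comm]
    exact mul_le_mul_of_nonneg_right (hb x) (norm_nonneg _)

/-- Absorbing ψ^(1/p) into u turns the source into a power of an L^p norm, so that continuity in
L^p_loc passes to it by the triangle inequality. -/
theorem source_eq_eLpNorm (h : IsEnergySolution μ₁ μ₂ p f g ε T u ut Du) (hp : 1 < p) (hρ : 0 < ρ)
    (ξ : Rn n) {t : ℝ} (ht : t ∈ Ioo 0 T) :
    source p ρ hρ ξ (u t) = (eLpNorm (fun x => u t x * planeWave ρ hρ ξ x ^ (1 / p))
      (ENNReal.ofReal p) (volume.restrict (Metric.closedBall 0 (ρ + 2)))).toReal ^ p := by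
  obtain ⟨c, -, -, hm⟩ := h.weighted_memLp hp hρ ξ
  have hp0 : 0 < p := by linarith
  rw [(hm t ht).eLpNorm_eq_integral_rpow_norm (by simpa using hp0) ENNReal.ofReal_ne_top,
    ENNReal.toReal_ofReal hp0.le, ENNReal.toReal_ofReal (by positivity), ← Real.rpow_mul
    (integral_nonneg fun _ => by positivity), inv_mul_cancel₀ hp0.ne', Real.rpow_one, source,
    ← setIntegral_eq_integral_of_forall_compl_eq_zero (s := Metric.closedBall 0 (ρ + 2))]
  · congr 1
    ext x
    have h0 := planeWave_nonneg hρ ξ x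
    rw [norm_mul, Real.mul_rpow (norm_nonneg _) (norm_nonneg _), Real.norm_eq_abs,
      Real.norm_of_nonneg (Real.rpow_nonneg h0 _), ← Real.rpow_mul h0, one_div,
      inv_mul_cancel₀ hp0.ne', Real.rpow_one]
  · intro x hx
    rw [planeWave_eq_zero, mul_zero]
    simpa using (not_le.1 (fun h' => hx (mem_closedBall_zero_iff.2 h'))).le

theorem source_continuousOn (h : IsEnergySolution μ₁ μ₂ p f g ε T u ut Du) (hp : 1 < p)
    (hρ : 0 < ρ) (ξ : Rn n) : ContinuousOn (fun t => source p ρ hρ ξ (u t)) (Ioo 0 T) := by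
  obtain ⟨c, hc, hb, hm⟩ := h.weighted_memLp hp hρ ξ
  set K := Metric.closedBall (0 : Rn n) (ρ + 2)
  have hp1 : 1 ≤ ENNReal.ofReal p := by rw [ENNReal.one_le_ofReal]; exact hp.le
  refine ContinuousOn.congr (f := fun t => (eLpNorm (fun x => u t x * planeWave ρ hρ ξ x ^ (1 / p))
      (ENNReal.ofReal p) (volume.restrict K)).toReal ^ p) ?_
    (fun t ht => h.source_eq_eLpNorm hp hρ ξ ht)
  refine ContinuousOn.rpow_const ?_ fun _ _ => Or.inr (by linarith)
  intro t ht
  refine ContinuousAt.continuousWithinAt ?_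
  have hlim := h.cont_Lp_loc t ht K (isCompact_closedBall 0 (ρ + 2))
  have hlim' : Tendsto (fun s => c * (eLpNorm (fun x => u s x - u t x) (ENNReal.ofReal p)
      (volume.restrict K)).toReal) (𝓝 t) (𝓝 0) := by
    have := ((ENNReal.tendsto_toReal ENNReal.zero_ne_top).comp hlim).const_mul c
    simpa using this
  rw [ContinuousAt, tendsto_iff_norm_sub_tendsto_zero]
  refine squeeze_zero' (Eventually.of_forall fun _ => norm_nonneg _) ?_ hlim'
  filter_upwards [Ioo_mem_nhds ht.1 ht.2] with s hs
  refine (abs_norm_toReal_sub_le hp1 (hm s hs) (hm t ht)).trans ?_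
  have hd : MemLp (fun x => u s x - u t x) (ENNReal.ofReal p) (volume.restrict K) :=
    (h.memLp_loc s hs K (isCompact_closedBall 0 (ρ + 2))).sub
      (h.memLp_loc t ht K (isCompact_closedBall 0 (ρ + 2)))
  have hle := eLpNorm_le_mul_eLpNorm_of_ae_le_mul (c := c) (p := ENNReal.ofReal p)
    (μ := volume.restrict K)
    (f := fun x => u s x * planeWave ρ hρ ξ x ^ (1 / p) - u t x * planeWave ρ hρ ξ x ^ (1 / p))
    (g := fun x => u s x - u t x)
    (ae_of_all _ fun x => by
      rw [← sub_mul, norm_mul, mul_comm]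
      exact mul_le_mul_of_nonneg_right (hb x) (norm_nonneg _))
  have := ENNReal.toReal_mono (ENNReal.mul_ne_top ENNReal.ofReal_ne_top hd.eLpNorm_ne_top) hle
  rwa [ENNReal.toReal_mul, ENNReal.toReal_ofReal hc.le] at this

/-- Continuity of u in L^p_loc is only available for t > 0; integrability down to time zero comes
from `integrable_nonlin`. -/
theorem source_intervalIntegrable (h : IsEnergySolution μ₁ μ₂ p f g ε T u ut Du) (hp : 1 < p)
    (hρ : 0 < ρ) (ξ : Rn n) {t : ℝ} (ht : t ∈ Ioo 0 T) :
    IntervalIntegrable (fun s => source p ρ hρ ξ (u s)) volume 0 t := by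
  obtain ⟨c, hc⟩ := (planeWave_compact hρ ξ).exists_bound_of_continuous
    (planeWave_contDiff hρ ξ).continuous
  have hp0 : 0 < p := by linarith
  set K := Metric.closedBall (0 : Rn n) (ρ + 2)
  have hK : IsCompact K := isCompact_closedBall 0 (ρ + 2)
  have hsub : Ioc 0 t ⊆ Ioo 0 T := fun s hs => ⟨hs.1, hs.2.trans_lt ht.2⟩
  refine ((h.integrable_nonlin t ht K hK).const_mul c).mono_fun' ?_ ?_
  · rw [uIoc_of_le ht.1.le]
    exact ((h.source_continuousOn hp hρ ξ).mono hsub).aestronglyMeasurable measurableSet_Ioc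
  · rw [uIoc_of_le ht.1.le]
    refine ae_restrict_of_forall_mem measurableSet_Ioc fun s hs => ?_
    beta_reduce
    rw [Real.norm_of_nonneg (source_nonneg _ _ _ _), source,
      ← setIntegral_eq_integral_of_forall_compl_eq_zero (s := K), ← integral_const_mul]
    · refine integral_mono_of_nonneg
        (ae_of_all _ fun x => mul_nonneg (Real.rpow_nonneg (abs_nonneg _) _)
          (planeWave_nonneg hρ ξ x)) ?_ (ae_of_all _ fun x => ?_)
      · have := (h.memLp_loc s (hsub hs) K hK).integrable_norm_rpow (by simpa using hp0)
          ENNReal.ofReal_ne_top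
        rw [ENNReal.toReal_ofReal hp0.le] at this
        exact this.const_mul c
      · have := hc x
        rw [Real.norm_of_nonneg (planeWave_nonneg hρ ξ x)] at this
        have h0 : 0 ≤ |u s x| ^ p := Real.rpow_nonneg (abs_nonneg _) _
        simp only
        nlinarith
    · intro x hx
      rw [planeWave_eq_zero, mul_zero]
      exact (not_le.1 (fun h' => hx (mem_closedBall_zero_iff.2 h'))).le

theorem pairing_integral_eq (h : IsEnergySolution μ₁ μ₂ p f g ε T u ut Du)
    (hsupp : SupportedInCone R T u) (hτ : 0 < τ) (hτT : τ < T) (hρ : 0 < ρ) (hρR : τ + R ≤ ρ)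
    (ξ : Rn n) {t : ℝ} (ht : t ∈ Icc 0 τ) :
    pairing ρ hρ ξ (ut t) - pairing ρ hρ ξ (ut 0)
      + (∫ s in (0 : ℝ)..t, -(‖ξ‖ ^ 2 * pairing ρ hρ ξ (u s)))
      + (∫ s in (0 : ℝ)..t, μ₁ / (1 + s) * pairing ρ hρ ξ (ut s))
      + (∫ s in (0 : ℝ)..t, μ₂ / (1 + s) ^ 2 * pairing ρ hρ ξ (u s))
    = ∫ s in (0 : ℝ)..t, source p ρ hρ ξ (u s) := by
  set ψ := planeWave ρ hρ ξ with hψ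
  -- A time cutoff equal to 1 near [0, τ] and vanishing before T: the space-time test function is
  -- the truncated plane wave on the whole interval of integration, and its time derivative drops
  -- out.
  let θ : ContDiffBump (0 : ℝ) := ⟨(2 * τ + T) / 3, (τ + 2 * T) / 3, by linarith, by linarith⟩
  have hθ1 : ∀ s, 0 ≤ s → s ≤ τ → θ =ᶠ[𝓝 s] fun _ => 1 := by
    intro s hs0 hs
    have : s ∈ Metric.ball (0 : ℝ) θ.rIn := by
      rw [Metric.mem_ball, Real.dist_eq, sub_zero, abs_of_nonneg hs0]
      show s < (2 * τ + T) / 3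
      linarith
    filter_upwards [Metric.isOpen_ball.mem_nhds this] with r hr
    exact θ.one_of_mem_closedBall (Metric.ball_subset_closedBall hr)
  have hθv : ∀ s, 0 ≤ s → s ≤ τ → θ s = 1 := fun s h0 h1 => (hθ1 s h0 h1).self_of_nhds
  have hw := h.weak_eq (fun z => ψ z.1 * θ z.2)
    (isTestFunction_mul_bump (planeWave_contDiff hρ ξ) (planeWave_compact hρ ξ) θ
      (show (τ + 2 * T) / 3 < T by linarith)) t ⟨ht.1, ht.2.trans_lt hτT⟩
  have e1 : (∫ x, ut t x * (ψ x * θ t)) = pairing ρ hρ ξ (ut t) := by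
    simp only [hθv t ht.1 ht.2, mul_one]; rfl
  have e2 : (∫ x, ε * g x * (ψ x * θ 0)) = pairing ρ hρ ξ (ut 0) := by
    rw [h.init_ut, pairing]
    refine integral_congr_ae ?_
    filter_upwards [Lp.coeFn_smul ε g] with x hx
    rw [hx, hθv 0 le_rfl hτ.le, mul_one, Pi.smul_apply, smul_eq_mul]
  have hIcc : ∀ s ∈ uIcc 0 t, 0 ≤ s ∧ s ≤ τ := fun s hs => by
    rw [uIcc_of_le ht.1] at hs
    exact ⟨hs.1, hs.2.trans ht.2⟩
  have e3 : (∫ s in (0 : ℝ)..t, ∫ x, (-(ut s x * deriv (fun r => ψ x * θ r) s)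
            + fderiv ℝ (fun y => ψ y * θ s) x (Du s x)))
      = ∫ s in (0 : ℝ)..t, -(‖ξ‖ ^ 2 * pairing ρ hρ ξ (u s)) := by
    refine intervalIntegral.integral_congr fun s hs => ?_
    obtain ⟨h0, h1⟩ := hIcc s hs
    have hd : ∀ x, deriv (fun r => ψ x * θ r) s = 0 := by
      intro x
      have : (fun r => ψ x * θ r) =ᶠ[𝓝 s] fun _ => ψ x := by
        filter_upwards [hθ1 s h0 h1] with r hr
        rw [hr, mul_one]
      rw [this.deriv_eq, deriv_const]
    simp only [hd, mul_zero, neg_zero, zero_add, hθv s h0 h1, mul_one]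
    refine (h.weak_grad s ⟨h0, h1.trans_lt hτT⟩).integral_fderiv_planeWave hρ ξ ?_
    filter_upwards [hsupp s ⟨h0, h1.trans_lt hτT⟩] with x hx hxρ
    exact hx (by linarith)
  have e4 : (∫ s in (0 : ℝ)..t, ∫ x, μ₁ / (1 + s) * ut s x * (ψ x * θ s))
      = ∫ s in (0 : ℝ)..t, μ₁ / (1 + s) * pairing ρ hρ ξ (ut s) := by
    refine intervalIntegral.integral_congr fun s hs => ?_
    obtain ⟨h0, h1⟩ := hIcc s hs
    simp only [hθv s h0 h1, mul_one, mul_assoc, pairing, integral_const_mul, hψ]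
  have e5 : (∫ s in (0 : ℝ)..t, ∫ x, μ₂ / (1 + s) ^ 2 * u s x * (ψ x * θ s))
      = ∫ s in (0 : ℝ)..t, μ₂ / (1 + s) ^ 2 * pairing ρ hρ ξ (u s) := by
    refine intervalIntegral.integral_congr fun s hs => ?_
    obtain ⟨h0, h1⟩ := hIcc s hs
    simp only [hθv s h0 h1, mul_one, mul_assoc, pairing, integral_const_mul, hψ]
  have e6 : (∫ s in (0 : ℝ)..t, ∫ x, |u s x| ^ p * (ψ x * θ s))
      = ∫ s in (0 : ℝ)..t, source p ρ hρ ξ (u s) := by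
    refine intervalIntegral.integral_congr fun s hs => ?_
    obtain ⟨h0, h1⟩ := hIcc s hs
    simp only [hθv s h0 h1, mul_one, source, hψ]
  simp only at hw
  rw [e1, e2, e3, e4, e5, e6] at hw
  exact hw

/-- The weak formulation only provides an integral identity for the pairing with u_t. Its integrands
are continuous at interior times, so the fundamental theorem of calculus yields a pointwise second
order equation. -/
theorem pairing_ut_hasDerivAt (h : IsEnergySolution μ₁ μ₂ p f g ε T u ut Du) (hp : 1 < p)
    (hsupp : SupportedInCone R T u) (hτ : 0 < τ) (hτT : τ < T) (hρ : 0 < ρ) (hρR : τ + R ≤ ρ)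
    (ξ : Rn n) {t : ℝ} (ht : t ∈ Ioo 0 τ) :
    HasDerivAt (fun t => pairing ρ hρ ξ (ut t))
      (source p ρ hρ ξ (u t) + ‖ξ‖ ^ 2 * pairing ρ hρ ξ (u t)
        - μ₁ / (1 + t) * pairing ρ hρ ξ (ut t) - μ₂ / (1 + t) ^ 2 * pairing ρ hρ ξ (u t)) t := by
  have hT : t ∈ Ioo 0 T := ⟨ht.1, ht.2.trans hτT⟩
  obtain ⟨hcu, hcut⟩ := h.pairing_continuousOn hρ ξ
  have hFTC : ∀ F : ℝ → ℝ, ContinuousOn F (Ico 0 T) →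
      HasDerivAt (fun r => ∫ s in (0 : ℝ)..r, F s) (F t) t := by
    intro F hF
    refine intervalIntegral.integral_hasDerivAt_right ?_ ?_ ?_
    · refine (hF.mono ?_).intervalIntegrable
      rw [uIcc_of_le ht.1.le]
      exact fun s hs => ⟨hs.1, hs.2.trans_lt hT.2⟩
    · exact (hF.mono Ioo_subset_Ico_self).stronglyMeasurableAtFilter isOpen_Ioo t hT
    · exact hF.continuousAt (Ico_mem_nhds hT.1 hT.2)
  have hone : ContinuousOn (fun s : ℝ => 1 + s) (Ico 0 T) := by fun_prop
  have d1 := hFTC (fun s => -(‖ξ‖ ^ 2 * pairing ρ hρ ξ (u s))) (continuousOn_const.mul hcu).neg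
  have d2 := hFTC (fun s => μ₁ / (1 + s) * pairing ρ hρ ξ (ut s))
    ((continuousOn_const.div hone fun s hs => by linarith [hs.1]).mul hcut)
  have d3 := hFTC (fun s => μ₂ / (1 + s) ^ 2 * pairing ρ hρ ξ (u s))
    ((continuousOn_const.div (hone.pow 2) fun s hs => by
      have : 0 < 1 + s := by linarith [hs.1]
      exact pow_ne_zero 2 this.ne').mul hcu)
  have hcs := h.source_continuousOn hp hρ ξ
  have d4 : HasDerivAt (fun r => ∫ s in (0 : ℝ)..r, source p ρ hρ ξ (u s))
      (source p ρ hρ ξ (u t)) t :=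
    intervalIntegral.integral_hasDerivAt_right (h.source_intervalIntegrable hp hρ ξ hT)
      (hcs.stronglyMeasurableAtFilter isOpen_Ioo t hT) (hcs.continuousAt (Ioo_mem_nhds hT.1 hT.2))
  have hd := (((d4.sub d1).sub d2).sub d3).add_const (pairing ρ hρ ξ (ut 0))
  refine (hd.congr_of_eventuallyEq ?_).congr_deriv (by ring)
  filter_upwards [Ioo_mem_nhds ht.1 ht.2] with r hr
  have := h.pairing_integral_eq hsupp hτ hτT hρ hρR ξ ⟨hr.1.le, hr.2.le⟩
  simp only [Pi.sub_apply]
  linarith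

end IsEnergySolution

/-- Reduction of the damped second order equation to a first order system. -/
theorem damped_to_momentum {μ₁ μ₂ σ q N t : ℝ} {Y Z : ℝ → ℝ} (ht : 0 < t)
    (hσ : σ ^ 2 = (μ₁ - 1) ^ 2 - 4 * μ₂) (hY : HasDerivAt Y (Z t) t)
    (hZ : HasDerivAt Z (N + q * Y t - μ₁ / (1 + t) * Z t - μ₂ / (1 + t) ^ 2 * Y t) t) :
    HasDerivAt (fun s => (1 + s) ^ ((μ₁ - 1 + σ) / 2) * Y s)
      ((1 + t) ^ (σ - 1) * ((1 + t) ^ ((1 + μ₁ - σ) / 2) * Z t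
        + (μ₁ - 1 + σ) / 2 * (1 + t) ^ ((1 + μ₁ - σ) / 2 - 1) * Y t)) t ∧
    HasDerivAt (fun s => (1 + s) ^ ((1 + μ₁ - σ) / 2) * Z s
        + (μ₁ - 1 + σ) / 2 * (1 + s) ^ ((1 + μ₁ - σ) / 2 - 1) * Y s)
      ((1 + t) ^ ((1 + μ₁ - σ) / 2) * (N + q * Y t)) t := by
  have h1 : 0 < 1 + t := by linarith
  constructor
  · refine ((hasDerivAt_one_add_rpow ht.le _).mul hY).congr_deriv ?_
    have e1 : (1 + t) ^ ((μ₁ - 1 + σ) / 2) = (1 + t) ^ (σ - 1) * (1 + t) ^ ((1 + μ₁ - σ) / 2) := by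
      rw [← Real.rpow_add h1]; congr 1; ring
    rw [Real.rpow_sub_one h1.ne', Real.rpow_sub_one h1.ne' ((1 + μ₁ - σ) / 2), e1]
    field_simp
    ring
  · refine (((hasDerivAt_one_add_rpow ht.le _).mul hZ).add
      (((hasDerivAt_one_add_rpow ht.le ((1 + μ₁ - σ) / 2 - 1)).const_mul
        ((μ₁ - 1 + σ) / 2)).mul hY)).congr_deriv ?_
    rw [Real.rpow_sub_one h1.ne' ((1 + μ₁ - σ) / 2 - 1), Real.rpow_sub_one h1.ne']
    -- With σ² = δ the zeroth order terms cancel, which is what dictates the two exponents of the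
    -- momentum.
    have hμ : μ₂ = ((μ₁ - 1) ^ 2 - σ ^ 2) / 4 := by linarith
    rw [hμ]
    field_simp
    ring

/-! ### Lower bounds for the nonlinear term -/

section support

variable {n : ℕ} {ρ A p : ℝ} {w : L2 n}

theorem pairing_eq_setIntegral (hρ : 0 < ρ) (hA : A ≤ ρ) (hw : ∀ᵐ x : Rn n, A < ‖x‖ → w x = 0)
    (ξ : Rn n) :
    pairing ρ hρ ξ w = ∫ x in Metric.closedBall 0 A, w x * Real.exp (inner ℝ ξ x) := by
  rw [pairing, ← integral_indicator measurableSet_closedBall]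
  refine integral_congr_ae ?_
  filter_upwards [hw] with x hx
  by_cases h : ‖x‖ ≤ A
  · rw [indicator_of_mem (by simpa using h), planeWave_eq hρ ξ (by linarith)]
  · rw [indicator_of_notMem (by simpa using h), hx (not_le.1 h), zero_mul]

theorem source_zero_eq_setIntegral (hp : 0 < p) (hρ : 0 < ρ) (hA : A ≤ ρ)
    (hw : ∀ᵐ x : Rn n, A < ‖x‖ → w x = 0) :
    source p ρ hρ 0 w = ∫ x in Metric.closedBall 0 A, |w x| ^ p := by
  rw [source, ← integral_indicator measurableSet_closedBall]
  refine integral_congr_ae ?_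
  filter_upwards [hw] with x hx
  by_cases h : ‖x‖ ≤ A
  · rw [indicator_of_mem (by simpa using h), planeWave_eq hρ 0 (by linarith)]
    simp
  · rw [indicator_of_notMem (by simpa using h), hx (not_le.1 h), abs_zero, Real.zero_rpow hp.ne',
      zero_mul]

theorem integrableOn_closedBall (w : L2 n) (A : ℝ) :
    IntegrableOn w (Metric.closedBall 0 A) := by
  have : IsFiniteMeasure (volume.restrict (Metric.closedBall (0 : Rn n) A)) :=
    ⟨by rw [Measure.restrict_apply_univ]; exact measure_closedBall_lt_top⟩
  exact ((Lp.memLp w).restrict _).integrable one_le_two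

/-- Hölder's inequality, as a lower bound for `∫ |w|^p`. -/
theorem rpow_le_integral_rpow_mul {q L B : ℝ} {s : Set (Rn n)} {v Φ : Rn n → ℝ}
    (hpq : p.HolderConjugate q) (hL : 0 ≤ L) (hv : MemLp v (ENNReal.ofReal p) (volume.restrict s))
    (hΦ : MemLp Φ (ENNReal.ofReal q) (volume.restrict s)) (hΦ0 : ∀ x, 0 ≤ Φ x)
    (h : L ≤ ∫ x in s, v x * Φ x) (hB : ∫ x in s, Φ x ^ q ≤ B) :
    L ^ p ≤ (∫ x in s, |v x| ^ p) * B ^ (p - 1) := by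
  have hp0 := hpq.pos
  have hq0 := hpq.symm.pos
  have hI : 0 ≤ ∫ x in s, |v x| ^ p :=
    integral_nonneg fun _ => Real.rpow_nonneg (abs_nonneg _) _
  have hJ : 0 ≤ ∫ x in s, Φ x ^ q := integral_nonneg fun x => Real.rpow_nonneg (hΦ0 x) _
  have h1 : L ≤ (∫ x in s, |v x| ^ p) ^ (1 / p) * (∫ x in s, Φ x ^ q) ^ (1 / q) := by
    refine h.trans ?_
    calc ∫ x in s, v x * Φ x ≤ ∫ x in s, |v x| * Φ x := by
          refine (le_abs_self _).trans ((abs_integral_le_integral_abs).trans_eq ?_)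
          congr 1
          ext x
          rw [abs_mul, abs_of_nonneg (hΦ0 x)]
      _ ≤ _ := integral_mul_le_Lp_mul_Lq_of_nonneg hpq (ae_of_all _ fun _ => abs_nonneg _)
          (ae_of_all _ hΦ0) hv.abs hΦ
  calc L ^ p ≤ ((∫ x in s, |v x| ^ p) ^ (1 / p) * (∫ x in s, Φ x ^ q) ^ (1 / q)) ^ p :=
        Real.rpow_le_rpow hL h1 hp0.le
    _ = (∫ x in s, |v x| ^ p) * (∫ x in s, Φ x ^ q) ^ (p - 1) := by
      rw [Real.mul_rpow (by positivity) (by positivity), ← Real.rpow_mul hI,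
        one_div_mul_cancel hp0.ne', Real.rpow_one, ← Real.rpow_mul hJ]
      congr 2
      -- The exponent p/q equals p - 1.
      have := hpq.sub_one_mul_conj
      field_simp
      linarith
    _ ≤ _ := by
      have := hpq.lt
      gcongr

/-- The average of the plane wave pairings over all directions. -/
theorem integral_pairing_dir (hρ : 0 < ρ) (hA : A ≤ ρ)
    (hw : ∀ᵐ x : Rn n, A < ‖x‖ → w x = 0) :
    IntegrableOn (fun y => pairing ρ hρ (dir y) w) (Metric.ball 0 1) ∧
    ∫ y in Metric.ball 0 1, pairing ρ hρ (dir y) w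
      = ∫ x in Metric.closedBall 0 A, w x * waveAvg x := by
  have hfin : IsFiniteMeasure (volume.restrict (Metric.ball (0 : Rn n) 1)) :=
    ⟨by rw [Measure.restrict_apply_univ]; exact measure_ball_lt_top⟩
  have hint : Integrable (Function.uncurry fun (y x : Rn n) => w x * Real.exp (inner ℝ (dir y) x))
      ((volume.restrict (Metric.ball 0 1)).prod (volume.restrict (Metric.closedBall 0 A))) := by
    have h1 : Integrable (fun z : Rn n × Rn n => w z.2)
        ((volume.restrict (Metric.ball 0 1)).prod (volume.restrict (Metric.closedBall 0 A))) :=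
      (show Integrable w (volume.restrict (Metric.closedBall 0 A)) from
        integrableOn_closedBall w A).comp_snd _
    have hm : Measurable fun z : Rn n × Rn n => Real.exp (inner ℝ (dir z.1) z.2) :=
      Real.measurable_exp.comp (((measurable_dir n).comp measurable_fst).inner measurable_snd)
    refine h1.mul_bdd (c := Real.exp A) hm.aestronglyMeasurable ?_
    rw [Measure.prod_restrict]
    refine ae_restrict_of_forall_mem (measurableSet_ball.prod measurableSet_closedBall) ?_
    intro z hz
    rw [Real.norm_eq_abs, Real.abs_exp]
    apply Real.exp_le_exp.2
    rw [real_inner_comm]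
    exact (inner_dir_le _ _).trans (mem_closedBall_zero_iff.1 hz.2)
  simp_rw [fun y => pairing_eq_setIntegral hρ hA hw (dir y)]
  refine ⟨hint.integral_prod_left, ?_⟩
  rw [integral_integral_swap hint]
  congr 1
  ext x
  rw [integral_const_mul, waveAvg]
  simp_rw [real_inner_comm]

end support

theorem volume_real_ball_pos (n : ℕ) : 0 < volume.real (Metric.ball (0 : Rn n) 1) :=
  ENNReal.toReal_pos (Metric.measure_ball_pos _ _ one_pos).ne' measure_ball_lt_top.ne

theorem volume_real_closedBall {n : ℕ} {A : ℝ} (hA : 0 ≤ A) :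
    volume.real (Metric.closedBall (0 : Rn n) A) = A ^ n * volume.real (Metric.ball (0 : Rn n) 1) := by
  rw [measureReal_def, Measure.addHaar_closedBall _ _ hA, ENNReal.toReal_mul,
    ENNReal.toReal_ofReal (by positivity), finrank_euclideanSpace_fin, measureReal_def]

theorem one_add_add_rpow_le (e : ℝ) {R : ℝ} (hR : 0 ≤ R) :
    ∃ C : ℝ, 0 < C ∧ ∀ t : ℝ, 0 ≤ t → (1 + (t + R)) ^ e ≤ C * (1 + t) ^ e := by
  refine ⟨max 1 ((1 + R) ^ e), by positivity, fun t ht => ?_⟩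
  rcases le_total 0 e with he | he
  · calc (1 + (t + R)) ^ e ≤ ((1 + R) * (1 + t)) ^ e :=
          Real.rpow_le_rpow (by linarith) (by nlinarith) he
      _ = (1 + R) ^ e * (1 + t) ^ e := Real.mul_rpow (by linarith) (by linarith)
      _ ≤ _ := by gcongr; exact le_max_right _ _
  · calc (1 + (t + R)) ^ e ≤ 1 * (1 + t) ^ e := by
          rw [one_mul]
          exact Real.rpow_le_rpow_of_nonpos (by linarith) (by linarith) he
      _ ≤ _ := by gcongr; exact le_max_left _ _

namespace IsEnergySolution

variable {n : ℕ} {μ₁ μ₂ p σ : ℝ} {f g : L2 n} {ε T R τ ρ : ℝ} {u ut : ℝ → L2 n}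
  {Du : ℝ → L2vec n}

/-- This is the condition h = 0 in the form used later: the momentum vanishes at time zero. -/
theorem pairing_init (h : IsEnergySolution μ₁ μ₂ p f g ε T u ut Du)
    (hh : ((μ₁ - 1 + σ) / 2) • f + g = 0) (hρ : 0 < ρ) (ξ : Rn n) :
    pairing ρ hρ ξ (ut 0) = -((μ₁ - 1 + σ) / 2) * pairing ρ hρ ξ (u 0) := by
  have hg : g = (-((μ₁ - 1 + σ) / 2)) • f := by
    rw [neg_smul]; exact eq_neg_of_add_eq_zero_right hh
  rw [h.init_u, h.init_ut, hg, smul_comm, pairing_smul]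

/-- No support condition is imposed on f; it follows from the cone condition at t = 0 as soon as a
solution exists. -/
theorem support_data (h : IsEnergySolution μ₁ μ₂ p f g ε T u ut Du) (hT : 0 < T)
    (hsupp : SupportedInCone R T u) (hε : 0 < ε) : ∀ᵐ x : Rn n, R < ‖x‖ → f x = 0 := by
  have h0 := hsupp 0 ⟨le_rfl, hT⟩
  rw [h.init_u] at h0
  filter_upwards [h0, Lp.coeFn_smul ε f] with x hx hs hR
  have := hx (by linarith)
  rw [hs, Pi.smul_apply, smul_eq_mul] at this
  exact (mul_eq_zero.1 this).resolve_left hε.ne'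

/-- The data of a truncated plane wave pairing. -/
theorem pairing_data (h : IsEnergySolution μ₁ μ₂ p f g ε T u ut Du) (hT : 0 < T)
    (hsupp : SupportedInCone R T u) (hε : 0 < ε) (hf : 0 ≤ f) (hρ : 0 < ρ) (hρR : R ≤ ρ)
    {ξ : Rn n} (hξ : ‖ξ‖ ≤ 1) :
    ε * (Real.exp (-R) * ∫ x in Metric.closedBall 0 R, f x) ≤ pairing ρ hρ ξ (u 0) := by
  have hs := h.support_data hT hsupp hε
  have hf0 : ∀ᵐ x : Rn n, 0 ≤ f x := (Lp.coeFn_nonneg f).2 hf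
  rw [h.init_u, pairing_smul, pairing_eq_setIntegral hρ hρR hs, ← integral_const_mul]
  refine mul_le_mul_of_nonneg_left ?_ hε.le
  have hif := integrableOn_closedBall f R
  refine integral_mono_ae (hif.const_mul _) ?_ ?_
  · refine hif.mul_continuousOn (Continuous.continuousOn (by fun_prop)) (isCompact_closedBall _ _)
  · refine (ae_restrict_iff' measurableSet_closedBall).2 ?_
    filter_upwards [hf0] with x hx hxR
    rw [mul_comm]
    refine mul_le_mul_of_nonneg_left (Real.exp_le_exp.2 ?_) hx
    have h1 := abs_le.1 (abs_real_inner_le_norm ξ x)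
    have h2 : ‖x‖ ≤ R := mem_closedBall_zero_iff.1 hxR
    have h3 : ‖ξ‖ * ‖x‖ ≤ 1 * R := by gcongr
    linarith [h1.1]

end IsEnergySolution

/-- Exponential growth of the plane wave pairings. -/
theorem exists_pairing_growth (μ₁ σ : ℝ) : ∃ c : ℝ, 0 < c ∧
    ∀ {n : ℕ} {μ₂ p : ℝ} {f g : L2 n} {ε T R τ ρ : ℝ} {u ut : ℝ → L2 n} {Du : ℝ → L2vec n},
    IsEnergySolution μ₁ μ₂ p f g ε T u ut Du → SupportedInCone R T u →
    σ ^ 2 = (μ₁ - 1) ^ 2 - 4 * μ₂ → 1 < p → ((μ₁ - 1 + σ) / 2) • f + g = 0 →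
    0 < τ → τ < T → ∀ (hρ : 0 < ρ), τ + R ≤ ρ → ∀ ξ : Rn n, ‖ξ‖ = 1 →
    0 < pairing ρ hρ ξ (u 0) → ∀ t ∈ Icc 0 τ,
    c * pairing ρ hρ ξ (u 0) * ((1 + t) ^ (-(μ₁ / 2)) * Real.exp t) ≤ pairing ρ hρ ξ (u t) := by
  -- With m = (1-σ)/2 the weights of `wave_system_growth` are those of the momentum system; the
  -- nonnegative source is discarded.
  obtain ⟨c, hc, hgrow⟩ := wave_system_growth ((1 - σ) / 2)
  refine ⟨c, hc, ?_⟩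
  intro n μ₂ p f g ε T R τ ρ u ut Du h hsupp hσ hp hh hτ hτT hρ hρR ξ hξ hpos t ht
  obtain ⟨hcu, hcut⟩ := h.pairing_continuousOn hρ ξ
  have hIcc : Icc 0 τ ⊆ Ico 0 T := fun s hs => ⟨hs.1, hs.2.trans_lt hτT⟩
  have hder : ∀ s ∈ Ioo 0 τ, _ := fun s hs =>
    damped_to_momentum (q := ‖ξ‖ ^ 2) (Y := fun t => pairing ρ hρ ξ (u t))
      (Z := fun t => pairing ρ hρ ξ (ut t)) (N := source p ρ hρ ξ (u s)) hs.1 hσ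
      (h.pairing_hasDerivAt hρ ξ ⟨hs.1, hs.2.trans hτT⟩)
      (h.pairing_ut_hasDerivAt hp hsupp hτ hτT hρ hρR ξ hs)
  have hfin := hgrow τ _ _ (fun s => (1 + s) ^ ((1 + μ₁ - σ) / 2) *
      (source p ρ hρ ξ (u s) + ‖ξ‖ ^ 2 * pairing ρ hρ ξ (u s)))
    ((continuousOn_one_add_rpow ((μ₁ - 1 + σ) / 2) τ).mul (hcu.mono hIcc))
    (((continuousOn_one_add_rpow ((1 + μ₁ - σ) / 2) τ).mul (hcut.mono hIcc)).add
      ((continuousOn_const.mul (continuousOn_one_add_rpow ((1 + μ₁ - σ) / 2 - 1) τ)).mul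
        (hcu.mono hIcc)))
    (fun s hs => by
      have := (hder s hs).1
      rw [show -2 * ((1 - σ) / 2) = σ - 1 by ring]
      exact this)
    (fun s hs => (hder s hs).2)
    (fun s hs => by
      have hs0 : 0 < 1 + s := by linarith [hs.1]
      have hN := source_nonneg p hρ ξ (u s)
      simp only [Pi.mul_apply]
      rw [hξ, ← mul_assoc, ← Real.rpow_add hs0,
        show 2 * ((1 - σ) / 2) + (μ₁ - 1 + σ) / 2 = (1 + μ₁ - σ) / 2 by ring]
      gcongr
      linarith)
    (by simpa using hpos)
    (by
      simp only [Pi.mul_apply, Pi.add_apply, add_zero, Real.one_rpow, one_mul, mul_one]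
      rw [h.pairing_init hh hρ ξ]
      linarith) t ht
  simp only [Pi.mul_apply, add_zero, Real.one_rpow, one_mul] at hfin
  have ht0 : 0 < 1 + t := by linarith [ht.1]
  have hpow : 0 < (1 + t) ^ ((μ₁ - 1 + σ) / 2) := by positivity
  refine le_of_mul_le_mul_left (le_trans (le_of_eq ?_) hfin) hpow
  rw [show -((1 - σ) / 2) = (μ₁ - 1 + σ) / 2 + -(μ₁ / 2) by ring, Real.rpow_add ht0]
  ring

/-- Polynomial lower bound for `∫ |u|^p` caused by the wave part of the solution. -/
theorem exists_source_lower {n : ℕ} (hn : 1 ≤ n) {μ₁ μ₂ p σ R : ℝ} {f g : L2 n} (hR : 1 ≤ R)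
    (hp : 1 < p) (hσ : σ ^ 2 = (μ₁ - 1) ^ 2 - 4 * μ₂) (hh : ((μ₁ - 1 + σ) / 2) • f + g = 0)
    (hf : 0 ≤ f) (hf_pos : 0 < ∫ x in Metric.closedBall 0 R, f x) : ∃ c : ℝ, 0 < c ∧
    ∀ (ε T τ : ℝ) (u ut : ℝ → L2 n) (Du : ℝ → L2vec n),
    IsEnergySolution μ₁ μ₂ p f g ε T u ut Du → SupportedInCone R T u → 0 < ε →
    0 < τ → τ < T → ∀ (hρ : 0 < τ + R), ∀ t ∈ Ioo 0 τ,
    c * ε ^ p * (1 + t) ^ ((n : ℝ) - 1 - (n + μ₁ - 1) * p / 2) ≤ source p (τ + R) hρ 0 (u t) := by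
  have hpq : p.HolderConjugate p.conjExponent := Real.HolderConjugate.conjExponent hp
  set q := p.conjExponent with hq
  obtain ⟨c, hc, hgrow⟩ := exists_pairing_growth μ₁ σ
  obtain ⟨C, hC, hΦ⟩ := integral_waveAvg_rpow_le hn hpq.symm.lt
  obtain ⟨C₂, hC₂, hcomp⟩ :=
    one_add_add_rpow_le (((n : ℝ) - 1) * (1 - q / 2)) (by linarith : 0 ≤ R)
  set I := Real.exp (-R) * ∫ x in Metric.closedBall 0 R, f x with hI
  have hI0 : 0 < I := by positivity
  set v := volume.real (Metric.ball (0 : Rn n) 1) with hv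
  have hv0 : 0 < v := volume_real_ball_pos n
  set D := C * Real.exp (q * R) * C₂ with hD
  have hD0 : 0 < D := by positivity
  refine ⟨(v * (c * I)) ^ p / D ^ (p - 1), by positivity, ?_⟩
  intro ε T τ u ut Du h hsupp hε hτ hτT hρ t ht
  have ht0 : 0 < 1 + t := by linarith [ht.1]
  have htR : 0 ≤ t + R := by linarith [ht.1]
  have hw := hsupp t ⟨ht.1.le, ht.2.trans hτT⟩
  have hAρ : t + R ≤ τ + R := by linarith [ht.2]
  obtain ⟨hint, havg⟩ := integral_pairing_dir hρ hAρ hw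
  set E := (1 + t) ^ (-(μ₁ / 2)) * Real.exp t with hE
  have hE0 : 0 < E := by positivity
  have hlow : ∀ y : Rn n, y ≠ 0 → c * (ε * I) * E ≤ pairing (τ + R) hρ (dir y) (u t) := by
    intro y hy
    have hdata := h.pairing_data (hτ.trans hτT) hsupp hε hf hρ (by linarith) (norm_dir_le y)
    refine le_trans ?_ (hgrow h hsupp hσ hp hh hτ hτT hρ le_rfl (dir y) (norm_dir hy)
      (lt_of_lt_of_le (by positivity) hdata) t ⟨ht.1.le, ht.2.le⟩)
    gcongr
  have hL : v * (c * (ε * I) * E) ≤ ∫ x in Metric.closedBall 0 (t + R), u t x * waveAvg x := by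
    rw [← havg]
    calc v * (c * (ε * I) * E) = ∫ _ in Metric.ball (0 : Rn n) 1, c * (ε * I) * E := by
          rw [setIntegral_const, smul_eq_mul]
      _ ≤ _ := by
          refine integral_mono_ae (integrableOn_const (hs := measure_ball_lt_top.ne)) hint ?_
          have : Nonempty (Fin n) := ⟨⟨0, hn⟩⟩
          have : Nontrivial (Rn n) := inferInstance
          -- At the origin `dir` is zero rather than a unit vector, but a point is null because n ≥
          -- 1.
          have h0 : ∀ᵐ y : Rn n, y ≠ 0 := by
            rw [ae_iff]; simp
          exact ae_restrict_of_ae (h0.mono fun y hy => hlow y hy)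
  have hB : ∫ x in Metric.closedBall (0 : Rn n) (t + R), waveAvg x ^ q
      ≤ D * (Real.exp (q * t) * (1 + t) ^ (((n : ℝ) - 1) * (1 - q / 2))) := by
    refine (hΦ (t + R) htR).trans ?_
    calc _ ≤ C * Real.exp (q * (t + R)) * (C₂ * (1 + t) ^ (((n : ℝ) - 1) * (1 - q / 2))) := by
          gcongr
          exact hcomp t ht.1.le
      _ = _ := by rw [mul_add, Real.exp_add, hD]; ring
  have hfinite : IsFiniteMeasure (volume.restrict (Metric.closedBall (0 : Rn n) (t + R))) :=
    ⟨by rw [Measure.restrict_apply_univ]; exact measure_closedBall_lt_top⟩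
  have hΦm : MemLp (waveAvg : Rn n → ℝ) (ENNReal.ofReal q)
      (volume.restrict (Metric.closedBall (0 : Rn n) (t + R))) := by
    obtain ⟨K, hK⟩ := (isCompact_closedBall (0 : Rn n) (t + R)).exists_bound_of_continuousOn
      (continuous_waveAvg n).continuousOn
    exact MemLp.of_bound (continuous_waveAvg n).aestronglyMeasurable K
      (ae_restrict_of_forall_mem measurableSet_closedBall hK)
  have hHol := rpow_le_integral_rpow_mul hpq (by positivity)
    (h.memLp_loc t ⟨ht.1, ht.2.trans hτT⟩ _ (isCompact_closedBall 0 (t + R))) hΦm waveAvg_nonneg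
    hL hB
  rw [source_zero_eq_setIntegral hpq.pos hρ hAρ hw]
  -- Because of this identity the exponentials on the two sides of Hölder's inequality are both
  -- exp(p t) and cancel, leaving a power of 1 + t.
  have hqp : q * (p - 1) = p := by rw [mul_comm]; exact hpq.sub_one_mul_conj
  have e1 : (D * (Real.exp (q * t) * (1 + t) ^ (((n : ℝ) - 1) * (1 - q / 2)))) ^ (p - 1)
      = D ^ (p - 1) * (Real.exp (p * t) *
        (1 + t) ^ (((n : ℝ) - 1) * (1 - q / 2) * (p - 1))) := by
    rw [Real.mul_rpow hD0.le (by positivity), Real.mul_rpow (Real.exp_pos (q * t)).le (by positivity),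
      ← Real.exp_mul, ← Real.rpow_mul ht0.le]
    rw [show q * t * (p - 1) = q * (p - 1) * t by ring, hqp]
  have e2 : (v * (c * (ε * I) * E)) ^ p = (v * (c * I)) ^ p * ε ^ p *
      ((1 + t) ^ (-(μ₁ / 2) * p) * Real.exp (p * t)) := by
    rw [show v * (c * (ε * I) * E) = (v * (c * I)) * ε * E by ring,
      Real.mul_rpow (by positivity) hE0.le, Real.mul_rpow (by positivity) hε.le, hE,
      Real.mul_rpow (y := Real.exp t) (by positivity) (by positivity), ← Real.rpow_mul ht0.le, ← Real.exp_mul,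
      mul_comm t p]
  have e3 : (1 + t) ^ (-(μ₁ / 2) * p) = (1 + t) ^ ((n : ℝ) - 1 - (n + μ₁ - 1) * p / 2) *
      (1 + t) ^ (((n : ℝ) - 1) * (1 - q / 2) * (p - 1)) := by
    rw [← Real.rpow_add ht0]
    congr 1
    have : ((n : ℝ) - 1) * (1 - q / 2) * (p - 1)
        = ((n : ℝ) - 1) * (p - 1) - ((n : ℝ) - 1) / 2 * (q * (p - 1)) := by ring
    rw [this, hqp]; ring
  rw [e1, e2, e3] at hHol
  rw [div_mul_eq_mul_div, div_mul_eq_mul_div, div_le_iff₀ (by positivity)]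
  have hX : 0 < Real.exp (p * t) * (1 + t) ^ (((n : ℝ) - 1) * (1 - q / 2) * (p - 1)) := by
    positivity
  refine le_of_mul_le_mul_right (le_trans (le_of_eq ?_) (hHol.trans_eq ?_)) hX <;> ring

/-- Hölder lower bound of `∫ |u|^p` by the spatial mean. -/
theorem exists_source_lower_mean {n : ℕ} {p R : ℝ} (hR : 1 ≤ R) (hp : 1 < p) :
    ∃ c : ℝ, 0 < c ∧ ∀ {μ₁ μ₂ : ℝ} {f g : L2 n} {ε T τ : ℝ} {u ut : ℝ → L2 n} {Du : ℝ → L2vec n},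
    IsEnergySolution μ₁ μ₂ p f g ε T u ut Du → SupportedInCone R T u →
    τ < T → ∀ (hρ : 0 < τ + R), ∀ t ∈ Ioo 0 τ, 0 ≤ pairing (τ + R) hρ 0 (u t) →
    c * (1 + t) ^ (-(n * (p - 1))) * pairing (τ + R) hρ 0 (u t) ^ p
      ≤ source p (τ + R) hρ 0 (u t) := by
  have hpq : p.HolderConjugate p.conjExponent := Real.HolderConjugate.conjExponent hp
  set q := p.conjExponent with hq
  set v := volume.real (Metric.ball (0 : Rn n) 1) with hv
  have hv0 : 0 < v := volume_real_ball_pos n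
  refine ⟨1 / (R ^ n * v) ^ (p - 1), by positivity, ?_⟩
  intro μ₁ μ₂ f g ε T τ u ut Du h hsupp hτT hρ t ht hY
  have ht0 : 0 < 1 + t := by linarith [ht.1]
  have htR : 0 ≤ t + R := by linarith [ht.1]
  have hw := hsupp t ⟨ht.1.le, ht.2.trans hτT⟩
  have hAρ : t + R ≤ τ + R := by linarith [ht.2]
  have hfinite : IsFiniteMeasure (volume.restrict (Metric.closedBall (0 : Rn n) (t + R))) :=
    ⟨by rw [Measure.restrict_apply_univ]; exact measure_closedBall_lt_top⟩
  have hHol := rpow_le_integral_rpow_mul (L := pairing (τ + R) hρ 0 (u t)) (Φ := fun _ => 1)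
    (B := (R ^ n * v) * (1 + t) ^ (n : ℝ)) hpq hY
    (h.memLp_loc t ⟨ht.1, ht.2.trans hτT⟩ _ (isCompact_closedBall 0 (t + R))) (memLp_const 1)
    (fun _ => zero_le_one) (by
      rw [pairing_eq_setIntegral hρ hAρ hw]
      simp) (by
      simp only [Real.one_rpow]
      rw [setIntegral_const, smul_eq_mul, mul_one, volume_real_closedBall htR, Real.rpow_natCast]
      calc (t + R) ^ n * v ≤ (R * (1 + t)) ^ n * v := by
            gcongr
            nlinarith [ht.1]
        _ = _ := by rw [mul_pow]; ring)
  rw [source_zero_eq_setIntegral hpq.pos hρ hAρ hw]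
  rw [Real.mul_rpow (by positivity) (by positivity), ← Real.rpow_mul ht0.le] at hHol
  rw [Real.rpow_neg ht0.le, ← one_div, one_div_mul_one_div, div_mul_eq_mul_div, one_mul,
    div_le_iff₀ (by positivity)]
  exact hHol

/-! ### A priori inequalities for the existence time -/

/-- Every existence time is controlled by four inequalities. -/
theorem exists_time_control {n : ℕ} (hn : 1 ≤ n) {μ₁ μ₂ p σ R : ℝ} {f g : L2 n} (hR : 1 ≤ R)
    (hp : 1 < p) (hσ0 : 0 ≤ σ) (hσ : σ ^ 2 = (μ₁ - 1) ^ 2 - 4 * μ₂)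
    (hh : ((μ₁ - 1 + σ) / 2) • f + g = 0) (hf : 0 ≤ f) (hf_ne : f ≠ 0) :
    ∃ C : ℝ, 0 < C ∧ ∀ (ε T τ : ℝ) (u ut : ℝ → L2 n) (Du : ℝ → L2vec n),
    IsEnergySolution μ₁ μ₂ p f g ε T u ut Du → SupportedInCone R T u → 0 < ε → 15 ≤ τ → τ < T →
    ε * (1 + τ) ^ (2 / (p - 1) - n - (μ₁ - 1 + σ) / 2) ≤ C ∧
    ε ^ p * (1 + τ) ^ (gammaS p (n + μ₁) / (2 * (p - 1))) ≤ C ∧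
    ε ^ p * (1 + τ) ^ (gammaF p (n + (μ₁ - 1 - σ) / 2) / (p - 1))
      * Real.log (1 + τ) ^ (1 - Real.sign σ) ≤ C ∧
    ((n + μ₁ - 1) * (p - 1) = n - σ + 2 →
      ε ^ p * (1 + τ) ^ (gammaF p (n + (μ₁ - 1 - σ) / 2) / (p - 1))
        * Real.log (1 + τ) ^ (2 - Real.sign σ) ≤ C) := by
  have hf0 : ∀ᵐ x : Rn n, 0 ≤ f x := (Lp.coeFn_nonneg f).2 hf
  set J := ∫ x in Metric.closedBall 0 R, f x with hJ
  have hJ0 : 0 ≤ J := integral_nonneg_of_ae (ae_restrict_of_ae hf0)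
  -- If f has zero integral over the ball of radius R, a solution would force f = 0 by its support;
  -- so no solution exists and any constant works.
  rcases hJ0.eq_or_lt with hJ0 | hJpos
  · refine ⟨1, one_pos, fun ε T τ u ut Du h hsupp hε hτ hτT => absurd ?_ hf_ne⟩
    have hs := h.support_data (by linarith) hsupp hε
    have hz := (setIntegral_eq_zero_iff_of_nonneg_ae (ae_restrict_of_ae hf0)
      (integrableOn_closedBall f R)).1 hJ0.symm
    rw [Filter.EventuallyEq, ae_restrict_iff' measurableSet_closedBall] at hz
    refine (Lp.eq_zero_iff_ae_eq_zero).2 ?_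
    filter_upwards [hs, hz] with x h1 h2
    by_cases hx : ‖x‖ ≤ R
    · exact h2 (mem_closedBall_zero_iff.2 hx)
    · exact h1 (not_le.1 hx)
  obtain ⟨c₁, hc₁, hmean⟩ := exists_source_lower_mean (n := n) hR hp
  obtain ⟨c₂, hc₂, hwave⟩ := exists_source_lower hn hR hp hσ hh hf hJpos
  set α := (μ₁ - 1 + σ) / 2 with hα
  set k := (1 + μ₁ - σ) / 2 with hk
  set d := (n : ℝ) - 1 - (n + μ₁ - 1) * p / 2 with hd
  -- The Hölder weight (1+t)^(-n(p-1)) combined with Y^p = (1+t)^(-αp) M^p.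
  set e := -(n * (p - 1)) - α * p with he
  obtain ⟨C, hC, hdich⟩ := momentum_dichotomy k d e hσ0 hp hc₁
  set I := Real.exp (-R) * J with hI
  have hI0 : 0 < I := by positivity
  have hp1 : 0 < p - 1 := by linarith
  set c := min I c₂ with hc
  have hc0 : 0 < c := by positivity
  refine ⟨C / c, by positivity, ?_⟩
  intro ε T τ u ut Du h hsupp hε hτ hτT
  have hτ0 : 0 < τ := by linarith
  have hρ : 0 < τ + R := by linarith
  obtain ⟨hcu, hcut⟩ := h.pairing_continuousOn hρ (0 : Rn n)
  have hIcc : Icc 0 τ ⊆ Ico 0 T := fun s hs => ⟨hs.1, hs.2.trans_lt hτT⟩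
  have hdata : ε * I ≤ pairing (τ + R) hρ 0 (u 0) :=
    h.pairing_data (by linarith) hsupp hε hf hρ (by linarith) (by simp)
  set M : ℝ → ℝ := fun s => (1 + s) ^ α * pairing (τ + R) hρ 0 (u s) with hM
  set G : ℝ → ℝ := fun s => (1 + s) ^ k * pairing (τ + R) hρ 0 (ut s)
    + α * (1 + s) ^ (k - 1) * pairing (τ + R) hρ 0 (u s) with hG
  have hsys : IsMomentumSystem σ k τ M G (fun s => source p (τ + R) hρ 0 (u s)) := by
    have hder : ∀ s ∈ Ioo 0 τ, _ := fun s hs =>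
      damped_to_momentum (q := ‖(0 : Rn n)‖ ^ 2) (Y := fun t => pairing (τ + R) hρ 0 (u t))
        (Z := fun t => pairing (τ + R) hρ 0 (ut t)) (N := source p (τ + R) hρ 0 (u s)) hs.1 hσ
        (h.pairing_hasDerivAt hρ 0 ⟨hs.1, hs.2.trans hτT⟩)
        (h.pairing_ut_hasDerivAt hp hsupp hτ0 hτT hρ le_rfl 0 hs)
    refine ⟨?_, ?_, fun s hs => (hder s hs).1, fun s hs => ?_,
      fun s _ => source_nonneg p hρ 0 (u s), ?_, ?_⟩
    · exact (continuousOn_one_add_rpow α τ).mul (hcu.mono hIcc)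
    · exact ((continuousOn_one_add_rpow k τ).mul (hcut.mono hIcc)).add
        ((continuousOn_const.mul (continuousOn_one_add_rpow (k - 1) τ)).mul (hcu.mono hIcc))
    · have := (hder s hs).2
      simpa using this
    · simp only [hM, add_zero, Real.one_rpow, one_mul]
      exact lt_of_lt_of_le (by positivity) hdata
    · simp only [hG, add_zero, Real.one_rpow, one_mul, mul_one]
      rw [h.pairing_init hh hρ 0, ← hα]
      linarith
  have hMY : ∀ t, 0 ≤ t → pairing (τ + R) hρ 0 (u t) = (1 + t) ^ (-α) * M t := by
    intro t ht
    rw [hM]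
    simp only
    rw [← mul_assoc, ← Real.rpow_add (by linarith), neg_add_cancel, Real.rpow_zero, one_mul]
  have hA : 0 ≤ c₂ * ε ^ p := by positivity
  obtain ⟨r1, r2, r3, r4⟩ := hdich τ (c₂ * ε ^ p) M G _ hτ hA hsys (fun t ht => by
      have ht0 : 0 < 1 + t := by linarith [ht.1]
      have hMt : 0 < M t := hsys.M_pos ⟨ht.1.le, ht.2.le⟩
      have hY0 : 0 ≤ pairing (τ + R) hρ 0 (u t) := by rw [hMY t ht.1.le]; positivity
      refine le_trans (le_of_eq ?_) (hmean h hsupp hτT hρ t ht hY0)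
      rw [hMY t ht.1.le, Real.mul_rpow (by positivity) hMt.le, ← Real.rpow_mul ht0.le, he,
        sub_eq_add_neg, Real.rpow_add ht0, neg_mul]
      ring) (fun t ht => hwave ε T τ u ut Du h hsupp hε hτ0 hτT hρ t ht)
  have hS : 0 < 1 + τ := by linarith
  set H := -(σ + 1 + k + e) / (p - 1) with hH
  have hHe : H = n + α - 2 / (p - 1) := by
    rw [hH, he, hk, hα]; field_simp; ring
  have hlog : 0 ≤ Real.log (1 + τ) := Real.log_nonneg (by linarith)
  -- Dividing by Kato's upper bound: subtracting H from the exponents 0, k + d + σ + 1 and σ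
  -- produces the exponents of the statement.
  have key : ∀ x b : ℝ, c * x * (1 + τ) ^ b ≤ C * (1 + τ) ^ H → x * (1 + τ) ^ (b - H) ≤ C / c := by
    intro x b hx
    rw [Real.rpow_sub hS, ← mul_div_assoc, div_le_div_iff₀ (by positivity) hc0]
    linarith
  have hcI : c ≤ I := min_le_left _ _
  have hcc : c ≤ c₂ := min_le_right _ _
  refine ⟨?_, ?_, ?_, fun hcrit => ?_⟩
  · have := key ε 0 (by
      rw [Real.rpow_zero, mul_one]
      refine le_trans ?_ r1
      have : M 0 = pairing (τ + R) hρ 0 (u 0) := by simp [hM]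
      rw [this]
      refine le_trans ?_ hdata
      rw [mul_comm]
      gcongr)
    rw [hHe] at this
    refine le_trans (le_of_eq ?_) this
    congr 2
    ring
  · have := key (ε ^ p) (k + d + σ + 1) (by
      refine le_trans ?_ r2
      gcongr)
    refine le_trans (le_of_eq ?_) this
    congr 2
    rw [hHe, hk, hd, hα, gammaS]
    field_simp
    ring
  · have := key (ε ^ p * Real.log (1 + τ) ^ (1 - Real.sign σ)) σ (by
      refine le_trans ?_ r3
      rw [← mul_assoc, mul_right_comm]
      gcongr)
    refine le_trans (le_of_eq ?_) this
    rw [mul_right_comm]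
    congr 2
    rw [hHe, hα, gammaF]
    field_simp
    ring
  · have := key (ε ^ p * Real.log (1 + τ) ^ (2 - Real.sign σ)) σ (by
      refine le_trans ?_ (r4 (by rw [hk, hd]; linarith))
      rw [← mul_assoc, mul_right_comm]
      gcongr)
    refine le_trans (le_of_eq ?_) this
    rw [mul_right_comm]
    congr 2
    rw [hHe, hα, gammaF]
    field_simp
    ring

/-! ### From inequalities for the existence time to lifespan bounds. -/

theorem lifespan_le {n : ℕ} {μ₁ μ₂ p R ε B : ℝ} {f g : L2 n} (hB : 15 ≤ B)
    (h : ∀ (T τ : ℝ) (u ut : ℝ → L2 n) (Du : ℝ → L2vec n),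
      IsEnergySolution μ₁ μ₂ p f g ε T u ut Du → SupportedInCone R T u → 15 ≤ τ → τ < T → τ ≤ B) :
    lifespan μ₁ μ₂ p f g R ε ≤ ENNReal.ofReal B := by
  refine sSup_le ?_
  rintro _ ⟨T, -, rfl, u, ut, Du, hsol, hsupp⟩
  refine ENNReal.ofReal_le_ofReal ?_
  by_contra! hBT
  have := h T ((B + T) / 2) u ut Du hsol hsupp (by linarith) (by linarith)
  linarith

/-- Every larger constant is admitted, so that the bounds of all regimes can later share one
constant. The first conclusion meets the threshold 15 of `lifespan_le`. -/
theorem exists_power_bound {a r C : ℝ} (ha : 0 < a) (hr : 0 ≤ r) (hC : 0 < C) :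
    ∃ C₀ : ℝ, ∀ C₁ : ℝ, C₀ ≤ C₁ → ∀ ε : ℝ, 0 < ε → ε ≤ 1 →
      15 ≤ C₁ * ε ^ (-r / a) ∧
      ∀ τ : ℝ, 0 ≤ τ → ε ^ r * (1 + τ) ^ a ≤ C → τ ≤ C₁ * ε ^ (-r / a) := by
  refine ⟨max 15 (C ^ (1 / a)), fun C₁ hC₁ ε hε hε1 => ?_⟩
  have h1 : 1 ≤ ε ^ (-r / a) :=
    Real.one_le_rpow_of_pos_of_le_one_of_nonpos hε hε1
      (div_nonpos_of_nonpos_of_nonneg (by linarith) ha.le)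
  have h15 : 15 ≤ C₁ := (le_max_left _ _).trans hC₁
  have hCa : C ^ (1 / a) ≤ C₁ := (le_max_right _ _).trans hC₁
  refine ⟨by nlinarith, fun τ hτ h => ?_⟩
  have h2 : (1 + τ) ^ a ≤ C * ε ^ (-r) := by
    rw [Real.rpow_neg hε.le, ← div_eq_mul_inv, le_div_iff₀ (by positivity)]
    linarith
  calc τ ≤ 1 + τ := by linarith
    _ = ((1 + τ) ^ a) ^ (1 / a) := by
      rw [← Real.rpow_mul (by linarith), mul_one_div_cancel ha.ne', Real.rpow_one]
    _ ≤ (C * ε ^ (-r)) ^ (1 / a) := Real.rpow_le_rpow (by positivity) h2 (by positivity)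
    _ = C ^ (1 / a) * ε ^ (-r / a) := by
      rw [Real.mul_rpow hC.le (by positivity), ← Real.rpow_mul hε.le]
      congr 2; ring
    _ ≤ _ := by gcongr

theorem strictMonoOn_rpow_mul_log {a c : ℝ} (ha : 0 < a) (hc : 0 ≤ c) :
    StrictMonoOn (fun s : ℝ => s ^ a * Real.log (1 + s) ^ c) (Ici 0) := by
  intro s hs t _ hst
  have hs0 : 0 ≤ s := hs
  have hlt : 0 < Real.log (1 + t) := Real.log_pos (by linarith)
  have h1 : s ^ a < t ^ a := Real.rpow_lt_rpow hs0 hst ha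
  have h2 : Real.log (1 + s) ^ c ≤ Real.log (1 + t) ^ c :=
    Real.rpow_le_rpow (Real.log_nonneg (by linarith))
      (Real.log_le_log (by linarith) (by linarith)) hc
  have h3 : 0 < Real.log (1 + t) ^ c := Real.rpow_pos_of_pos hlt c
  exact (mul_le_mul_of_nonneg_left h2 (Real.rpow_nonneg hs0 a)).trans_lt (mul_lt_mul_of_pos_right h1 h3)

theorem exists_mixed_solution {a c X : ℝ} (ha : 0 < a) (hc : 0 ≤ c) (hX : 0 < X) :
    ∃! s : ℝ, 0 < s ∧ X * s ^ a * Real.log (1 + s) ^ c = 1 := by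
  have hmono := strictMonoOn_rpow_mul_log ha hc
  set φ : ℝ → ℝ := fun s => s ^ a * Real.log (1 + s) ^ c with hφ
  have hiff : ∀ s : ℝ, X * s ^ a * Real.log (1 + s) ^ c = 1 ↔ φ s = X⁻¹ := by
    intro s
    rw [hφ, ← mul_eq_one_iff_eq_inv₀ hX.ne', mul_assoc, mul_comm X]
  simp_rw [hiff]
  -- S ≥ 2 gives log(1+S) ≥ 1, so the logarithm can be dropped at the upper end of the intermediate
  -- value argument.
  set S : ℝ := max 2 (X⁻¹ ^ (1 / a)) with hS
  have hS2 : 2 ≤ S := le_max_left _ _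
  have hcont : ContinuousOn φ (Icc 0 S) := by
    refine ContinuousOn.mul ?_ ?_
    · exact continuousOn_id.rpow_const fun _ _ => Or.inr ha.le
    · refine ContinuousOn.rpow_const ?_ fun _ _ => Or.inr hc
      exact ContinuousOn.log (by fun_prop) fun s hs => by linarith [hs.1]
  have h0 : φ 0 = 0 := by simp [hφ, Real.zero_rpow ha.ne']
  have hSX : X⁻¹ ≤ φ S := by
    have h1 : X⁻¹ ≤ S ^ a := by
      calc X⁻¹ = (X⁻¹ ^ (1 / a)) ^ a := by
            rw [← Real.rpow_mul (by positivity), one_div_mul_cancel ha.ne', Real.rpow_one]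
        _ ≤ S ^ a := Real.rpow_le_rpow (by positivity) (le_max_right _ _) ha.le
    have h2 : 1 ≤ Real.log (1 + S) := by
      rw [Real.le_log_iff_exp_le (by linarith)]
      linarith [Real.exp_one_lt_d9]
    have h3 : 1 ≤ Real.log (1 + S) ^ c := Real.one_le_rpow h2 hc
    have h4 : 0 ≤ S ^ a := by positivity
    simp only [hφ]
    nlinarith
  obtain ⟨s, hs, hsX⟩ := intermediate_value_Icc (by linarith : (0 : ℝ) ≤ S) hcont
    ⟨by rw [h0]; positivity, hSX⟩
  have hs0 : 0 < s := by
    rcases hs.1.eq_or_lt with h | h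
    · rw [← h, h0] at hsX
      have : 0 < X⁻¹ := by positivity
      linarith
    · exact h
  exact ⟨s, ⟨hs0, hsX⟩, fun t ht => hmono.injOn (mem_Ici.2 ht.1.le) (mem_Ici.2 hs0.le)
    (ht.2.trans hsX.symm)⟩

theorem exists_mixed_bound {a c p C : ℝ} (ha : 0 < a) (hc : 0 ≤ c) (hp : 0 < p) (hC : 0 < C) :
    ∃ C₀ : ℝ, ∀ C₁ : ℝ, C₀ ≤ C₁ → ∀ ε : ℝ, 0 < ε → ε ≤ 1 →
      ∀ s : ℝ, 0 < s → ε ^ p * s ^ a * Real.log (1 + s) ^ c = 1 → 15 ≤ C₁ * s ∧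
      ∀ τ : ℝ, 0 ≤ τ → ε ^ p * (1 + τ) ^ a * Real.log (1 + τ) ^ c ≤ C → τ ≤ C₁ * s := by
  refine ⟨max 15 ((C + 1) ^ (1 / a)), fun C₁ hC₁ ε hε hε1 s hs heq => ?_⟩
  have h15 : 15 ≤ C₁ := (le_max_left _ _).trans hC₁
  have hC₁0 : 0 < C₁ := by linarith
  have hCa : C + 1 ≤ C₁ ^ a := by
    calc C + 1 = ((C + 1) ^ (1 / a)) ^ a := by
          rw [← Real.rpow_mul (by positivity), one_div_mul_cancel ha.ne', Real.rpow_one]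
      _ ≤ C₁ ^ a := Real.rpow_le_rpow (by positivity) ((le_max_right _ _).trans hC₁) ha.le
  -- For ε ≤ 1 and s < 1 every factor of the defining equation is at most 1 and s^a is below 1,
  -- since log(1+s) ≤ s.
  have hs1 : 1 ≤ s := by
    by_contra! hlt
    have h1 : ε ^ p ≤ 1 := Real.rpow_le_one hε.le hε1 hp.le
    have h2 : s ^ a < 1 := Real.rpow_lt_one hs.le hlt ha
    have hl0 : 0 ≤ Real.log (1 + s) := Real.log_nonneg (by linarith)
    have h3 : Real.log (1 + s) ^ c ≤ 1 :=
      Real.rpow_le_one hl0 (by linarith [Real.log_le_sub_one_of_pos (by linarith : 0 < 1 + s)]) hc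
    have h4 : 0 ≤ s ^ a := by positivity
    have h5 : ε ^ p * s ^ a < 1 := (mul_le_of_le_one_left h4 h1).trans_lt h2
    have h6 : 0 ≤ ε ^ p * s ^ a := by positivity
    have h7 : ε ^ p * s ^ a * Real.log (1 + s) ^ c < 1 :=
      (mul_le_of_le_one_right h6 h3).trans_lt h5
    linarith
  refine ⟨by nlinarith, fun τ hτ h => ?_⟩
  by_contra! hlt
  have hτs : s ≤ τ := by nlinarith
  have h1 : C₁ ^ a * s ^ a ≤ (1 + τ) ^ a := by
    rw [← Real.mul_rpow hC₁0.le hs.le]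
    exact Real.rpow_le_rpow (by positivity) (by linarith) ha.le
  have h2 : Real.log (1 + s) ^ c ≤ Real.log (1 + τ) ^ c :=
    Real.rpow_le_rpow (Real.log_nonneg (by linarith))
      (Real.log_le_log (by linarith) (by linarith)) hc
  have h3 : 0 ≤ Real.log (1 + s) ^ c := Real.rpow_nonneg (Real.log_nonneg (by linarith)) _
  have h4 : C₁ ^ a * (ε ^ p * s ^ a * Real.log (1 + s) ^ c)
      ≤ ε ^ p * (1 + τ) ^ a * Real.log (1 + τ) ^ c := by
    calc _ = ε ^ p * (C₁ ^ a * s ^ a) * Real.log (1 + s) ^ c := by ring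
      _ ≤ _ := by gcongr
  rw [heq] at h4
  linarith

/-! ### Exponents -/

/-- d_* is the positive root x of (2+x)(ν-1+x) = 4(ν-1). This quadratic says 1 + (2+x)/(ν-1) = 1 +
4/(ν-1+x), so the Strauss, Fujita and p_* exponents agree at n - √δ = d_*. -/
theorem dStar_spec {ν : ℝ} (hν : 1 < ν) :
    0 < dStar ν ∧ (2 + dStar ν) * (ν - 1 + dStar ν) = 4 * (ν - 1) ∧
      pS ν = ((1 + (2 + dStar ν) / (ν - 1) : ℝ) : EReal) := by
  have hd : dStar ν = (-1 - ν + Real.sqrt (ν ^ 2 + 10 * ν - 7)) / 2 := if_pos hν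
  have hq : 0 ≤ ν ^ 2 + 10 * ν - 7 := by nlinarith
  have hs := Real.sq_sqrt hq
  have hlt : 1 + ν < Real.sqrt (ν ^ 2 + 10 * ν - 7) :=
    Real.lt_sqrt_of_sq_lt (by nlinarith)
  set S := Real.sqrt (ν ^ 2 + 10 * ν - 7) with hS
  refine ⟨by rw [hd]; linarith, by rw [hd]; linarith, ?_⟩
  rw [pS, if_pos hν, ← hS, hd]
  congr 1
  have : ν - 1 ≠ 0 := by linarith
  field_simp
  ring

/-- In terms of w = (ν-1)(p-1), the quadratic (ν-1) γ_S factors with roots 2 + x and -(ν-1+x), where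
x = d_*. -/
theorem gammaS_pos_of_lt {p ν : ℝ} (hν : 1 < ν) (hp : 1 < p)
    (h : (ν - 1) * (p - 1) < 2 + dStar ν) : 0 < gammaS p ν := by
  obtain ⟨h0, h1, -⟩ := dStar_spec hν
  set x := dStar ν
  set w := (ν - 1) * (p - 1) with hw
  have hw0 : 0 < w := mul_pos (by linarith) (by linarith)
  have e : (ν - 1) * gammaS p ν = (2 + x - w) * (w + (ν - 1 + x)) := by
    rw [gammaS]
    have : (2 + x - w) * (w + (ν - 1 + x)) = 4 * (ν - 1) + (3 - ν) * w - w ^ 2 := by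
      linear_combination h1
    rw [this, hw]; ring
  have : 0 < (ν - 1) * gammaS p ν := by
    rw [e]; exact mul_pos (by linarith) (by linarith)
  exact pos_of_mul_pos_right this (by linarith)

theorem gammaS_one_pos {p : ℝ} (hp : 1 < p) : 0 < gammaS p 1 := by
  rw [gammaS]; nlinarith

theorem lt_pS_iff {p ν : ℝ} (hν : 1 < ν) :
    (p : EReal) < pS ν ↔ (ν - 1) * (p - 1) < 2 + dStar ν := by
  rw [(dStar_spec hν).2.2, EReal.coe_lt_coe_iff, ← sub_lt_iff_lt_add', lt_div_iff₀ (by linarith),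
    mul_comm]

theorem gammaF_pos_iff {p h : ℝ} (hp : 1 < p) : 0 < gammaF p h ↔ (p : EReal) < pF h := by
  rw [gammaF, pF]
  split_ifs with hh
  · rw [EReal.coe_lt_coe_iff, ← sub_lt_iff_lt_add', lt_div_iff₀ hh, mul_comm (p - 1)]
    constructor <;> intro _ <;> linarith
  · simp only [EReal.coe_lt_top, iff_true]
    nlinarith

/-- Positivity of `γ_F` in the heat-like region `D < d_*`. -/
theorem gammaF_pos_of_lt {p ν D : ℝ} (hν : 1 < ν) (hp : 1 < p) (hD : D < dStar ν)
    (h : (ν - 1) * (p - 1) < 2 + dStar ν) : 0 < gammaF p ((ν - 1 + D) / 2) := by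
  obtain ⟨h0, h1, -⟩ := dStar_spec hν
  set x := dStar ν
  set w := (ν - 1) * (p - 1) with hw
  have hw0 : 0 < w := mul_pos (by linarith) (by linarith)
  -- Both factors are below those of (ν-1+x)(2+x) = 4(ν-1), with x = d_*.
  have hkey : (ν - 1 + D) * w < 4 * (ν - 1) := by
    rcases le_or_gt (ν - 1 + D) 0 with hs | hs
    · nlinarith
    · rw [← h1, mul_comm (2 + x)]
      exact mul_lt_mul'' (by linarith) h hs.le hw0.le
  have e : (ν - 1) * gammaF p ((ν - 1 + D) / 2) = (4 * (ν - 1) - (ν - 1 + D) * w) / 2 := by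
    rw [gammaF, hw]; ring
  have : 0 < (ν - 1) * gammaF p ((ν - 1 + D) / 2) := by rw [e]; linarith
  exact pos_of_mul_pos_right this (by linarith)

/-- Positivity of `γ_S` in the wave-like region `d_* ≤ D`. -/
theorem gammaS_pos_of_gammaF_pos {p ν D : ℝ} (hν : 1 < ν) (hp : 1 < p) (hD : dStar ν ≤ D)
    (h : 0 < gammaF p ((ν - 1 + D) / 2)) : 0 < gammaS p ν := by
  refine gammaS_pos_of_lt hν hp ?_
  obtain ⟨h0, h1, -⟩ := dStar_spec hν
  set x := dStar ν
  rw [gammaF] at h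
  have h2 : (ν - 1 + x) * (p - 1) < 4 := by nlinarith
  have h3 : (ν - 1) * ((ν - 1 + x) * (p - 1)) < (ν - 1) * 4 :=
    mul_lt_mul_of_pos_left h2 (by linarith)
  have h4 : (ν - 1 + x) * ((ν - 1) * (p - 1)) < (ν - 1 + x) * (2 + x) := by linarith
  exact lt_of_mul_lt_mul_left h4 (by linarith)

/-- Positivity amounts to (p-1)(1+μ₁+√δ) < 4. Below or at θ this is immediate from the formula for
r_*; above θ it needs the quadratic of which θ is the smaller root. -/
theorem gammaF_pos_of_lt_rStar {μ₁ δ p : ℝ} (hμ₁ : 0 ≤ μ₁) (hδ1 : δ < 1)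
    (h : p < rStar μ₁ δ) : 0 < gammaF p ((μ₁ + 1 + Real.sqrt δ) / 2) := by
  set s := Real.sqrt δ with hs
  have hs0 : 0 ≤ s := Real.sqrt_nonneg δ
  have hs1 : s < 1 := by rw [hs, Real.sqrt_lt' one_pos]; simpa using hδ1
  have hden : 0 < 1 + μ₁ + s := by linarith
  have hmain : (p - 1) * (1 + μ₁ + s) < 4 := by
    rw [rStar] at h
    rw [← hs] at h
    have hA : p < 1 + 2 * ((2 - s) / (1 + μ₁ + s)) → (p - 1) * (1 + μ₁ + s) < 4 := by
      intro h
      rw [← mul_div_assoc, ← sub_lt_iff_lt_add', lt_div_iff₀ hden] at h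
      linarith
    split_ifs at h with h1 h2
    · exact hA h
    · rw [← h2] at h
      exact hA h
    · have hθ : theta μ₁ < s := lt_of_le_of_ne (not_lt.1 h1) (Ne.symm h2)
      rw [theta] at hθ
      -- The roots are θ and 1 + μ₁/2 + √(μ₁²+16)/2; s exceeds the first and, being below 1, lies
      -- under the second.
      have hq : s ^ 2 - (2 + μ₁) * s + μ₁ - 3 < 0 := by
        have hr := Real.sq_sqrt (by positivity : 0 ≤ μ₁ ^ 2 + 16)
        have hr0 := Real.sqrt_nonneg (μ₁ ^ 2 + 16)
        set r := Real.sqrt (μ₁ ^ 2 + 16)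
        have h5 : 0 < (s - (1 + μ₁ / 2 - r / 2)) * ((1 + μ₁ / 2 + r / 2) - s) :=
          mul_pos (by linarith) (by linarith)
        nlinarith
      rw [lt_div_iff₀ (by linarith)] at h
      have h6 : (p - 1) * (1 + s) < 1 - s := by linarith
      have h7 : (p - 1) * (1 + s) * (1 + μ₁ + s) < (1 - s) * (1 + μ₁ + s) :=
        mul_lt_mul_of_pos_right h6 hden
      have h8 : (1 - s) * (1 + μ₁ + s) ≤ 4 * (1 + s) := by nlinarith
      have h9 : (1 + s) * ((p - 1) * (1 + μ₁ + s)) < (1 + s) * 4 := by linarith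
      exact lt_of_mul_lt_mul_left h9 (by linarith)
  rw [gammaF]
  linarith

end ScaleInvWave

/-! ### Choice of constants and case distinction. -/

theorem theorem1p3 (n : ℕ) (hn : 1 ≤ n) (μ₁ μ₂ δ p R : ℝ)
    (hμ₁ : 0 ≤ μ₁) (hδ_def : δ = ScaleInvWave.delta μ₁ μ₂) (hδ : 0 ≤ δ)
    (hp : 1 < p) (hpc : (p : EReal) < ScaleInvWave.pCrit n μ₁ δ)
    (f g : ScaleInvWave.L2 n) (hf : ScaleInvWave.MemH1 f)
    (hf_nonneg : 0 ≤ f) (hf_ne : f ≠ 0)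
    (hh : ((μ₁ - 1 + Real.sqrt δ) / 2) • f + g = 0)
    (hR : 1 ≤ R) :
    ∃ ε₄ : ℝ, 0 < ε₄ ∧ ∃ C : ℝ, 0 < C ∧ ∀ ε : ℝ, 0 < ε → ε ≤ ε₄ →
      (Real.sqrt δ ≤ n - ScaleInvWave.dStar (n + μ₁) →
        ScaleInvWave.WaveBound n μ₁ p C ε (ScaleInvWave.lifespan μ₁ μ₂ p f g R ε)) ∧
      (n - ScaleInvWave.dStar (n + μ₁) < Real.sqrt δ → Real.sqrt δ < n + 2 →
        ((p : EReal) < ScaleInvWave.pStar n μ₁ δ →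
          ScaleInvWave.WaveBound n μ₁ p C ε (ScaleInvWave.lifespan μ₁ μ₂ p f g R ε)) ∧
        ((p : EReal) = ScaleInvWave.pStar n μ₁ δ →
          ScaleInvWave.MixedBound n μ₁ δ p (2 - Real.sign δ) C ε
            (ScaleInvWave.lifespan μ₁ μ₂ p f g R ε)) ∧
        (ScaleInvWave.pStar n μ₁ δ < (p : EReal) →
          ScaleInvWave.MixedBound n μ₁ δ p (1 - Real.sign δ) C ε
            (ScaleInvWave.lifespan μ₁ μ₂ p f g R ε))) ∧
      (n + 2 ≤ Real.sqrt δ →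
        ScaleInvWave.MixedBound n μ₁ δ p (1 - Real.sign δ) C ε
          (ScaleInvWave.lifespan μ₁ μ₂ p f g R ε)) ∧
      (n = 1 → δ < 1 → p < ScaleInvWave.rStar μ₁ δ →
        ScaleInvWave.lifespan μ₁ μ₂ p f g R ε ≤ ENNReal.ofReal
          (C * ε ^ (-(p - 1) / ScaleInvWave.gammaF p ((μ₁ + 1 + Real.sqrt δ) / 2)))) := by
  open ScaleInvWave in
  set σ := Real.sqrt δ with hσ
  have hσ0 : 0 ≤ σ := Real.sqrt_nonneg δ
  have hσ2 : σ ^ 2 = (μ₁ - 1) ^ 2 - 4 * μ₂ := by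
    rw [hσ, Real.sq_sqrt hδ, hδ_def, delta]
  have hsign : Real.sign σ = Real.sign δ := by
    rcases hδ.eq_or_lt with h | h
    · rw [hσ, ← h, Real.sqrt_zero]
    · rw [Real.sign_of_pos h, Real.sign_of_pos (Real.sqrt_pos.2 h)]
  have hsign1 : Real.sign δ ≤ 1 := by
    rcases Real.sign_apply_eq δ with h | h | h <;> rw [h] <;> norm_num
  have hp0 : 0 < p := by linarith
  have hp1 : 0 < p - 1 := by linarith
  have hn1 : (1 : ℝ) ≤ n := by exact_mod_cast hn
  obtain ⟨C, hC, hctrl⟩ := exists_time_control hn hR hp hσ0 hσ2 hh hf_nonneg hf_ne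
  rw [hsign] at hctrl
  set ν := (n : ℝ) + μ₁ with hν
  have hν1 : 1 ≤ ν := by linarith
  have hdim : heatDim n μ₁ δ = (ν - 1 + (n - σ)) / 2 := by rw [heatDim]; ring
  have hdim' : (n : ℝ) + (μ₁ - 1 - σ) / 2 = heatDim n μ₁ δ := rfl
  rw [hdim'] at hctrl
  -- Positivity of γ sits behind the choice of the constant, so that all constants exist before the
  -- regimes are distinguished.
  have hmixed : ∀ c : ℝ, 0 ≤ c → ∃ C₀ : ℝ, 0 < gammaF p (heatDim n μ₁ δ) → ∀ C₁ : ℝ, C₀ ≤ C₁ →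
      ∀ ε : ℝ, 0 < ε → ε ≤ 1 →
      (∀ (T τ : ℝ) (u ut : ℝ → L2 n) (Du : ℝ → L2vec n),
        IsEnergySolution μ₁ μ₂ p f g ε T u ut Du → SupportedInCone R T u → 15 ≤ τ → τ < T →
        ε ^ p * (1 + τ) ^ (gammaF p (heatDim n μ₁ δ) / (p - 1)) * Real.log (1 + τ) ^ c ≤ C) →
      MixedBound n μ₁ δ p c C₁ ε (lifespan μ₁ μ₂ p f g R ε) := by
    intro c hc
    by_cases hγ : 0 < gammaF p (heatDim n μ₁ δ)
    · have ha : 0 < gammaF p (heatDim n μ₁ δ) / (p - 1) := by positivity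
      obtain ⟨C₀, hC₀⟩ := exists_mixed_bound ha hc hp0 hC
      refine ⟨C₀, fun _ C₁ hC₁ ε hε hε1 h => ⟨exists_mixed_solution ha hc (by positivity), ?_⟩⟩
      rintro s ⟨hs, hs1⟩
      obtain ⟨h15, hle⟩ := hC₀ C₁ hC₁ ε hε hε1 s hs hs1
      exact lifespan_le h15 fun T τ u ut Du h1 h2 h3 h4 =>
        hle τ (by linarith) (h T τ u ut Du h1 h2 h3 h4)
    · exact ⟨0, fun h => absurd h hγ⟩
  have hwave : ∃ C₀ : ℝ, 0 < gammaS p ν → ∀ C₁ : ℝ, C₀ ≤ C₁ → ∀ ε : ℝ, 0 < ε → ε ≤ 1 →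
      WaveBound n μ₁ p C₁ ε (lifespan μ₁ μ₂ p f g R ε) := by
    by_cases hγ : 0 < gammaS p ν
    · obtain ⟨C₀, hC₀⟩ := exists_power_bound (a := gammaS p ν / (2 * (p - 1))) (by positivity)
        hp0.le hC
      refine ⟨C₀, fun _ C₁ hC₁ ε hε hε1 => ?_⟩
      obtain ⟨h15, hle⟩ := hC₀ C₁ hC₁ ε hε hε1
      have e : -p / (gammaS p ν / (2 * (p - 1))) = -(2 * p * (p - 1)) / gammaS p ν := by
        field_simp
      rw [e] at h15 hle
      exact lifespan_le h15 fun T τ u ut Du h1 h2 h3 h4 =>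
        hle τ (by linarith) (hctrl ε T τ u ut Du h1 h2 hε h3 h4).2.1
    · exact ⟨0, fun h => absurd h hγ⟩
  have hlin : ∃ C₀ : ℝ, n = 1 → 0 < gammaF p ((μ₁ + 1 + σ) / 2) → ∀ C₁ : ℝ, C₀ ≤ C₁ →
      ∀ ε : ℝ, 0 < ε → ε ≤ 1 → lifespan μ₁ μ₂ p f g R ε ≤ ENNReal.ofReal
        (C₁ * ε ^ (-(p - 1) / gammaF p ((μ₁ + 1 + σ) / 2))) := by
    by_cases hγ : 0 < gammaF p ((μ₁ + 1 + σ) / 2)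
    · obtain ⟨C₀, hC₀⟩ := exists_power_bound (a := gammaF p ((μ₁ + 1 + σ) / 2) / (p - 1))
        (by positivity) zero_le_one hC
      refine ⟨C₀, fun hn1 _ C₁ hC₁ ε hε hε1 => ?_⟩
      obtain ⟨h15, hle⟩ := hC₀ C₁ hC₁ ε hε hε1
      have e : -1 / (gammaF p ((μ₁ + 1 + σ) / 2) / (p - 1))
          = -(p - 1) / gammaF p ((μ₁ + 1 + σ) / 2) := by
        field_simp
      rw [e] at h15 hle
      refine lifespan_le h15 fun T τ u ut Du h1 h2 h3 h4 => hle τ (by linarith) ?_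
      refine le_trans (le_of_eq ?_) (hctrl ε T τ u ut Du h1 h2 hε h3 h4).1
      rw [Real.rpow_one, hn1, gammaF]
      congr 2
      push_cast
      field_simp
      ring
    · exact ⟨0, fun _ h => absurd h hγ⟩
  obtain ⟨Cw, hCw⟩ := hwave
  obtain ⟨C₁, hC₁⟩ := hmixed (1 - Real.sign δ) (by linarith)
  obtain ⟨C₂, hC₂⟩ := hmixed (2 - Real.sign δ) (by linarith)
  obtain ⟨Cl, hCl⟩ := hlin
  -- Subcriticality may come from either exponent in the maximum; for n - √δ < d_* being below the
  -- Strauss exponent also puts p below the Fujita one.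
  have heat_pos : n - σ < dStar ν → 1 < ν → 0 < gammaF p (heatDim n μ₁ δ) := by
    intro hD hν'
    rcases lt_max_iff.1 hpc with h | h
    · exact (gammaF_pos_iff hp).2 h
    · rw [hdim]
      exact gammaF_pos_of_lt hν' hp hD ((lt_pS_iff hν').1 h)
  refine ⟨1, one_pos, max 1 (max Cw (max C₁ (max C₂ Cl))), by positivity, fun ε hε hε1 => ?_⟩
  set K := max 1 (max Cw (max C₁ (max C₂ Cl))) with hK
  have k1 : Cw ≤ K := (le_max_left _ _).trans (le_max_right _ _)
  have k2' : max C₁ (max C₂ Cl) ≤ K := (le_max_right _ _).trans (le_max_right _ _)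
  have k2 : C₁ ≤ K := (le_max_left _ _).trans k2'
  have k3 : C₂ ≤ K := (le_max_left _ _).trans ((le_max_right _ _).trans k2')
  have k4 : Cl ≤ K := (le_max_right _ _).trans ((le_max_right _ _).trans k2')
  have wave (h : 0 < gammaS p ν) := hCw h K k1 ε hε hε1
  have heat (h : 0 < gammaF p (heatDim n μ₁ δ)) := hC₁ h K k2 ε hε hε1
    fun T τ u ut Du h1 h2 h3 h4 => (hctrl ε T τ u ut Du h1 h2 hε h3 h4).2.2.1
  refine ⟨fun hD => wave ?_, fun hD hD2 => ⟨fun hps => wave ?_, fun hps => ?_, fun hps => heat ?_⟩,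
    fun hD => heat ?_, fun h1 hδ1 hr => ?_⟩
  -- The degenerate value ν = 1, where the Strauss exponent and p_* are infinite, is treated
  -- separately in every regime.
  · rcases hν1.eq_or_lt with h | h
    · rw [← h]; exact gammaS_one_pos hp
    · rcases lt_max_iff.1 hpc with h' | h'
      · refine gammaS_pos_of_gammaF_pos h hp (D := n - σ) (by linarith) ?_
        rw [← hdim]
        exact (gammaF_pos_iff hp).2 h'
      · exact gammaS_pos_of_lt h hp ((lt_pS_iff h).1 h')
  · rcases hν1.eq_or_lt with h | h
    · rw [← h]; exact gammaS_one_pos hp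
    · rw [pStar, if_neg (by linarith), EReal.coe_lt_coe_iff, ← sub_lt_iff_lt_add',
        lt_div_iff₀ (by linarith)] at hps
      exact gammaS_pos_of_lt h hp (by linarith)
  · rcases hν1.eq_or_lt with h | h
    · rw [pStar, if_pos h.symm] at hps
      exact absurd hps (EReal.coe_ne_top p)
    · rw [pStar, if_neg (by linarith), EReal.coe_eq_coe_iff, ← sub_eq_iff_eq_add',
        eq_div_iff (by linarith)] at hps
      refine hC₂ ?_ K k3 ε hε hε1 fun T τ u ut Du h1 h2 h3 h4 =>
        (hctrl ε T τ u ut Du h1 h2 hε h3 h4).2.2.2 (by linarith)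
      exact heat_pos (by linarith) h
  · rcases hν1.eq_or_lt with h | h
    · rw [pStar, if_pos h.symm] at hps
      exact absurd hps (not_lt.2 le_top)
    · exact heat_pos (by linarith) h
  · rcases hν1.eq_or_lt with h | h
    · rw [hdim, ← h, gammaF]
      nlinarith
    · exact heat_pos (by linarith [(dStar_spec h).1]) h
  · exact hCl h1 (gammaF_pos_of_lt_rStar hμ₁ hδ1 hr) K k4 ε hε hε1
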